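/- **Posterior ratio consistency for hyper-pMOM priors with a complexity prior on the models.** *Setting.* For $n\ge 1$ let $X_n$ be a deterministic $n\times p_n$ design matrix. A model is a subset $\mathbf k\subseteq\{1,\dots,p_n\}$, of cardinality $|\mathbf k|$; $X_{\mathbf k}$ denotes the submatrix of the columns of $X_n$ in $\mathbf k$, and $A_{\mathbf k}$ the principal submatrix, with rows and columns in $\mathbf k$, of a symmetric $p_n\times p_n$ matrix $A_{p_n}$. Fix an integer $r\ge1$ and constants $\alpha_1,\alpha_2,c_1,c_2>0$. Consider the hierarchical model $$Y_n\mid \beta_{\mathbf k},\sigma^2,\mathbf k\sim N(X_{\mathbf k}\beta_{\mathbf k},\sigma^2 I_n),$$ $$\pi(\beta_{\mathbf k}\mid\tau,\sigma^2,\mathbf k)=d_{\mathbf k}(2\pi)^{-|\mathbf k|/2}(\tau\sigma^2)^{-r|\mathbf k|-|\mathbf k|/2}|A_{\mathbf k}|^{1/2}\exp\Big\{-\frac{\beta_{\mathbf k}^TA_{\mathbf k}\beta_{\mathbf k}}{2\tau\sigma^2}\Big\}\prod_{i\in\mathbf k}\beta_i^{2r},$$ $$\pi(\tau)=\frac{(n/2)^{1/2}}{\Gamma(1/2)}\tau^{-3/2}e^{-n/(2\tau)},\qquad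 \pi(\sigma^2)=\frac{\alpha_2^{\alpha_1}}{\Gamma(\alpha_1)}(\sigma^2)^{-(\alpha_1+1)}e^{-\alpha_2/\sigma^2}\qquad(\tau,\sigma^2>0),$$ where $d_{\mathbf k}$ is the normalizing constant, with the complexity prior on the models $$\pi(\mathbf k)\propto c_1^{-|\mathbf k|}p_n^{-c_2|\mathbf k|}\ \text{ if } |\mathbf k|\le q_n,\qquad \pi(\mathbf k)=0\ \text{ if }|\mathbf k|>q_n .$$ Let $m_{\mathbf k}(y)$ be the marginal density of $Y_n$ at $y$ under the model $\mathbf k$ (the integral of likelihood times priors over $\beta_{\mathbf k},\sigma^2,\tau$), and let $\pi(\mathbf k\mid y)=\pi(\mathbf k)m_{\mathbf k}(y)/\sum_{\mathbf l}\pi(\mathbf l)m_{\mathbf l}(y)$ be the posterior probability of $\mathbf k$. *Data.* The data are $y_n=X_n\beta_0+\epsilon_n$, where the entries of the random vector $\epsilon_n$ are i.i.d. $N(0,\sigma_0^2)$ with $\sigma_0^2>0$. The support $\mathbf t$ of $\beta_0$ is a finite set contained in $\{1,\dots,p_n\}$ for every $n\ge1$; and $\mathbf t$, the nonzero entries of $\beta_0$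 and $\sigma_0^2$ do not depend on $n$. *Assumptions.* 1. There are $\varepsilon_n$ with $0<\varepsilon_n<1$ and $\varepsilon_n^{-1}=O((\log n)^{1/8})$ such that for every $n\ge1$, every model $\mathbf k\subseteq\{1,\dots,p_n\}$ and every $1\le j\le\min(n,|\mathbf k|)$ one has $\varepsilon_n\le\nu_j\le\varepsilon_n^{-1}$, where $\nu_j$ is the $j$-th largest eigenvalue (counted with multiplicity) of $X_{\mathbf k}^TX_{\mathbf k}/n$. 2. $q_n=O(n^\xi)$ for some $\xi<1$, and $|\mathbf t|\le q_n$ for all large $n$. 3. There are constants $0<a_1<a_2<\infty$ such that for every $n\ge1$ all eigenvalues of $A_{p_n}$ lie in $(a_1,a_2)$. 4. $\log p_n=O(n^\kappa)$ for some $0<\kappa<1$. *Conclusion.* As $n\to\infty$, $$\max_{\mathbf k\ne\mathbf t}\frac{\pi(\mathbf k\mid y_n)}{\pi(\mathbf t\mid y_n)}\longrightarrow0\quad\text{in probability},$$ where the maximum is over all models $\mathbf k\subseteq\{1,\dots,p_n\}$ with $\mathbf k\ne\mathbf t$ (and is $0$ if there is none). -/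

import Mathlib

open MeasureTheory ProbabilityTheory Filter Matrix
open scoped NNReal ENNReal Topology

noncomputable section

namespace HyperPMOM

/- A model is a finite set `k : Finset (Fin p)` of column indices; `k` also denotes the subtype of
its elements, so that a coefficient vector of the model is a function `β : k → ℝ`. -/

/-- The design matrix `X_k`: the columns of `X` that belong to the model `k`. -/
def subDesign {n p : ℕ} (X : Matrix (Fin n) (Fin p) ℝ) (k : Finset (Fin p)) :
    Matrix (Fin n) k ℝ :=
  X.submatrix id Subtype.val

/-- The principal submatrix `A_k`. -/
def subPrec {p : ℕ} (A : Matrix (Fin p) (Fin p) ℝ) (k : Finset (Fin p)) : Matrix k k ℝ :=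
  A.submatrix Subtype.val Subtype.val

/-- The scaled Gram matrix `X_kᵀ X_k / n`. -/
def scaledGram {n p : ℕ} (X : Matrix (Fin n) (Fin p) ℝ) (k : Finset (Fin p)) : Matrix k k ℝ :=
  (n : ℝ)⁻¹ • ((subDesign X k)ᵀ * subDesign X k)

theorem scaledGram_isHermitian {n p : ℕ} (X : Matrix (Fin n) (Fin p) ℝ) (k : Finset (Fin p)) :
    (scaledGram X k).IsHermitian := by
  ext i j
  simp [scaledGram, Matrix.mul_apply, Matrix.conjTranspose_apply, mul_comm]

/-- For every model `k`, the `min(n, |k|)` largest eigenvalues (with multiplicity) of the positive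
semidefinite matrix `X_kᵀ X_k / n` lie in `[ε, ε⁻¹]`. `eigenvalues₀` lists the `|k|` eigenvalues in
decreasing order, starting with index `0`; as `ε` will be positive, the entry with index `j - 1` is
the `j`-th largest nonzero eigenvalue, for `1 ≤ j ≤ min(n, |k|)`. -/
def DesignEigenBounds {n p : ℕ} (X : Matrix (Fin n) (Fin p) ℝ) (ε : ℝ) : Prop :=
  ∀ (k : Finset (Fin p)) (j : Fin (Fintype.card k)), (j : ℕ) < min n k.card →
    ε ≤ (scaledGram_isHermitian X k).eigenvalues₀ j ∧
      (scaledGram_isHermitian X k).eigenvalues₀ j ≤ ε⁻¹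

/-- `A` is symmetric and all its eigenvalues lie in the open interval `(a₁, a₂)`. -/
def EigenvaluesBetween {p : ℕ} (A : Matrix (Fin p) (Fin p) ℝ) (a₁ a₂ : ℝ) : Prop :=
  ∃ h : A.IsHermitian, ∀ i, a₁ < h.eigenvalues i ∧ h.eigenvalues i < a₂

/-- The density at `y` of `N(X_k β, s I_n)`, where `s = σ²`. -/
def likelihood {n p : ℕ} (X : Matrix (Fin n) (Fin p) ℝ) (k : Finset (Fin p)) (y : Fin n → ℝ)
    (β : k → ℝ) (s : ℝ) : ℝ :=
  (2 * Real.pi * s) ^ (-((n : ℝ) / 2)) *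
    Real.exp (-(((y - subDesign X k *ᵥ β) ⬝ᵥ (y - subDesign X k *ᵥ β)) / (2 * s)))

/-- The pMOM prior density of order `r` without its normalizing constant; `v` is `τ σ²`. -/
def pmomKernel {p : ℕ} (A : Matrix (Fin p) (Fin p) ℝ) (r : ℕ) (k : Finset (Fin p))
    (β : k → ℝ) (v : ℝ) : ℝ :=
  (2 * Real.pi) ^ (-((k.card : ℝ) / 2)) * v ^ (-((r : ℝ) * k.card) - (k.card : ℝ) / 2) *
    Real.sqrt (subPrec A k).det * Real.exp (-((β ⬝ᵥ (subPrec A k *ᵥ β)) / (2 * v))) *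
    ∏ i, β i ^ (2 * r)

/-- The normalizing constant `d_k`. The integral of `pmomKernel` over `β` is the same for every
`v > 0` (substitute `β = √v b`), so that it may be computed at `v = 1`. -/
def pmomConst {p : ℕ} (A : Matrix (Fin p) (Fin p) ℝ) (r : ℕ) (k : Finset (Fin p)) : ℝ :=
  (∫ β : k → ℝ, pmomKernel A r k β 1)⁻¹

/-- The pMOM prior density of `β_k` given `τ` and `s = σ²`. -/
def pmomDensity {p : ℕ} (A : Matrix (Fin p) (Fin p) ℝ) (r : ℕ) (k : Finset (Fin p))
    (β : k → ℝ) (τ s : ℝ) : ℝ :=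
  pmomConst A r k * pmomKernel A r k β (τ * s)

/-- The Inverse-Gamma`(1/2, n/2)` prior density of `τ`. -/
def tauDensity (n : ℕ) (τ : ℝ) : ℝ :=
  ((n : ℝ) / 2) ^ (1 / 2 : ℝ) / Real.Gamma (1 / 2) * τ ^ (-(3 / 2) : ℝ) *
    Real.exp (-((n : ℝ) / (2 * τ)))

/-- The Inverse-Gamma`(α₁, α₂)` prior density of `s = σ²`. -/
def sigmaSqDensity (α₁ α₂ s : ℝ) : ℝ :=
  α₂ ^ α₁ / Real.Gamma α₁ * s ^ (-(α₁ + 1)) * Real.exp (-(α₂ / s))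

/-- The marginal density `m_k(y)`: the integral over `β`, `s = σ²` and `τ` of likelihood times
priors. The integrand is nonnegative, so the integral is a Lebesgue integral with values in
`[0, ∞]`. -/
def marginal {n p : ℕ} (X : Matrix (Fin n) (Fin p) ℝ) (A : Matrix (Fin p) (Fin p) ℝ) (r : ℕ)
    (α₁ α₂ : ℝ) (k : Finset (Fin p)) (y : Fin n → ℝ) : ℝ :=
  (∫⁻ τ in Set.Ioi (0 : ℝ), ∫⁻ s in Set.Ioi (0 : ℝ), ∫⁻ β : k → ℝ,
    ENNReal.ofReal (likelihood X k y β s * pmomDensity A r k β τ s * tauDensity n τ *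
      sigmaSqDensity α₁ α₂ s)).toReal

/-- The unnormalized complexity prior weight `c₁^{-|k|} p^{-c₂ |k|}` of the model `k`, set to `0`
for the models with more than `q` elements. -/
def priorWeight {p : ℕ} (q c₁ c₂ : ℝ) (k : Finset (Fin p)) : ℝ :=
  if (k.card : ℝ) ≤ q then c₁ ^ (-(k.card : ℝ)) * (p : ℝ) ^ (-(c₂ * k.card)) else 0

/-- The complexity prior `π(k)` on the models. -/
def modelPrior {p : ℕ} (q c₁ c₂ : ℝ) (k : Finset (Fin p)) : ℝ :=
  priorWeight q c₁ c₂ k / ∑ l : Finset (Fin p), priorWeight q c₁ c₂ l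

/-- The posterior probability `π(k | y) = π(k) m_k(y) / π(y)`, with `π(y) = ∑_l π(l) m_l(y)`. -/
def posterior {n p : ℕ} (X : Matrix (Fin n) (Fin p) ℝ) (A : Matrix (Fin p) (Fin p) ℝ) (r : ℕ)
    (α₁ α₂ q c₁ c₂ : ℝ) (k : Finset (Fin p)) (y : Fin n → ℝ) : ℝ :=
  modelPrior q c₁ c₂ k * marginal X A r α₁ α₂ k y /
    ∑ l : Finset (Fin p), modelPrior q c₁ c₂ l * marginal X A r α₁ α₂ l y

/-- The true model `t`: the indices below `p` at which the coefficient sequence is nonzero. -/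
def trueModel (p : ℕ) (β₀ : ℕ →₀ ℝ) : Finset (Fin p) :=
  Finset.univ.filter fun j => β₀ j ≠ 0

/-- The response vector `y = X β₀ + e`. -/
def response {n p : ℕ} (X : Matrix (Fin n) (Fin p) ℝ) (β₀ : ℕ →₀ ℝ) (e : Fin n → ℝ) :
    Fin n → ℝ :=
  X *ᵥ (fun j : Fin p => β₀ j) + e

/-- `max_{k ≠ t} π(k | y) / π(t | y)`; a supremum over a finite family of nonnegative numbers, equal
to `0` if there is no model other than `t`. -/
def maxPosteriorRatio {n p : ℕ} (X : Matrix (Fin n) (Fin p) ℝ) (A : Matrix (Fin p) (Fin p) ℝ)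
    (r : ℕ) (α₁ α₂ q c₁ c₂ : ℝ) (t : Finset (Fin p)) (y : Fin n → ℝ) : ℝ :=
  ⨆ k : {k : Finset (Fin p) // k ≠ t},
    posterior X A r α₁ α₂ q c₁ c₂ k.1 y / posterior X A r α₁ α₂ q c₁ c₂ t y

end HyperPMOM

end

/-
Integrating out the coefficients and both scales, the prior weight times the marginal density of a
model is, up to an explicit exponential factor, the Gaussian likelihood maximized over the variance,
`W ↦ (2πeW/n)^{-n/2}`, at a residual sum of squares `W`. An upper bound for every model and a lower
bound for the true model `t` reduce the theorem to a comparison of exponents.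

If `k` strictly contains `t`, each superfluous variable raises the log-likelihood by at most about
`(5/4) log n`, through the projection of the noise. The nonlocal prior charges more: per variable
the integral over the coefficient contributes `(n ε)^{-(r + 1/2)}`, and `τ^{-(r + 1/2)}`, integrated
against the prior of `τ`, contributes `(|k| / n)^{r + 1/2}`. Even when `|k|` is of order `n`, at
least `(3/2) log n` is lost, so that a negative power of `n` remains.
If `k` misses a variable of `t`, the eigenvalue bounds leave a multiple of `n ε` of the signal in
the residual sum of squares, and the factor `exp (-η n ε)` beats every term of order
`(|q| + 1) log n`.

The noise has to be controlled on all models containing `t` at once. The exponential moments of the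
squared projections allow a union bound, because the Gram matrix of all `p` columns has rank at most
`n` and trace at least `p ε`, which forces `p ≤ n ε⁻²`.
-/

noncomputable section

namespace HyperPMOM

lemma dotProduct_self_nonneg {ι : Type*} [Fintype ι] (v : ι → ℝ) : 0 ≤ v ⬝ᵥ v := by
  simpa using dotProduct_self_star_nonneg v

lemma dotProduct_self_pos {ι : Type*} [Fintype ι] {v : ι → ℝ} (hv : v ≠ 0) : 0 < v ⬝ᵥ v :=
  (dotProduct_self_nonneg v).lt_of_ne' (mt dotProduct_self_eq_zero.1 hv)

lemma mulVec_dotProduct {m ι : Type*} [Fintype m] [Fintype ι] (M : Matrix m ι ℝ) (v : ι → ℝ)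
    (w : m → ℝ) : (M *ᵥ v) ⬝ᵥ w = v ⬝ᵥ (Mᵀ *ᵥ w) := by
  rw [Matrix.dotProduct_transpose_mulVec, dotProduct_comm]

section QuadraticForm

variable {ι : Type*} [Fintype ι] [DecidableEq ι]

lemma exists_quadForm_eq_sum_eigenvalues {H : Matrix ι ι ℝ} (hH : H.IsHermitian) (v : ι → ℝ) :
    ∃ w : ι → ℝ, w ⬝ᵥ w = v ⬝ᵥ v ∧ v ⬝ᵥ (H *ᵥ v) = ∑ i, hH.eigenvalues i * w i ^ 2 := by
  set U : Matrix ι ι ℝ := (hH.eigenvectorUnitary : Matrix ι ι ℝ)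
  have unitary : U * Uᵀ = 1 := by
    simpa [Matrix.star_eq_conjTranspose] using
      (Matrix.mem_unitaryGroup_iff (A := U)).1 hH.eigenvectorUnitary.2
  have spectral : H = U * diagonal hH.eigenvalues * Uᵀ := by
    simpa [Unitary.conjStarAlgAut_apply, Matrix.star_eq_conjTranspose] using hH.spectral_theorem
  refine ⟨Uᵀ *ᵥ v, ?_, ?_⟩
  · rw [mulVec_dotProduct, transpose_transpose, Matrix.mulVec_mulVec, unitary, Matrix.one_mulVec]
  · conv_lhs => rw [spectral]
    rw [← Matrix.mulVec_mulVec, ← Matrix.mulVec_mulVec, Matrix.dotProduct_mulVec,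
      ← Matrix.mulVec_transpose]
    simp only [dotProduct, Matrix.mulVec_diagonal]
    exact Finset.sum_congr rfl fun i _ => by ring

lemma quadForm_mem_Icc_of_eigenvalues {H : Matrix ι ι ℝ} (hH : H.IsHermitian) {a b : ℝ}
    (h : ∀ i, hH.eigenvalues i ∈ Set.Icc a b) (v : ι → ℝ) :
    v ⬝ᵥ (H *ᵥ v) ∈ Set.Icc (a * (v ⬝ᵥ v)) (b * (v ⬝ᵥ v)) := by
  obtain ⟨w, hw, hv⟩ := exists_quadForm_eq_sum_eigenvalues hH v
  rw [hv, ← hw]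
  simp only [dotProduct, Finset.mul_sum, ← sq]
  exact ⟨Finset.sum_le_sum fun i _ => mul_le_mul_of_nonneg_right (h i).1 (sq_nonneg _),
    Finset.sum_le_sum fun i _ => mul_le_mul_of_nonneg_right (h i).2 (sq_nonneg _)⟩

end QuadraticForm

section FullColumnRank

variable {m ι : Type*} [Fintype m] [Fintype ι]

lemma posDef_transpose_mul_self {M : Matrix m ι ℝ} (hM : Function.Injective M.mulVec) :
    (Mᵀ * M).PosDef := by
  simpa using Matrix.PosDef.conjTranspose_mul_self M hM

lemma exists_pos_mul_le_mulVec_dotProduct_self {M : Matrix m ι ℝ}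
    (hM : Function.Injective M.mulVec) :
    ∃ c > 0, ∀ v, c * (v ⬝ᵥ v) ≤ (M *ᵥ v) ⬝ᵥ (M *ᵥ v) := by
  classical
  have hpd := posDef_transpose_mul_self hM
  obtain ⟨c, hc, hle⟩ : ∃ c > 0, ∀ i, c ≤ hpd.1.eigenvalues i := by
    rcases isEmpty_or_nonempty ι with _ | _
    · exact ⟨1, one_pos, isEmptyElim⟩
    · obtain ⟨i, hi⟩ := Finite.exists_min hpd.1.eigenvalues
      exact ⟨_, hpd.eigenvalues_pos i, hi⟩
  refine ⟨c, hc, fun v => ?_⟩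
  rw [mulVec_dotProduct, Matrix.mulVec_mulVec]
  exact (quadForm_mem_Icc_of_eigenvalues hpd.1
    (fun i => ⟨hle i, Finset.single_le_sum (fun j _ => (hpd.eigenvalues_pos j).le)
      (Finset.mem_univ i)⟩) v).1

end FullColumnRank

section LeastSquares

variable {m ι : Type*} [Fintype m] [Fintype ι] [DecidableEq ι]

/-- The least squares coefficients of `e` on the columns of `M`. The normal equations are solved
with the matrix inverse, which is meaningful only if the columns of `M` are linearly independent. -/
def lsq (M : Matrix m ι ℝ) (e : m → ℝ) : ι → ℝ := (Mᵀ * M)⁻¹ *ᵥ (Mᵀ *ᵥ e)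

/-- The squared length of the projection of `e` on the column space of `M`: the part of the
residual sum of squares that the model with design matrix `M` explains. -/
def projSq (M : Matrix m ι ℝ) (e : m → ℝ) : ℝ := (M *ᵥ lsq M e) ⬝ᵥ (M *ᵥ lsq M e)

lemma projSq_nonneg (M : Matrix m ι ℝ) (e : m → ℝ) : 0 ≤ projSq M e := dotProduct_self_nonneg _

lemma mulVec_dotProduct_mulVec_lsq {M : Matrix m ι ℝ} (hM : Function.Injective M.mulVec)
    (e : m → ℝ) (v : ι → ℝ) : (M *ᵥ v) ⬝ᵥ (M *ᵥ lsq M e) = (M *ᵥ v) ⬝ᵥ e := by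
  have hdet : IsUnit (Mᵀ * M).det := (posDef_transpose_mul_self hM).det_pos.ne'.isUnit
  rw [mulVec_dotProduct, mulVec_dotProduct, Matrix.mulVec_mulVec, lsq, Matrix.mulVec_mulVec,
    Matrix.mul_nonsing_inv _ hdet, Matrix.one_mulVec]

lemma sub_mulVec_dotProduct_self {M : Matrix m ι ℝ} (hM : Function.Injective M.mulVec)
    (e : m → ℝ) (v : ι → ℝ) :
    (e - M *ᵥ v) ⬝ᵥ (e - M *ᵥ v) =
      e ⬝ᵥ e - projSq M e + (M *ᵥ (v - lsq M e)) ⬝ᵥ (M *ᵥ (v - lsq M e)) := by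
  have normal_v := mulVec_dotProduct_mulVec_lsq hM e v
  rw [projSq, Matrix.mulVec_sub]
  simp only [sub_dotProduct, dotProduct_sub, dotProduct_comm e (M *ᵥ v),
    dotProduct_comm (M *ᵥ lsq M e) (M *ᵥ v)]
  linarith

end LeastSquares

section Design

variable {n p : ℕ}

lemma quadForm_scaledGram (X : Matrix (Fin n) (Fin p) ℝ) (k : Finset (Fin p)) (v : k → ℝ) :
    v ⬝ᵥ (scaledGram X k *ᵥ v) =
      (n : ℝ)⁻¹ * ((subDesign X k *ᵥ v) ⬝ᵥ (subDesign X k *ᵥ v)) := by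
  rw [scaledGram, Matrix.smul_mulVec, dotProduct_smul, ← Matrix.mulVec_mulVec,
    ← mulVec_dotProduct, smul_eq_mul]

lemma DesignEigenBounds.subDesign_mem_Icc {X : Matrix (Fin n) (Fin p) ℝ} {ε : ℝ}
    (h : DesignEigenBounds X ε) (hn : 1 ≤ n) {k : Finset (Fin p)} (hk : k.card ≤ n) (v : k → ℝ) :
    (subDesign X k *ᵥ v) ⬝ᵥ (subDesign X k *ᵥ v) ∈
      Set.Icc (n * ε * (v ⬝ᵥ v)) (n * ε⁻¹ * (v ⬝ᵥ v)) := by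
  have hn₀ : (0 : ℝ) < n := by exact_mod_cast hn
  have lt_min (j : Fin (Fintype.card k)) : (j : ℕ) < min n k.card := by
    rw [min_eq_right hk]
    simpa using j.2
  obtain ⟨hlow, hupp⟩ := quadForm_mem_Icc_of_eigenvalues (scaledGram_isHermitian X k)
    (fun i => h k _ (lt_min _)) v
  rw [quadForm_scaledGram, le_inv_mul_iff₀ hn₀, ← mul_assoc] at hlow
  rw [quadForm_scaledGram, inv_mul_le_iff₀ hn₀, ← mul_assoc] at hupp
  exact ⟨hlow, hupp⟩

lemma DesignEigenBounds.injective_mulVec {X : Matrix (Fin n) (Fin p) ℝ} {ε : ℝ}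
    (h : DesignEigenBounds X ε) (hn : 1 ≤ n) (hε : 0 < ε) {k : Finset (Fin p)}
    (hk : k.card ≤ n) : Function.Injective (subDesign X k).mulVec := by
  refine (injective_iff_map_eq_zero (subDesign X k).mulVecLin).2 fun v hv => ?_
  by_contra hv₀
  have := (h.subDesign_mem_Icc hn hk v).1
  rw [← Matrix.mulVecLin_apply, hv, dotProduct_zero] at this
  have hn₀ : (0 : ℝ) < n := by exact_mod_cast hn
  exact this.not_gt (mul_pos (mul_pos hn₀ hε) (dotProduct_self_pos hv₀))

lemma rank_scaledGram_le (X : Matrix (Fin n) (Fin p) ℝ) (k : Finset (Fin p)) :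
    (scaledGram X k).rank ≤ n := by
  rw [scaledGram, ← Matrix.smul_mul]
  exact (Matrix.rank_mul_le_right _ _).trans ((Matrix.rank_le_card_height _).trans (by simp))

lemma DesignEigenBounds.trace_scaledGram_le {X : Matrix (Fin n) (Fin p) ℝ} {ε : ℝ}
    (h : DesignEigenBounds X ε) (hn : 1 ≤ n) (hε : 0 < ε) (k : Finset (Fin p)) :
    (scaledGram X k).trace ≤ n * ε⁻¹ := by
  set hG := scaledGram_isHermitian X k
  have eigenvalues_le (i : k) : hG.eigenvalues i ≤ ε⁻¹ := by
    have hcard : 0 < k.card := Finset.card_pos.2 ⟨i, i.2⟩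
    exact (hG.eigenvalues₀_antitone (Fin.le_def.2 (Nat.zero_le _))).trans
      (h k ⟨0, by simpa using hcard⟩ (lt_min hn hcard)).2
  have hcount : (Finset.univ.filter fun i => hG.eigenvalues i ≠ 0).card ≤ n := by
    rw [← Fintype.card_subtype, ← hG.rank_eq_card_non_zero_eigs]
    exact rank_scaledGram_le X k
  calc (scaledGram X k).trace = ∑ i with hG.eigenvalues i ≠ 0, hG.eigenvalues i := by
        rw [Finset.sum_filter_ne_zero, hG.trace_eq_sum_eigenvalues]
        simp
    _ ≤ (Finset.univ.filter fun i => hG.eigenvalues i ≠ 0).card * ε⁻¹ := by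
        rw [← nsmul_eq_mul]
        exact Finset.sum_le_card_nsmul _ _ _ fun i _ => eigenvalues_le i
    _ ≤ n * ε⁻¹ := by gcongr

lemma DesignEigenBounds.le_scaledGram_diag {X : Matrix (Fin n) (Fin p) ℝ} {ε : ℝ}
    (h : DesignEigenBounds X ε) (hn : 1 ≤ n) (k : Finset (Fin p)) (i : k) :
    ε ≤ scaledGram X k i i := by
  have column := (h.subDesign_mem_Icc hn (k := {i.1}) (by simpa using hn) (fun _ => 1)).1
  have entry : scaledGram X k i i = (n : ℝ)⁻¹ * ∑ l, X l i * X l i := by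
    simp [scaledGram, subDesign, Matrix.mul_apply]
  rw [entry, le_inv_mul_iff₀ (by exact_mod_cast hn)]
  simpa [dotProduct, Matrix.mulVec, subDesign] using column

/- The trace of the scaled Gram matrix of all the columns is at least `p ε`, while its rank is at
most `n`. -/
lemma DesignEigenBounds.card_le {X : Matrix (Fin n) (Fin p) ℝ} {ε : ℝ}
    (h : DesignEigenBounds X ε) (hn : 1 ≤ n) (hε : 0 < ε) : (p : ℝ) ≤ n * (ε⁻¹ * ε⁻¹) := by
  have hdiag : (p : ℝ) * ε ≤ (scaledGram X Finset.univ).trace := by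
    simpa [Matrix.trace] using Finset.card_nsmul_le_sum Finset.univ
      (fun i => scaledGram X Finset.univ i i) ε fun i _ => h.le_scaledGram_diag hn _ i
  rw [← mul_assoc, ← div_eq_mul_inv _ ε, le_div_iff₀ hε]
  exact hdiag.trans (h.trace_scaledGram_le hn hε _)

end Design

section Precision

variable {p : ℕ}

/-- The coefficient vector of all `p` columns with the entries `v` on the model `k` and `0`
elsewhere. -/
def extendZero {k : Finset (Fin p)} (v : k → ℝ) (j : Fin p) : ℝ :=
  if hj : j ∈ k then v ⟨j, hj⟩ else 0

lemma extendZero_coe {k : Finset (Fin p)} (v : k → ℝ) (j : k) : extendZero v j = v j := by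
  simp [extendZero]

lemma extendZero_of_notMem {k : Finset (Fin p)} (v : k → ℝ) {j : Fin p} (hj : j ∉ k) :
    extendZero v j = 0 := by
  simp [extendZero, hj]

lemma extendZero_dotProduct {k : Finset (Fin p)} (v : k → ℝ) (f : Fin p → ℝ) :
    extendZero v ⬝ᵥ f = ∑ j : k, v j * f j := by
  rw [dotProduct, ← Finset.sum_subset (Finset.subset_univ k), ← Finset.sum_coe_sort k]
  · simp only [extendZero_coe]
  · exact fun j _ hj => by rw [extendZero_of_notMem v hj, zero_mul]

lemma extendZero_dotProduct_extendZero {k : Finset (Fin p)} (v w : k → ℝ) :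
    extendZero v ⬝ᵥ extendZero w = v ⬝ᵥ w := by
  rw [extendZero_dotProduct]
  simp only [extendZero_coe, dotProduct]

lemma mulVec_extendZero {m : Type*} (M : Matrix m (Fin p) ℝ) {k : Finset (Fin p)} (v : k → ℝ) :
    M *ᵥ extendZero v = M.submatrix id (Subtype.val : k → Fin p) *ᵥ v := by
  ext i
  rw [Matrix.mulVec, dotProduct_comm, extendZero_dotProduct, Matrix.mulVec, dotProduct_comm]
  simp [dotProduct]

lemma quadForm_subPrec (A : Matrix (Fin p) (Fin p) ℝ) {k : Finset (Fin p)} (v : k → ℝ) :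
    v ⬝ᵥ (subPrec A k *ᵥ v) = extendZero v ⬝ᵥ (A *ᵥ extendZero v) := by
  rw [extendZero_dotProduct, mulVec_extendZero]
  rfl

lemma EigenvaluesBetween.quadForm_mem_Icc {A : Matrix (Fin p) (Fin p) ℝ} {a₁ a₂ : ℝ}
    (h : EigenvaluesBetween A a₁ a₂) {k : Finset (Fin p)} (v : k → ℝ) :
    v ⬝ᵥ (subPrec A k *ᵥ v) ∈ Set.Icc (a₁ * (v ⬝ᵥ v)) (a₂ * (v ⬝ᵥ v)) := by
  obtain ⟨hA, hev⟩ := h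
  rw [quadForm_subPrec, ← extendZero_dotProduct_extendZero v v]
  exact quadForm_mem_Icc_of_eigenvalues hA (fun i => ⟨(hev i).1.le, (hev i).2.le⟩) _

lemma EigenvaluesBetween.subPrec_posDef {A : Matrix (Fin p) (Fin p) ℝ} {a₁ a₂ : ℝ}
    (h : EigenvaluesBetween A a₁ a₂) (ha : 0 < a₁) (k : Finset (Fin p)) :
    (subPrec A k).PosDef := by
  refine Matrix.PosDef.of_dotProduct_mulVec_pos (h.1.submatrix _) fun v hv => ?_
  simpa using (mul_pos ha (dotProduct_self_pos hv)).trans_le (h.quadForm_mem_Icc v).1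

end Precision

lemma lintegral_ofReal_fintype_prod {ι : Type*} [Fintype ι] {μ : ι → Measure ℝ}
    [∀ i, SigmaFinite (μ i)] {f : ι → ℝ → ℝ} (hf : ∀ i, Integrable (f i) (μ i))
    (hf₀ : ∀ i x, 0 ≤ f i x) :
    ∫⁻ x, ENNReal.ofReal (∏ i, f i (x i)) ∂(Measure.pi μ) =
      ENNReal.ofReal (∏ i, ∫ x, f i x ∂(μ i)) := by
  rw [← ofReal_integral_eq_lintegral_ofReal (Integrable.fintype_prod hf)
    (ae_of_all _ fun x => Finset.prod_nonneg fun i _ => hf₀ i _), integral_fintype_prod_eq_prod]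

section GaussianTail

variable {m ι : Type*} [Fintype m] [Fintype ι]

lemma lintegral_exp_dotProduct_gaussian (v : ℝ≥0) (b : m → ℝ) :
    ∫⁻ e, ENNReal.ofReal (Real.exp (b ⬝ᵥ e)) ∂(Measure.pi fun _ : m => gaussianReal 0 v) =
      ENNReal.ofReal (Real.exp (v * (b ⬝ᵥ b) / 2)) := by
  have coordinate (i : m) :
      ∫ x, Real.exp (b i * x) ∂(gaussianReal 0 v) = Real.exp (v * (b i * b i) / 2) := by
    have := mgf_gaussianReal (p := gaussianReal 0 v) (X := id) (μ := 0) (v := v) (by simp) (b i)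
    rw [mgf] at this
    simpa [sq] using this
  simp only [dotProduct, Real.exp_sum]
  rw [lintegral_ofReal_fintype_prod (f := fun i x => Real.exp (b i * x))
    (fun _ => integrable_exp_mul_gaussianReal _) (fun _ x => (Real.exp_pos _).le)]
  simp only [coordinate]
  rw [← Real.exp_sum, Finset.mul_sum, Finset.sum_div]

/-- The Gaussian integral `∫ exp (-a ‖M γ‖²)` over all coefficient vectors `γ`. It depends on `M`
and `a` only through a constant and a power of `a`, and cancels wherever it occurs. -/
def gaussMass (M : Matrix m ι ℝ) (a : ℝ) : ℝ≥0∞ :=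
  ∫⁻ γ : ι → ℝ, ENNReal.ofReal (Real.exp (-(a * ((M *ᵥ γ) ⬝ᵥ (M *ᵥ γ)))))

lemma gaussMass_ne_zero (M : Matrix m ι ℝ) (a : ℝ) : gaussMass M a ≠ 0 := by
  have hmeas : Measurable fun γ : ι → ℝ =>
      ENNReal.ofReal (Real.exp (-(a * ((M *ᵥ γ) ⬝ᵥ (M *ᵥ γ))))) := by
    fun_prop
  have hsupp : (Function.support fun γ : ι → ℝ =>
      ENNReal.ofReal (Real.exp (-(a * ((M *ᵥ γ) ⬝ᵥ (M *ᵥ γ)))))) = Set.univ :=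
    Set.eq_univ_of_forall fun γ => (ENNReal.ofReal_pos.2 (Real.exp_pos _)).ne'
  rw [gaussMass, ← pos_iff_ne_zero, lintegral_pos_iff_support hmeas, hsupp]
  exact Measure.measure_univ_pos.2 (NeZero.ne _)

lemma gaussMass_ne_top {M : Matrix m ι ℝ} (hM : Function.Injective M.mulVec) {a : ℝ}
    (ha : 0 < a) : gaussMass M a ≠ ⊤ := by
  obtain ⟨c, hc, hle⟩ := exists_pos_mul_le_mulVec_dotProduct_self hM
  have dominated (γ : ι → ℝ) : Real.exp (-(a * ((M *ᵥ γ) ⬝ᵥ (M *ᵥ γ)))) ≤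
      ∏ i, Real.exp (-(a * c) * γ i ^ 2) := by
    rw [← Real.exp_sum, ← Finset.mul_sum, Real.exp_le_exp]
    have := mul_le_mul_of_nonneg_left (hle γ) ha.le
    simp only [dotProduct, ← sq] at this ⊢
    linarith
  refine ne_top_of_le_ne_top ?_ (lintegral_mono fun γ => ENNReal.ofReal_le_ofReal (dominated γ))
  rw [volume_pi, lintegral_ofReal_fintype_prod (f := fun _ x => Real.exp (-(a * c) * x ^ 2))
    (fun _ => integrable_exp_neg_mul_sq (mul_pos ha hc)) (fun _ x => (Real.exp_pos _).le)]
  exact ENNReal.ofReal_ne_top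

lemma gaussMass_mul_sq (M : Matrix m ι ℝ) (a : ℝ) {t : ℝ} (ht : 0 < t) :
    gaussMass M (a * t ^ 2) = ENNReal.ofReal (t⁻¹ ^ Fintype.card ι) * gaussMass M a := by
  have hmeas : Measurable fun γ : ι → ℝ =>
      ENNReal.ofReal (Real.exp (-(a * ((M *ᵥ γ) ⬝ᵥ (M *ᵥ γ))))) := by
    fun_prop
  rw [gaussMass, gaussMass, ← abs_of_pos (pow_pos (inv_pos.2 ht) _), inv_pow,
    ← Module.finrank_fintype_fun_eq_card ℝ, ← smul_eq_mul (α := ℝ≥0∞), ← lintegral_smul_measure,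
    ← Measure.map_addHaar_smul _ ht.ne', lintegral_map hmeas (measurable_const_smul t)]
  refine lintegral_congr fun γ => ?_
  simp only [Matrix.mulVec_smul, smul_dotProduct, dotProduct_smul, smul_eq_mul]
  ring_nf

variable [DecidableEq ι]

lemma continuous_projSq (M : Matrix m ι ℝ) : Continuous (projSq M) := by
  unfold projSq lsq
  fun_prop

/- Linearization: `exp (a ‖P e‖²)` becomes an average over `γ` of exponentials that are linear in
`e`, whose Gaussian expectations are known. -/
lemma ofReal_exp_projSq_mul_gaussMass {M : Matrix m ι ℝ} (hM : Function.Injective M.mulVec)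
    (a : ℝ) (e : m → ℝ) :
    ENNReal.ofReal (Real.exp (a * projSq M e)) * gaussMass M a =
      ∫⁻ γ : ι → ℝ, ENNReal.ofReal (Real.exp (-(a * ((M *ᵥ γ) ⬝ᵥ (M *ᵥ γ))))) *
        ENNReal.ofReal (Real.exp (((2 * a) • (M *ᵥ γ)) ⬝ᵥ e)) := by
  rw [gaussMass, ← lintegral_const_mul' _ _ ENNReal.ofReal_ne_top,
    ← lintegral_sub_right_eq_self _ (lsq M e)]
  refine lintegral_congr fun γ => ?_
  rw [← ENNReal.ofReal_mul (Real.exp_pos _).le, ← Real.exp_add,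
    ← ENNReal.ofReal_mul (Real.exp_pos _).le, ← Real.exp_add]
  have square := sub_mulVec_dotProduct_self hM e γ
  have expand : (e - M *ᵥ γ) ⬝ᵥ (e - M *ᵥ γ) =
      e ⬝ᵥ e - 2 * ((M *ᵥ γ) ⬝ᵥ e) + (M *ᵥ γ) ⬝ᵥ (M *ᵥ γ) := by
    simp only [sub_dotProduct, dotProduct_sub, dotProduct_comm e (M *ᵥ γ)]
    ring
  congr 2
  rw [smul_dotProduct, smul_eq_mul]
  linear_combination a * square - a * expand

lemma lintegral_exp_projSq {M : Matrix m ι ℝ} (hM : Function.Injective M.mulVec) {v : ℝ≥0}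
    (hv : 0 < v) {θ : ℝ} (hθ₀ : 0 < θ) (hθ₁ : θ < 1) :
    ∫⁻ e, ENNReal.ofReal (Real.exp (θ / (2 * v) * projSq M e))
        ∂(Measure.pi fun _ : m => gaussianReal 0 v) =
      ENNReal.ofReal ((√(1 - θ))⁻¹ ^ Fintype.card ι) := by
  set a : ℝ := θ / (2 * v) with ha_def
  have ha : 0 < a := by positivity
  have expectation (γ : ι → ℝ) :
      ∫⁻ e, ENNReal.ofReal (Real.exp (-(a * ((M *ᵥ γ) ⬝ᵥ (M *ᵥ γ))))) *
          ENNReal.ofReal (Real.exp (((2 * a) • (M *ᵥ γ)) ⬝ᵥ e))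
          ∂(Measure.pi fun _ : m => gaussianReal 0 v) =
        ENNReal.ofReal (Real.exp (-(a * √(1 - θ) ^ 2 * ((M *ᵥ γ) ⬝ᵥ (M *ᵥ γ))))) := by
    rw [lintegral_const_mul' _ _ ENNReal.ofReal_ne_top, lintegral_exp_dotProduct_gaussian,
      ← ENNReal.ofReal_mul (Real.exp_pos _).le, ← Real.exp_add, Real.sq_sqrt (by linarith),
      smul_dotProduct, dotProduct_smul, smul_eq_mul, smul_eq_mul, ha_def]
    congr 2
    field_simp
    ring
  have hmeas : AEMeasurable (Function.uncurry fun (e : m → ℝ) (γ : ι → ℝ) =>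
      ENNReal.ofReal (Real.exp (-(a * ((M *ᵥ γ) ⬝ᵥ (M *ᵥ γ))))) *
        ENNReal.ofReal (Real.exp (((2 * a) • (M *ᵥ γ)) ⬝ᵥ e)))
      ((Measure.pi fun _ : m => gaussianReal 0 v).prod volume) := by
    unfold Function.uncurry
    fun_prop
  refine (ENNReal.mul_left_inj (gaussMass_ne_zero M a) (gaussMass_ne_top hM ha)).1 ?_
  calc _ = ∫⁻ γ, ∫⁻ e, ENNReal.ofReal (Real.exp (-(a * ((M *ᵥ γ) ⬝ᵥ (M *ᵥ γ))))) *
          ENNReal.ofReal (Real.exp (((2 * a) • (M *ᵥ γ)) ⬝ᵥ e))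
          ∂(Measure.pi fun _ : m => gaussianReal 0 v) := by
        rw [← lintegral_mul_const' _ _ (gaussMass_ne_top hM ha),
          ← lintegral_lintegral_swap hmeas]
        simp only [ofReal_exp_projSq_mul_gaussMass hM]
    _ = gaussMass M (a * √(1 - θ) ^ 2) := lintegral_congr expectation
    _ = _ := gaussMass_mul_sq M a (Real.sqrt_pos.2 (by linarith))

lemma measure_lt_projSq_le {M : Matrix m ι ℝ} (hM : Function.Injective M.mulVec) {v : ℝ≥0}
    (hv : 0 < v) {θ : ℝ} (hθ₀ : 0 < θ) (hθ₁ : θ < 1) (x : ℝ) :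
    (Measure.pi fun _ : m => gaussianReal 0 v) {e | 2 * v * x < projSq M e} ≤
      ENNReal.ofReal (Real.exp (-(θ * x)) * (√(1 - θ))⁻¹ ^ Fintype.card ι) := by
  have hmeas : Measurable fun e => ENNReal.ofReal (Real.exp (θ / (2 * v) * projSq M e)) := by
    have := continuous_projSq M
    fun_prop
  have subset_superlevel : {e : m → ℝ | 2 * v * x < projSq M e} ⊆
      {e | ENNReal.ofReal (Real.exp (θ * x)) ≤
        ENNReal.ofReal (Real.exp (θ / (2 * v) * projSq M e))} := by
    intro e he
    refine ENNReal.ofReal_le_ofReal (Real.exp_le_exp.2 ?_)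
    calc θ * x = θ / (2 * v) * (2 * v * x) := by field_simp
      _ ≤ θ / (2 * v) * projSq M e := mul_le_mul_of_nonneg_left he.le (by positivity)
  refine (measure_mono subset_superlevel).trans
    ((meas_ge_le_lintegral_div hmeas.aemeasurable (by simp [Real.exp_pos])
      ENNReal.ofReal_ne_top).trans_eq ?_)
  rw [lintegral_exp_projSq hM hv hθ₀ hθ₁, ← ENNReal.ofReal_div_of_pos (Real.exp_pos _),
    Real.exp_neg, div_eq_inv_mul]

end GaussianTail

section InverseGamma

lemma rpow_neg_mul_exp_neg_div_le {x b N : ℝ} (hx : 0 < x) (hb : 0 < b) (hN : 0 ≤ N) :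
    x ^ (-N) * Real.exp (-(b / x)) ≤ (N / (Real.exp 1 * b)) ^ N := by
  rcases hN.eq_or_lt with rfl | hN
  · simpa using (by positivity : 0 ≤ b / x)
  set z : ℝ := b / (N * x) with hz
  have mul_exp_le_one : z * Real.exp (1 - z) ≤ 1 := by
    rw [← neg_sub, Real.exp_neg, ← div_eq_mul_inv, div_le_one (Real.exp_pos _)]
    linarith [Real.add_one_le_exp (z - 1)]
  have substitution : x⁻¹ * Real.exp (-z) = N / (Real.exp 1 * b) * (z * Real.exp (1 - z)) := by
    rw [sub_eq_add_neg, Real.exp_add, hz]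
    field_simp
  calc x ^ (-N) * Real.exp (-(b / x)) = (x⁻¹ * Real.exp (-z)) ^ N := by
        rw [Real.mul_rpow (by positivity) (by positivity), Real.rpow_neg hx.le,
          Real.inv_rpow hx.le, ← Real.exp_mul, hz]
        congr 2
        field_simp
    _ = (N / (Real.exp 1 * b)) ^ N * (z * Real.exp (1 - z)) ^ N := by
        rw [substitution, Real.mul_rpow (by positivity) (by positivity)]
    _ ≤ (N / (Real.exp 1 * b)) ^ N :=
        mul_le_of_le_one_right (by positivity)
          (Real.rpow_le_one (by positivity) mul_exp_le_one hN.le)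

lemma lintegral_rpow_mul_exp_neg_div {a b : ℝ} (ha : 0 < a) (hb : 0 < b) :
    ∫⁻ x in Set.Ioi (0 : ℝ), ENNReal.ofReal (x ^ (-(a + 1)) * Real.exp (-(b / x))) =
      ENNReal.ofReal (Real.Gamma a * b ^ (-a)) := by
  set g : ℝ → ℝ := fun y => y ^ (a - 1) * Real.exp (-(b * y)) with hg
  have inversion : Set.EqOn (fun x => (|(-1 : ℝ)| * x ^ ((-1 : ℝ) - 1)) • g (x ^ (-1 : ℝ)))
      (fun x => x ^ (-(a + 1)) * Real.exp (-(b / x))) (Set.Ioi 0) := by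
    intro x (hx : 0 < x)
    simp only [hg, abs_neg, abs_one, one_mul, smul_eq_mul, ← mul_assoc, ← Real.rpow_mul hx.le]
    rw [← Real.rpow_add hx, Real.rpow_neg_one, ← div_eq_mul_inv]
    ring_nf
  have integrable : IntegrableOn (fun x => x ^ (-(a + 1)) * Real.exp (-(b / x))) (Set.Ioi 0) := by
    rw [← integrableOn_congr_fun inversion measurableSet_Ioi,
      integrableOn_Ioi_comp_rpow_iff g (by norm_num)]
    simpa [hg] using integrableOn_rpow_mul_exp_neg_mul_rpow (p := 1) (s := a - 1)
      (by linarith) one_pos hb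
  rw [← ofReal_integral_eq_lintegral_ofReal integrable
    ((ae_restrict_iff' measurableSet_Ioi).2 (ae_of_all _ fun x (hx : 0 < x) => by positivity)),
    ← setIntegral_congr_fun measurableSet_Ioi inversion, integral_comp_rpow_Ioi g (by norm_num),
    Real.integral_rpow_mul_exp_neg_mul_Ioi ha hb, one_div, Real.inv_rpow hb.le,
    ← Real.rpow_neg hb.le, mul_comm]

end InverseGamma

section GaussianMoments

lemma integrable_exp_neg_mul_sq_mul_pow {b : ℝ} (hb : 0 < b) (r : ℕ) :
    Integrable fun x : ℝ => Real.exp (-(b * x ^ 2)) * x ^ (2 * r) := by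
  have := integrable_rpow_mul_exp_neg_mul_sq hb (s := ((2 * r : ℕ) : ℝ))
    (lt_of_lt_of_le (by norm_num) (Nat.cast_nonneg _))
  simpa only [Real.rpow_natCast, neg_mul, mul_comm] using this

/-- The function `exp (-u²/2) (1 + u²)^r`. After rescaling it dominates the product of a Gaussian
density centred anywhere and `x^{2r}`, at the cost of a factor depending on the centre. -/
def momKernel (r : ℕ) (u : ℝ) : ℝ := Real.exp (-(1 / 2 * u ^ 2)) * (1 + u ^ 2) ^ r

lemma momKernel_pos (r : ℕ) (u : ℝ) : 0 < momKernel r u := by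
  unfold momKernel
  positivity

lemma integrable_momKernel (r : ℕ) : Integrable (momKernel r) := by
  have hdom := ((integrable_exp_neg_mul_sq_mul_pow (b := 1 / 2) (by norm_num) 0).add
    (integrable_exp_neg_mul_sq_mul_pow (b := 1 / 2) (by norm_num) r)).const_mul (2 ^ (r - 1))
  have hmeas : AEStronglyMeasurable (momKernel r) := by
    unfold momKernel
    fun_prop
  refine hdom.mono' hmeas (ae_of_all _ fun u => ?_)
  have binomial : (1 + u ^ 2) ^ r ≤ 2 ^ (r - 1) * (1 + u ^ (2 * r)) := by
    simpa [← pow_mul] using add_pow_le (zero_le_one (α := ℝ)) (sq_nonneg u) r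
  rw [Real.norm_of_nonneg (momKernel_pos r u).le, momKernel]
  refine (mul_le_mul_of_nonneg_left binomial (Real.exp_pos _).le).trans_eq ?_
  simp only [Pi.add_apply, mul_zero, pow_zero]
  ring

lemma integral_momKernel_pos (r : ℕ) : 0 < ∫ u, momKernel r u := by
  rw [integral_pos_iff_support_of_nonneg (fun u => (momKernel_pos r u).le)
    (integrable_momKernel r),
    Set.eq_univ_of_forall fun u => Function.mem_support.2 (momKernel_pos r u).ne']
  simp

lemma exp_mul_pow_le_momKernel {a s : ℝ} (ha : 0 < a) (hs : 0 < s) (r : ℕ) (c x : ℝ) :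
    Real.exp (-(a * (x - c) ^ 2 / (2 * s))) * x ^ (2 * r) ≤
      (s / a * (1 + a * c ^ 2 / s)) ^ r * momKernel r (√(a / s) * (x - c)) := by
  have rescale : (√(a / s) * (x - c)) ^ 2 = a / s * (x - c) ^ 2 := by
    rw [mul_pow, Real.sq_sqrt (by positivity)]
  have cauchy_schwarz : x ^ 2 ≤ s / a * (1 + a * c ^ 2 / s) * (1 + a / s * (x - c) ^ 2) := by
    have : s / a * (1 + a * c ^ 2 / s) * (1 + a / s * (x - c) ^ 2) =
        x ^ 2 + s / a * (1 - a / s * (c * (x - c))) ^ 2 := by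
      field_simp
      ring
    rw [this]
    exact le_add_of_nonneg_right (by positivity)
  rw [momKernel, rescale, pow_mul, mul_left_comm, ← mul_pow]
  refine mul_le_mul (Real.exp_le_exp.2 (le_of_eq (by field_simp)))
    (pow_le_pow_left₀ (sq_nonneg x) cauchy_schwarz r) (by positivity) (Real.exp_pos _).le

lemma integral_momKernel_comp (r : ℕ) {w : ℝ} (hw : 0 < w) (c : ℝ) :
    ∫ x, momKernel r (w * (x - c)) = w⁻¹ * ∫ u, momKernel r u := by
  rw [integral_sub_right_eq_self (fun x => momKernel r (w * x)) c,
    Measure.integral_comp_mul_left, abs_of_pos (inv_pos.2 hw), smul_eq_mul]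

lemma prod_pow_two_mul_nonneg {ι : Type*} [Fintype ι] (b : ι → ℝ) (r : ℕ) :
    0 ≤ ∏ i, b i ^ (2 * r) :=
  Finset.prod_nonneg fun i _ => (even_two_mul r).pow_nonneg (b i)

lemma lintegral_exp_mul_prod_pow_le {ι : Type*} [Fintype ι] {a s : ℝ} (ha : 0 < a) (hs : 0 < s)
    (r : ℕ) (c : ι → ℝ) :
    ∫⁻ β : ι → ℝ, ENNReal.ofReal (Real.exp (-(a * (∑ i, (β i - c i) ^ 2) / (2 * s))) *
        ∏ i, β i ^ (2 * r)) ≤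
      ENNReal.ofReal (((s / a) ^ ((r : ℝ) + 1 / 2) * ∫ u, momKernel r u) ^ Fintype.card ι *
        (∏ i, (1 + a * c i ^ 2 / s)) ^ r) := by
  have hw : 0 < √(a / s) := Real.sqrt_pos.2 (by positivity)
  have factor (β : ι → ℝ) : Real.exp (-(a * (∑ i, (β i - c i) ^ 2) / (2 * s))) *
      ∏ i, β i ^ (2 * r) =
        ∏ i, Real.exp (-(a * (β i - c i) ^ 2 / (2 * s))) * β i ^ (2 * r) := by
    rw [Finset.mul_sum, Finset.sum_div, ← Finset.sum_neg_distrib, Real.exp_sum,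
      Finset.prod_mul_distrib]
  have power : (s / a) ^ ((r : ℝ) + 1 / 2) = (s / a) ^ r * (√(a / s))⁻¹ := by
    rw [Real.rpow_add (by positivity), Real.rpow_natCast, ← Real.sqrt_eq_rpow, ← Real.sqrt_inv,
      inv_div]
  calc _ ≤ ∫⁻ β : ι → ℝ, ENNReal.ofReal (∏ i, ((s / a * (1 + a * c i ^ 2 / s)) ^ r *
          momKernel r (√(a / s) * (β i - c i)))) := by
        refine lintegral_mono fun β => ENNReal.ofReal_le_ofReal ?_
        rw [factor]
        exact Finset.prod_le_prod (fun i _ => mul_nonneg (Real.exp_pos _).le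
          ((even_two_mul r).pow_nonneg _)) fun i _ => exp_mul_pow_le_momKernel ha hs r _ _
    _ = ENNReal.ofReal (∏ i, (s / a * (1 + a * c i ^ 2 / s)) ^ r *
          ((√(a / s))⁻¹ * ∫ u, momKernel r u)) := by
        rw [volume_pi, lintegral_ofReal_fintype_prod (f := fun i x =>
            (s / a * (1 + a * c i ^ 2 / s)) ^ r * momKernel r (√(a / s) * (x - c i)))
          (fun i => (((integrable_momKernel r).comp_mul_left' hw.ne').comp_sub_right _).const_mul _)
          (fun i x => mul_nonneg (by positivity) (momKernel_pos _ _).le)]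
        simp only [integral_const_mul, integral_momKernel_comp r hw]
    _ = _ := by
        rw [power, ← Finset.prod_pow, ← Finset.card_univ, ← Finset.prod_const,
          ← Finset.prod_mul_distrib]
        congr 1
        exact Finset.prod_congr rfl fun i _ => by rw [mul_pow]; ring

end GaussianMoments

section PriorConstant

/-- The Gaussian moment `∫ exp (-b x² / 2) x^{2r}`. -/
def pureMom (r : ℕ) (b : ℝ) : ℝ := ∫ x : ℝ, Real.exp (-(b / 2 * x ^ 2)) * x ^ (2 * r)

lemma pureMom_pos (r : ℕ) {b : ℝ} (hb : 0 < b) : 0 < pureMom r b := by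
  rw [pureMom, integral_pos_iff_support_of_nonneg
    (fun x => mul_nonneg (Real.exp_pos _).le ((even_two_mul r).pow_nonneg x))
    (integrable_exp_neg_mul_sq_mul_pow (half_pos hb) r)]
  refine lt_of_lt_of_le (by simp) (measure_mono (s := Set.Ioi (0 : ℝ)) fun x hx => ?_)
  have : (0 : ℝ) < x := hx
  exact Function.mem_support.2 (by positivity)

lemma exp_mul_prod_pow_eq_prod {ι : Type*} [Fintype ι] (r : ℕ) (b : ℝ) (x : ι → ℝ) :
    Real.exp (-(b * (x ⬝ᵥ x) / 2)) * ∏ i, x i ^ (2 * r) =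
      ∏ i, Real.exp (-(b / 2 * x i ^ 2)) * x i ^ (2 * r) := by
  rw [Finset.prod_mul_distrib, ← Real.exp_sum, Finset.sum_neg_distrib, ← Finset.mul_sum]
  simp only [dotProduct, ← sq, mul_div_right_comm]

lemma integrable_exp_mul_prod_pow {b : ℝ} (hb : 0 < b) (r : ℕ) (ι : Type*) [Fintype ι] :
    Integrable fun x : ι → ℝ => Real.exp (-(b * (x ⬝ᵥ x) / 2)) * ∏ i, x i ^ (2 * r) := by
  simp only [exp_mul_prod_pow_eq_prod]
  exact Integrable.fintype_prod (f := fun _ x => Real.exp (-(b / 2 * x ^ 2)) * x ^ (2 * r))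
    fun _ => integrable_exp_neg_mul_sq_mul_pow (half_pos hb) r

lemma integral_exp_mul_prod_pow (b : ℝ) (r : ℕ) (ι : Type*) [Fintype ι] :
    ∫ x : ι → ℝ, Real.exp (-(b * (x ⬝ᵥ x) / 2)) * ∏ i, x i ^ (2 * r) =
      pureMom r b ^ Fintype.card ι := by
  simp only [exp_mul_prod_pow_eq_prod]
  rw [integral_fintype_prod_volume_eq_pow
    (f := fun x => Real.exp (-(b / 2 * x ^ 2)) * x ^ (2 * r)), pureMom]

variable {p : ℕ}

/-- The integral of the pMOM kernel at `v = 1` without its Gaussian normalizing factor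
`(2π)^{-|k|/2} |A_k|^{1/2}`, which cancels in the normalized prior density. -/
def pmomInt (A : Matrix (Fin p) (Fin p) ℝ) (r : ℕ) (k : Finset (Fin p)) : ℝ :=
  ∫ b : k → ℝ, Real.exp (-((b ⬝ᵥ (subPrec A k *ᵥ b)) / 2)) * ∏ i, b i ^ (2 * r)

lemma EigenvaluesBetween.pmomInt_mem_Icc {A : Matrix (Fin p) (Fin p) ℝ} {a₁ a₂ : ℝ}
    (h : EigenvaluesBetween A a₁ a₂) (ha₁ : 0 < a₁) (ha₂ : 0 < a₂) (r : ℕ)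
    (k : Finset (Fin p)) :
    pmomInt A r k ∈ Set.Icc (pureMom r a₂ ^ k.card) (pureMom r a₁ ^ k.card) := by
  set f : (k → ℝ) → ℝ := fun b =>
    Real.exp (-((b ⬝ᵥ (subPrec A k *ᵥ b)) / 2)) * ∏ i, b i ^ (2 * r)
  have f_le (b : k → ℝ) : f b ≤ Real.exp (-(a₁ * (b ⬝ᵥ b) / 2)) * ∏ i, b i ^ (2 * r) :=
    mul_le_mul_of_nonneg_right (Real.exp_le_exp.2 (by linarith [(h.quadForm_mem_Icc b).1]))
      (prod_pow_two_mul_nonneg b r)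
  have le_f (b : k → ℝ) : Real.exp (-(a₂ * (b ⬝ᵥ b) / 2)) * ∏ i, b i ^ (2 * r) ≤ f b :=
    mul_le_mul_of_nonneg_right (Real.exp_le_exp.2 (by linarith [(h.quadForm_mem_Icc b).2]))
      (prod_pow_two_mul_nonneg b r)
  have hf : Integrable f := by
    refine (integrable_exp_mul_prod_pow ha₁ r k).mono'
      (by fun_prop : Continuous f).aestronglyMeasurable (ae_of_all _ fun b => ?_)
    rw [Real.norm_of_nonneg (mul_nonneg (Real.exp_pos _).le (prod_pow_two_mul_nonneg b r))]
    exact f_le b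
  rw [← Fintype.card_coe k, ← integral_exp_mul_prod_pow, ← integral_exp_mul_prod_pow]
  exact ⟨integral_mono (integrable_exp_mul_prod_pow ha₂ r k) hf le_f,
    integral_mono hf (integrable_exp_mul_prod_pow ha₁ r k) f_le⟩

lemma EigenvaluesBetween.pmomInt_pos {A : Matrix (Fin p) (Fin p) ℝ} {a₁ a₂ : ℝ}
    (h : EigenvaluesBetween A a₁ a₂) (ha₁ : 0 < a₁) (ha₂ : 0 < a₂) (r : ℕ)
    (k : Finset (Fin p)) : 0 < pmomInt A r k :=
  (pow_pos (pureMom_pos r ha₂) _).trans_le (h.pmomInt_mem_Icc ha₁ ha₂ r k).1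

lemma pmomDensity_eq {A : Matrix (Fin p) (Fin p) ℝ} {k : Finset (Fin p)}
    (hA : (subPrec A k).PosDef) (r : ℕ) (β : k → ℝ) (τ s : ℝ) :
    pmomDensity A r k β τ s = (pmomInt A r k)⁻¹ * (τ * s) ^ (-(((r : ℝ) + 1 / 2) * k.card)) *
      (Real.exp (-((β ⬝ᵥ (subPrec A k *ᵥ β)) / (2 * (τ * s)))) * ∏ i, β i ^ (2 * r)) := by
  set D : ℝ := (2 * Real.pi) ^ (-((k.card : ℝ) / 2)) * √(subPrec A k).det with hD
  have hD₀ : D ≠ 0 := by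
    have := hA.det_pos
    positivity
  have hconst : pmomConst A r k = D⁻¹ * (pmomInt A r k)⁻¹ := by
    rw [pmomConst, ← mul_inv, pmomInt, ← integral_const_mul]
    congr 2
    ext b
    rw [pmomKernel, Real.one_rpow, mul_one, mul_one, hD]
    ring
  rw [pmomDensity, hconst, pmomKernel,
    show -((r : ℝ) * k.card) - (k.card : ℝ) / 2 = -(((r : ℝ) + 1 / 2) * k.card) by ring]
  field_simp
  rw [hD]
  ring

end PriorConstant

section PriorDensities

lemma sigmaSqDensity_nonneg {α b s : ℝ} (hα : 0 < α) (hb : 0 < b) (hs : 0 < s) :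
    0 ≤ sigmaSqDensity α b s := by
  have := Real.Gamma_pos_of_pos hα
  unfold sigmaSqDensity
  positivity

lemma lintegral_sigmaSqDensity {α b : ℝ} (hα : 0 < α) (hb : 0 < b) :
    ∫⁻ s in Set.Ioi (0 : ℝ), ENNReal.ofReal (sigmaSqDensity α b s) = 1 := by
  have hconst : 0 ≤ b ^ α / Real.Gamma α := by positivity
  simp only [sigmaSqDensity, mul_assoc, ENNReal.ofReal_mul hconst]
  rw [lintegral_const_mul' _ _ ENNReal.ofReal_ne_top, lintegral_rpow_mul_exp_neg_div hα hb,
    ← ENNReal.ofReal_mul hconst, Real.rpow_neg hb.le]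
  field_simp
  simp

lemma rpow_neg_mul_sigmaSqDensity_le {α b N s : ℝ} (hα : 0 < α) (hb : 0 < b) (hN : 0 ≤ N)
    (hs : 0 < s) :
    s ^ (-N) * sigmaSqDensity α (2 * b) s ≤
      2 ^ α * (N / (Real.exp 1 * b)) ^ N * sigmaSqDensity α b s := by
  have split_exp : Real.exp (-(2 * b / s)) = Real.exp (-(b / s)) * Real.exp (-(b / s)) := by
    rw [← Real.exp_add]
    ring_nf
  calc s ^ (-N) * sigmaSqDensity α (2 * b) s
      = s ^ (-N) * Real.exp (-(b / s)) * (2 ^ α * sigmaSqDensity α b s) := by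
        rw [sigmaSqDensity, sigmaSqDensity, split_exp, Real.mul_rpow zero_le_two hb.le]
        ring
    _ ≤ (N / (Real.exp 1 * b)) ^ N * (2 ^ α * sigmaSqDensity α b s) :=
        mul_le_mul_of_nonneg_right (rpow_neg_mul_exp_neg_div_le hs hb hN)
          (mul_nonneg (by positivity) (sigmaSqDensity_nonneg hα hb hs))
    _ = 2 ^ α * (N / (Real.exp 1 * b)) ^ N * sigmaSqDensity α b s := by ring

lemma tauDensity_eq_sigmaSqDensity (n : ℕ) (τ : ℝ) :
    tauDensity n τ = sigmaSqDensity (1 / 2) (n / 2) τ := by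
  rw [tauDensity, sigmaSqDensity, div_div]
  norm_num

lemma tauDensity_nonneg {n : ℕ} (hn : 1 ≤ n) {τ : ℝ} (hτ : 0 < τ) : 0 ≤ tauDensity n τ := by
  have : (0 : ℝ) < n := by exact_mod_cast hn
  rw [tauDensity_eq_sigmaSqDensity]
  exact sigmaSqDensity_nonneg (by norm_num) (by positivity) hτ

lemma lintegral_rpow_neg_mul_tauDensity_le {n : ℕ} (hn : 1 ≤ n) {N a : ℝ} (hN : 0 ≤ N)
    (ha : 0 < a) :
    ∫⁻ τ in Set.Ioi (0 : ℝ), ENNReal.ofReal ((τ * a) ^ (-N) * tauDensity n τ) ≤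
      ENNReal.ofReal (√2 * (a ^ (-N) * (2 * N / n) ^ N)) := by
  have hn₀ : (0 : ℝ) < n := by exact_mod_cast hn
  have base_le : N / (Real.exp 1 * (n / 4)) ≤ 2 * N / n := by
    rw [div_le_div_iff₀ (by positivity) hn₀]
    have he : 2 ≤ Real.exp 1 := by linarith [Real.add_one_le_exp 1]
    nlinarith [mul_le_mul_of_nonneg_right he (mul_nonneg hN hn₀.le)]
  have pointwise (τ : ℝ) (hτ : 0 < τ) : (τ * a) ^ (-N) * tauDensity n τ ≤
      √2 * (a ^ (-N) * (2 * N / n) ^ N) * sigmaSqDensity (1 / 2) (n / 4) τ := by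
    have hσ := sigmaSqDensity_nonneg (by norm_num : (0 : ℝ) < 1 / 2)
      (by positivity : (0 : ℝ) < n / 4) hτ
    calc (τ * a) ^ (-N) * tauDensity n τ
        = a ^ (-N) * (τ ^ (-N) * sigmaSqDensity (1 / 2) (2 * (n / 4)) τ) := by
          rw [Real.mul_rpow hτ.le ha.le, tauDensity_eq_sigmaSqDensity]
          ring_nf
      _ ≤ a ^ (-N) * (√2 * (2 * N / n) ^ N * sigmaSqDensity (1 / 2) (n / 4) τ) := by
          refine mul_le_mul_of_nonneg_left ((rpow_neg_mul_sigmaSqDensity_le (by norm_num)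
            (by positivity) hN hτ).trans ?_) (by positivity)
          rw [Real.sqrt_eq_rpow]
          gcongr
      _ = _ := by ring
  refine (setLIntegral_mono' measurableSet_Ioi fun τ hτ =>
    ENNReal.ofReal_le_ofReal (pointwise τ hτ)).trans_eq ?_
  have hconst : 0 ≤ √2 * (a ^ (-N) * (2 * N / n) ^ N) := by positivity
  simp only [ENNReal.ofReal_mul hconst]
  rw [lintegral_const_mul' _ _ ENNReal.ofReal_ne_top,
    lintegral_sigmaSqDensity (by norm_num) (by positivity), mul_one]

end PriorDensities

section ProfileLikelihood

/-- The maximum over `s > 0` of the Gaussian likelihood `(2πs)^{-n/2} exp (-W / (2s))` with residual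
sum of squares `W`, attained at `s = W / n`. -/
def profileLikelihood (n : ℕ) (W : ℝ) : ℝ :=
  (2 * Real.pi) ^ (-((n : ℝ) / 2)) * (n / (Real.exp 1 * W)) ^ ((n : ℝ) / 2)

lemma profileLikelihood_nonneg (n : ℕ) {W : ℝ} (hW : 0 < W) : 0 ≤ profileLikelihood n W := by
  unfold profileLikelihood
  positivity

lemma rpow_mul_exp_le_profileLikelihood (n : ℕ) {W s : ℝ} (hW : 0 < W) (hs : 0 < s) :
    (2 * Real.pi * s) ^ (-((n : ℝ) / 2)) * Real.exp (-(W / (2 * s))) ≤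
      profileLikelihood n W := by
  have := rpow_neg_mul_exp_neg_div_le hs (half_pos hW) (by positivity : (0 : ℝ) ≤ n / 2)
  rw [Real.mul_rpow (by positivity) hs.le, mul_assoc, profileLikelihood, ← div_div,
    show (n : ℝ) / (Real.exp 1 * W) = n / 2 / (Real.exp 1 * (W / 2)) by field_simp]
  exact mul_le_mul_of_nonneg_left this (by positivity)

lemma rpow_mul_exp_mul_exp_le_profileLikelihood (n : ℕ) {Q V W s : ℝ} (hW : 0 < W)
    (hWQ : W ≤ Q - 2 * V) (hs : 0 < s) :
    (2 * Real.pi * s) ^ (-((n : ℝ) / 2)) * Real.exp (-(Q / (2 * s))) * Real.exp (V / s) ≤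
      profileLikelihood n W := by
  refine le_trans ?_ (rpow_mul_exp_le_profileLikelihood n hW hs)
  rw [mul_assoc, ← Real.exp_add]
  gcongr
  rw [neg_add_le_iff_le_add, ← sub_eq_add_neg, le_sub_iff_add_le]
  field_simp
  linarith

end ProfileLikelihood

section MarginalUpper

variable {n p : ℕ}

/-- The marginal density with values in `[0, ∞]`, before it is known to be finite. -/
def emarginal (X : Matrix (Fin n) (Fin p) ℝ) (A : Matrix (Fin p) (Fin p) ℝ) (r : ℕ)
    (α₁ α₂ : ℝ) (k : Finset (Fin p)) (y : Fin n → ℝ) : ℝ≥0∞ :=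
  ∫⁻ τ in Set.Ioi (0 : ℝ), ∫⁻ s in Set.Ioi (0 : ℝ), ∫⁻ β : k → ℝ,
    ENNReal.ofReal (likelihood X k y β s * pmomDensity A r k β τ s * tauDensity n τ *
      sigmaSqDensity α₁ α₂ s)

lemma likelihood_mul_pmomDensity_le {X : Matrix (Fin n) (Fin p) ℝ}
    {A : Matrix (Fin p) (Fin p) ℝ} {a₁ a₂ : ℝ} (hA : EigenvaluesBetween A a₁ a₂) (ha₁ : 0 < a₁)
    (ha₂ : 0 < a₂) (r : ℕ) {k : Finset (Fin p)} {y : Fin n → ℝ} {β : k → ℝ} {R τ s : ℝ}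
    (hR : R ≤ (y - subDesign X k *ᵥ β) ⬝ᵥ (y - subDesign X k *ᵥ β)) (hτ : 0 < τ) (hs : 0 < s) :
    likelihood X k y β s * pmomDensity A r k β τ s ≤
      (2 * Real.pi * s) ^ (-((n : ℝ) / 2)) * Real.exp (-(R / (2 * s))) *
        ((pureMom r a₂ ^ k.card)⁻¹ * (τ * s) ^ (-(((r : ℝ) + 1 / 2) * k.card)) *
          ∏ i, β i ^ (2 * r)) := by
  have likelihood_le : likelihood X k y β s ≤
      (2 * Real.pi * s) ^ (-((n : ℝ) / 2)) * Real.exp (-(R / (2 * s))) := by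
    unfold likelihood
    gcongr
  have exp_le_one : Real.exp (-((β ⬝ᵥ (subPrec A k *ᵥ β)) / (2 * (τ * s)))) ≤ 1 := by
    refine Real.exp_le_one_iff.2 (neg_nonpos.2 (div_nonneg ?_ (by positivity)))
    exact (mul_nonneg ha₁.le (dotProduct_self_nonneg β)).trans (hA.quadForm_mem_Icc β).1
  have inv_le : (pmomInt A r k)⁻¹ ≤ (pureMom r a₂ ^ k.card)⁻¹ :=
    inv_anti₀ (pow_pos (pureMom_pos r ha₂) _) (hA.pmomInt_mem_Icc ha₁ ha₂ r k).1
  have hpmom := (hA.pmomInt_pos ha₁ ha₂ r k).le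
  have hmom := (pureMom_pos r ha₂).le
  have hprod := prod_pow_two_mul_nonneg β r
  rw [pmomDensity_eq (hA.subPrec_posDef ha₁ k)]
  refine mul_le_mul likelihood_le ?_ (by positivity) (by positivity)
  calc _ ≤ (pureMom r a₂ ^ k.card)⁻¹ * (τ * s) ^ (-(((r : ℝ) + 1 / 2) * k.card)) *
        (1 * ∏ i, β i ^ (2 * r)) := by gcongr
    _ = _ := by rw [one_mul]

lemma prod_one_add_pow_le {ι : Type*} [Fintype ι] {a s : ℝ} (ha : 0 < a) (hs : 0 < s)
    {c N v : ι → ℝ} (hN : ∀ i, 1 + a * c i ^ 2 / s ≤ N i * Real.exp (v i / s)) (r : ℕ) :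
    (∏ i, (1 + a * c i ^ 2 / s)) ^ r ≤ (∏ i, N i) ^ r * Real.exp (r * (∑ i, v i) / s) := by
  have hprod : ∏ i, (1 + a * c i ^ 2 / s) ≤ (∏ i, N i) * Real.exp ((∑ i, v i) / s) := by
    rw [Finset.sum_div, Real.exp_sum, ← Finset.prod_mul_distrib]
    exact Finset.prod_le_prod (fun i _ => by positivity) fun i _ => hN i
  calc (∏ i, (1 + a * c i ^ 2 / s)) ^ r ≤ ((∏ i, N i) * Real.exp ((∑ i, v i) / s)) ^ r :=
        pow_le_pow_left₀ (Finset.prod_nonneg fun i _ => by positivity) hprod r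
    _ = (∏ i, N i) ^ r * Real.exp (r * (∑ i, v i) / s) := by
        rw [mul_pow, ← Real.exp_nat_mul, mul_div_assoc]

lemma rpow_neg_mul_rpow_pow {a τ s ρ : ℝ} (ha : 0 < a) (hτ : 0 < τ) (hs : 0 < s) (m : ℕ) :
    (τ * s) ^ (-(ρ * m)) * ((s / a) ^ ρ) ^ m = (τ * a) ^ (-(ρ * m)) := by
  rw [← Real.rpow_natCast, ← Real.rpow_mul (by positivity),
    Real.rpow_neg (by positivity), Real.rpow_neg (by positivity),
    ← Real.inv_rpow (by positivity), ← Real.inv_rpow (by positivity),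
    ← Real.mul_rpow (by positivity) (by positivity)]
  congr 1
  field_simp

/- If the residual sum of squares is at least `Q + a ‖β - c‖²`, the nonlocal factor `∏ β_i^{2r}` is
effectively concentrated near `c`, and `N`, `v` bound what it contributes there. -/
lemma lintegral_likelihood_mul_pmomDensity_le {X : Matrix (Fin n) (Fin p) ℝ}
    {A : Matrix (Fin p) (Fin p) ℝ} {a₁ a₂ : ℝ} (hA : EigenvaluesBetween A a₁ a₂) (ha₁ : 0 < a₁)
    (ha₂ : 0 < a₂) (r : ℕ) {k : Finset (Fin p)} {y : Fin n → ℝ} {c N v : k → ℝ} {a Q W : ℝ}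
    (ha : 0 < a)
    (hQ : ∀ β : k → ℝ, Q + a * ∑ i, (β i - c i) ^ 2 ≤
      (y - subDesign X k *ᵥ β) ⬝ᵥ (y - subDesign X k *ᵥ β))
    (hN : ∀ i, ∀ s : ℝ, 0 < s → 1 + a * c i ^ 2 / s ≤ N i * Real.exp (v i / s))
    (hW : 0 < W) (hWQ : W ≤ Q - 2 * r * ∑ i, v i) {τ s : ℝ} (hτ : 0 < τ) (hs : 0 < s) :
    ∫⁻ β : k → ℝ, ENNReal.ofReal (likelihood X k y β s * pmomDensity A r k β τ s) ≤
      ENNReal.ofReal (((∫ u, momKernel r u) / pureMom r a₂) ^ k.card * (∏ i, N i) ^ r *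
        profileLikelihood n W * (τ * a) ^ (-(((r : ℝ) + 1 / 2) * k.card))) := by
  set ρ : ℝ := (r : ℝ) + 1 / 2
  set G : ℝ := ∫ u, momKernel r u
  set J : ℝ := pureMom r a₂
  set P : ℝ := (2 * Real.pi * s) ^ (-((n : ℝ) / 2))
  have hG : 0 < G := integral_momKernel_pos r
  have hJ : 0 < J := pureMom_pos r ha₂
  have hprod : 0 ≤ ∏ i, N i := Finset.prod_nonneg fun i _ =>
    (pos_of_mul_pos_left (lt_of_lt_of_le (by positivity) (hN i s hs)) (Real.exp_pos _).le).le
  have pointwise (β : k → ℝ) : likelihood X k y β s * pmomDensity A r k β τ s ≤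
      P * Real.exp (-(Q / (2 * s))) * ((J ^ k.card)⁻¹ * (τ * s) ^ (-(ρ * k.card))) *
        (Real.exp (-(a * (∑ i, (β i - c i) ^ 2) / (2 * s))) * ∏ i, β i ^ (2 * r)) := by
    refine (likelihood_mul_pmomDensity_le hA ha₁ ha₂ r (hQ β) hτ hs).trans_eq ?_
    rw [add_div, neg_add, Real.exp_add]
    ring
  have exponent_le : P * Real.exp (-(Q / (2 * s))) * Real.exp (r * (∑ i, v i) / s) ≤
      profileLikelihood n W :=
    rpow_mul_exp_mul_exp_le_profileLikelihood n hW (by linarith) hs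
  have hconst : 0 ≤ P * Real.exp (-(Q / (2 * s))) *
      ((J ^ k.card)⁻¹ * (τ * s) ^ (-(ρ * k.card))) := by positivity
  refine (lintegral_mono fun β => ENNReal.ofReal_le_ofReal (pointwise β)).trans ?_
  simp only [ENNReal.ofReal_mul hconst]
  rw [lintegral_const_mul' _ _ ENNReal.ofReal_ne_top]
  refine (mul_le_mul_right (lintegral_exp_mul_prod_pow_le ha hs r c) _).trans ?_
  rw [← ENNReal.ofReal_mul hconst, Fintype.card_coe]
  refine ENNReal.ofReal_le_ofReal ?_
  calc _ ≤ P * Real.exp (-(Q / (2 * s))) * ((J ^ k.card)⁻¹ * (τ * s) ^ (-(ρ * k.card))) *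
        (((s / a) ^ ρ * G) ^ k.card * ((∏ i, N i) ^ r * Real.exp (r * (∑ i, v i) / s))) := by
        gcongr
        exact prod_one_add_pow_le ha hs (fun i => hN i s hs) r
    _ = (G / J) ^ k.card * (∏ i, N i) ^ r *
          (P * Real.exp (-(Q / (2 * s))) * Real.exp (r * (∑ i, v i) / s)) *
          ((τ * s) ^ (-(ρ * k.card)) * ((s / a) ^ ρ) ^ k.card) := by
        rw [mul_pow, div_pow]
        field_simp
    _ ≤ (G / J) ^ k.card * (∏ i, N i) ^ r * profileLikelihood n W *
          (τ * a) ^ (-(ρ * k.card)) := by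
        rw [rpow_neg_mul_rpow_pow ha hτ hs]
        gcongr

lemma emarginal_le_lintegral_tauDensity {X : Matrix (Fin n) (Fin p) ℝ}
    {A : Matrix (Fin p) (Fin p) ℝ} {r : ℕ} {α₁ α₂ : ℝ} (hα₁ : 0 < α₁) (hα₂ : 0 < α₂)
    (hn : 1 ≤ n) {k : Finset (Fin p)} {y : Fin n → ℝ} {D : ℝ} (hD : 0 ≤ D) {g : ℝ → ℝ}
    (h : ∀ τ > 0, ∀ s > 0, ∫⁻ β : k → ℝ,
      ENNReal.ofReal (likelihood X k y β s * pmomDensity A r k β τ s) ≤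
        ENNReal.ofReal (D * g τ)) :
    emarginal X A r α₁ α₂ k y ≤ ENNReal.ofReal D *
      ∫⁻ τ in Set.Ioi (0 : ℝ), ENNReal.ofReal (g τ * tauDensity n τ) := by
  rw [emarginal, ← lintegral_const_mul' _ _ ENNReal.ofReal_ne_top]
  refine setLIntegral_mono' measurableSet_Ioi fun τ (hτ : 0 < τ) => ?_
  calc _ ≤ ∫⁻ s in Set.Ioi (0 : ℝ), ENNReal.ofReal (D * g τ * tauDensity n τ) *
          ENNReal.ofReal (sigmaSqDensity α₁ α₂ s) := by
        refine setLIntegral_mono' measurableSet_Ioi fun s (hs : 0 < s) => ?_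
        simp only [ENNReal.ofReal_mul' (sigmaSqDensity_nonneg hα₁ hα₂ hs),
          ENNReal.ofReal_mul' (tauDensity_nonneg hn hτ)]
        rw [lintegral_mul_const' _ _ ENNReal.ofReal_ne_top,
          lintegral_mul_const' _ _ ENNReal.ofReal_ne_top]
        gcongr
        exact h τ hτ s hs
    _ = ENNReal.ofReal D * ENNReal.ofReal (g τ * tauDensity n τ) := by
        rw [lintegral_const_mul' _ _ ENNReal.ofReal_ne_top, lintegral_sigmaSqDensity hα₁ hα₂,
          mul_one, mul_assoc, ENNReal.ofReal_mul hD]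

lemma emarginal_le {X : Matrix (Fin n) (Fin p) ℝ}
    {A : Matrix (Fin p) (Fin p) ℝ} {a₁ a₂ : ℝ} (hA : EigenvaluesBetween A a₁ a₂) (ha₁ : 0 < a₁)
    (ha₂ : 0 < a₂) (r : ℕ) {α₁ α₂ : ℝ} (hα₁ : 0 < α₁) (hα₂ : 0 < α₂) (hn : 1 ≤ n)
    {k : Finset (Fin p)} {y : Fin n → ℝ} {c N v : k → ℝ} {a Q W : ℝ} (ha : 0 < a)
    (hQ : ∀ β : k → ℝ, Q + a * ∑ i, (β i - c i) ^ 2 ≤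
      (y - subDesign X k *ᵥ β) ⬝ᵥ (y - subDesign X k *ᵥ β))
    (hN : ∀ i, ∀ s : ℝ, 0 < s → 1 + a * c i ^ 2 / s ≤ N i * Real.exp (v i / s))
    (hW : 0 < W) (hWQ : W ≤ Q - 2 * r * ∑ i, v i) :
    emarginal X A r α₁ α₂ k y ≤
      ENNReal.ofReal (((∫ u, momKernel r u) / pureMom r a₂) ^ k.card * (∏ i, N i) ^ r *
        profileLikelihood n W * (√2 * (a ^ (-(((r : ℝ) + 1 / 2) * k.card)) *
          (2 * (((r : ℝ) + 1 / 2) * k.card) / n) ^ (((r : ℝ) + 1 / 2) * k.card)))) := by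
  have hG := integral_momKernel_pos r
  have hJ := pureMom_pos r ha₂
  have hprod : 0 ≤ ∏ i, N i := Finset.prod_nonneg fun i _ =>
    (pos_of_mul_pos_left (lt_of_lt_of_le (by positivity) (hN i 1 one_pos)) (Real.exp_pos _).le).le
  have hprofile := profileLikelihood_nonneg n hW
  have hD : 0 ≤ ((∫ u, momKernel r u) / pureMom r a₂) ^ k.card * (∏ i, N i) ^ r *
      profileLikelihood n W := by positivity
  refine (emarginal_le_lintegral_tauDensity hα₁ hα₂ hn hD fun τ hτ s hs =>
    lintegral_likelihood_mul_pmomDensity_le hA ha₁ ha₂ r ha hQ hN hW hWQ hτ hs).trans ?_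
  rw [ENNReal.ofReal_mul hD]
  gcongr
  exact lintegral_rpow_neg_mul_tauDensity_le hn (by positivity) ha

end MarginalUpper

section MarginalLower

lemma mul_measure_le_setLIntegral {α : Type*} [MeasurableSpace α] {μ : Measure α} {s t : Set α}
    (ht : MeasurableSet t) (hts : t ⊆ s) {c : ℝ≥0∞} {f : α → ℝ≥0∞} (h : ∀ x ∈ t, c ≤ f x) :
    c * μ t ≤ ∫⁻ x in s, f x ∂μ := by
  rw [← setLIntegral_const]
  exact (setLIntegral_mono' ht h).trans (lintegral_mono_set hts)

lemma exp_mul_rpow_le_rpow {n : ℕ} {s s₀ : ℝ} (hn : 1 ≤ n) (hs₀ : 0 < s₀) (hs₀s : s₀ ≤ s)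
    (hs : s ≤ s₀ * (1 + 1 / n)) :
    Real.exp (-(1 / 2)) * s₀ ^ (-((n : ℝ) / 2)) ≤ s ^ (-((n : ℝ) / 2)) := by
  have pow_le : (1 + 1 / n : ℝ) ^ ((n : ℝ) / 2) ≤ Real.exp (1 / 2) := by
    calc (1 + 1 / n : ℝ) ^ ((n : ℝ) / 2) ≤ Real.exp (1 / n) ^ ((n : ℝ) / 2) := by
          gcongr
          linarith [Real.add_one_le_exp (1 / n : ℝ)]
      _ = Real.exp (1 / 2) := by
          rw [← Real.exp_mul]
          field_simp
  calc Real.exp (-(1 / 2)) * s₀ ^ (-((n : ℝ) / 2))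
      ≤ ((1 + 1 / n : ℝ) ^ ((n : ℝ) / 2))⁻¹ * s₀ ^ (-((n : ℝ) / 2)) := by
        rw [Real.exp_neg]
        gcongr
    _ = (s₀ * (1 + 1 / n)) ^ (-((n : ℝ) / 2)) := by
        rw [Real.mul_rpow hs₀.le (by positivity), Real.rpow_neg (by positivity) (x := 1 + 1 / _),
          mul_comm]
    _ ≤ s ^ (-((n : ℝ) / 2)) :=
        Real.rpow_le_rpow_of_nonpos (hs₀.trans_le hs₀s) hs (neg_nonpos.2 (by positivity))

variable {n p : ℕ}

lemma exp_mul_profileLikelihood_le_likelihood {X : Matrix (Fin n) (Fin p) ℝ}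
    {k : Finset (Fin p)} {y : Fin n → ℝ} {β : k → ℝ} {W s : ℝ} (hn : 1 ≤ n) (hW : 0 < W)
    (hβ : (y - subDesign X k *ᵥ β) ⬝ᵥ (y - subDesign X k *ᵥ β) ≤ W)
    (hWs : W / n ≤ s) (hs : s ≤ W / n * (1 + 1 / n)) :
    Real.exp (-(1 / 2)) * profileLikelihood n W ≤ likelihood X k y β s := by
  have hn₀ : (0 : ℝ) < n := by exact_mod_cast hn
  have hs₀ : 0 < s := lt_of_lt_of_le (by positivity) hWs
  have base_eq : (n / (Real.exp 1 * W)) ^ ((n : ℝ) / 2) =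
      (W / n) ^ (-((n : ℝ) / 2)) * Real.exp (-((n : ℝ) / 2)) := by
    rw [← div_div, div_right_comm, Real.div_rpow (by positivity) (by positivity), ← Real.exp_mul,
      one_mul, Real.exp_neg, Real.rpow_neg (by positivity), ← Real.inv_rpow (by positivity),
      inv_div, div_eq_mul_inv]
  have exponent_le : ((y - subDesign X k *ᵥ β) ⬝ᵥ (y - subDesign X k *ᵥ β)) / (2 * s) ≤ n / 2 := by
    rw [div_le_div_iff₀ (by positivity) two_pos]
    rw [div_le_iff₀ hn₀] at hWs
    linarith
  rw [likelihood, profileLikelihood, Real.mul_rpow (by positivity) hs₀.le, base_eq]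
  calc _ = (2 * Real.pi) ^ (-((n : ℝ) / 2)) *
          (Real.exp (-(1 / 2)) * (W / n) ^ (-((n : ℝ) / 2))) * Real.exp (-((n : ℝ) / 2)) := by
        ring
    _ ≤ _ := by
        gcongr
        exact exp_mul_rpow_le_rpow hn (by positivity) hWs hs

lemma EigenvaluesBetween.le_pmomDensity {A : Matrix (Fin p) (Fin p) ℝ} {a₁ a₂ : ℝ}
    (hA : EigenvaluesBetween A a₁ a₂) (ha₁ : 0 < a₁) (ha₂ : 0 < a₂) (r : ℕ) {k : Finset (Fin p)}
    {β : k → ℝ} {u v b M : ℝ} {τ s : ℝ} (hb : 0 ≤ b) (hβ : ∀ i, b ≤ |β i| ∧ |β i| ≤ M)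
    (hu : 0 < u) (huτ : u ≤ τ * s) (hv : τ * s ≤ v) :
    (pureMom r a₁ ^ k.card)⁻¹ * v ^ (-(((r : ℝ) + 1 / 2) * k.card)) *
      (Real.exp (-(a₂ * (k.card * M ^ 2) / (2 * u))) * (b ^ (2 * r)) ^ k.card) ≤
    pmomDensity A r k β τ s := by
  have hI := hA.pmomInt_pos ha₁ ha₂ r k
  have hτs : 0 < τ * s := hu.trans_le huτ
  have hv₀ : 0 < v := hτs.trans_le hv
  have rpow_le : v ^ (-(((r : ℝ) + 1 / 2) * k.card)) ≤ (τ * s) ^ (-(((r : ℝ) + 1 / 2) * k.card)) :=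
    Real.rpow_le_rpow_of_nonpos hτs hv (neg_nonpos.2 (by positivity))
  have norm_sq_le : β ⬝ᵥ β ≤ k.card * M ^ 2 := by
    have (i : k) : β i * β i ≤ M ^ 2 := by
      rw [← sq, ← sq_abs]
      exact pow_le_pow_left₀ (abs_nonneg _) (hβ i).2 2
    simpa [dotProduct] using Finset.sum_le_card_nsmul Finset.univ _ _ fun i _ => this i
  have exp_le : Real.exp (-(a₂ * (k.card * M ^ 2) / (2 * u))) ≤
      Real.exp (-((β ⬝ᵥ (subPrec A k *ᵥ β)) / (2 * (τ * s)))) := by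
    refine Real.exp_le_exp.2 (neg_le_neg
      (div_le_div₀ (by positivity) ?_ (by positivity) (by linarith)))
    exact (hA.quadForm_mem_Icc β).2.trans (mul_le_mul_of_nonneg_left norm_sq_le ha₂.le)
  have pow_le_prod : (b ^ (2 * r)) ^ k.card ≤ ∏ i, β i ^ (2 * r) := by
    rw [← Fintype.card_coe k, ← Finset.card_univ, ← Finset.prod_const]
    refine Finset.prod_le_prod (fun i _ => by positivity) fun i _ => ?_
    rw [← (even_two_mul r).pow_abs (β i)]
    exact pow_le_pow_left₀ hb (hβ i).1 _
  have inv_le : (pureMom r a₁ ^ k.card)⁻¹ ≤ (pmomInt A r k)⁻¹ :=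
    inv_anti₀ hI (hA.pmomInt_mem_Icc ha₁ ha₂ r k).2
  rw [pmomDensity_eq (hA.subPrec_posDef ha₁ k)]
  gcongr

lemma le_sigmaSqDensity {α b s s₀ s₁ : ℝ} (hα : 0 < α) (hb : 0 < b) (hs₀ : 0 < s₀) (hs₀s : s₀ ≤ s)
    (hss₁ : s ≤ s₁) :
    b ^ α / Real.Gamma α * s₁ ^ (-(α + 1)) * Real.exp (-(b / s₀)) ≤ sigmaSqDensity α b s := by
  have hs : 0 < s := hs₀.trans_le hs₀s
  have rpow_le : s₁ ^ (-(α + 1)) ≤ s ^ (-(α + 1)) :=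
    Real.rpow_le_rpow_of_nonpos hs hss₁ (by linarith)
  rw [sigmaSqDensity]
  gcongr

lemma exists_le_tauDensity :
    ∃ C : ℝ, 0 < C ∧ ∀ n : ℕ, 1 ≤ n → ∀ τ ∈ Set.Icc (n : ℝ) (2 * n),
      C * (n : ℝ)⁻¹ ≤ tauDensity n τ := by
  refine ⟨(2 ^ (1 / 2 : ℝ))⁻¹ / Real.Gamma (1 / 2) * 2 ^ (-(3 / 2) : ℝ) * Real.exp (-(1 / 2)),
    by positivity, fun n hn τ hτ => ?_⟩
  have hn₀ : (0 : ℝ) < n := by exact_mod_cast hn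
  have inv_eq : (n : ℝ)⁻¹ = (n : ℝ) ^ (1 / 2 : ℝ) * (n : ℝ) ^ (-(3 / 2) : ℝ) := by
    rw [← Real.rpow_add hn₀, ← Real.rpow_neg_one]
    norm_num
  rw [tauDensity_eq_sigmaSqDensity]
  refine le_of_eq_of_le ?_
    (le_sigmaSqDensity (one_half_pos (α := ℝ)) (half_pos hn₀) hn₀ hτ.1 hτ.2)
  rw [inv_eq, Real.mul_rpow two_pos.le hn₀.le, Real.div_rpow hn₀.le two_pos.le,
    show (n : ℝ) / 2 / n = 1 / 2 by field_simp, show (1 / 2 + 1 : ℝ) = 3 / 2 by norm_num]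
  ring

lemma ofReal_mul_box_le_emarginal {X : Matrix (Fin n) (Fin p) ℝ} {A : Matrix (Fin p) (Fin p) ℝ}
    {r : ℕ} {α₁ α₂ : ℝ} {k : Finset (Fin p)} {y : Fin n → ℝ} {c : k → ℝ}
    {h L s₀ s₁ τ₀ τ₁ : ℝ} (hL : 0 ≤ L) (hh : 0 ≤ h) (hs₀ : 0 < s₀) (hs : s₀ ≤ s₁) (hτ₀ : 0 < τ₀)
    (hbox : ∀ τ ∈ Set.Icc τ₀ τ₁, ∀ s ∈ Set.Icc s₀ s₁, ∀ β : k → ℝ, (∀ i, |β i - c i| ≤ h) →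
      L ≤ likelihood X k y β s * pmomDensity A r k β τ s * tauDensity n τ *
        sigmaSqDensity α₁ α₂ s) :
    ENNReal.ofReal (L * (2 * h) ^ k.card * (s₁ - s₀) * (τ₁ - τ₀)) ≤
      emarginal X A r α₁ α₂ k y := by
  have volume_cube : volume (Set.Icc (fun i : k => c i - h) fun i => c i + h) =
      ENNReal.ofReal ((2 * h) ^ k.card) := by
    simp only [Real.volume_Icc_pi, show ∀ i : k, c i + h - (c i - h) = 2 * h from
      fun i => by ring, Finset.prod_const, Finset.card_univ, Fintype.card_coe]
    rw [ENNReal.ofReal_pow (by positivity)]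
  rw [ENNReal.ofReal_mul (by have := sub_nonneg.2 hs; positivity),
    ENNReal.ofReal_mul (by positivity), ENNReal.ofReal_mul hL, ← Real.volume_Icc,
    ← Real.volume_Icc, ← volume_cube]
  refine mul_measure_le_setLIntegral measurableSet_Icc (fun τ hτ => hτ₀.trans_le hτ.1)
    fun τ hτ => mul_measure_le_setLIntegral measurableSet_Icc (fun s hs => hs₀.trans_le hs.1)
      fun s hs => ?_
  rw [← setLIntegral_univ]
  refine mul_measure_le_setLIntegral measurableSet_Icc (Set.subset_univ _) fun β hβ =>
    ENNReal.ofReal_le_ofReal (hbox τ hτ s hs β fun i => abs_le.2 ⟨?_, ?_⟩)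
  · linarith [hβ.1 i]
  · linarith [hβ.2 i]

lemma exists_le_priorDensities (r : ℕ) {α₁ α₂ a₁ a₂ s₀ s₁ b : ℝ} (M : ℝ) (T : ℕ) (hα₁ : 0 < α₁)
    (hα₂ : 0 < α₂) (ha₁ : 0 < a₁) (ha₂ : 0 < a₂) (hs₀ : 0 < s₀) (hs₁ : 0 < s₁) (hb : 0 < b) :
    ∃ C : ℝ, 0 < C ∧ ∀ (n p : ℕ) (A : Matrix (Fin p) (Fin p) ℝ) (k : Finset (Fin p)) (β : k → ℝ),
      1 ≤ n → EigenvaluesBetween A a₁ a₂ → k.card = T → (∀ i, b ≤ |β i| ∧ |β i| ≤ M) →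
      ∀ τ ∈ Set.Icc (n : ℝ) (2 * n), ∀ s ∈ Set.Icc s₀ s₁,
        C * ((n : ℝ) ^ (-(((r : ℝ) + 1 / 2) * T)) * (n : ℝ)⁻¹) ≤
          pmomDensity A r k β τ s * tauDensity n τ * sigmaSqDensity α₁ α₂ s := by
  obtain ⟨C, hC, le_tau⟩ := exists_le_tauDensity
  have hJ := pureMom_pos r ha₁
  set K : ℝ := (pureMom r a₁ ^ T)⁻¹ * (2 * s₁) ^ (-(((r : ℝ) + 1 / 2) * T)) *
    (Real.exp (-(a₂ * (T * M ^ 2) / (2 * s₀))) * (b ^ (2 * r)) ^ T)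
  set S : ℝ := α₂ ^ α₁ / Real.Gamma α₁ * s₁ ^ (-(α₁ + 1)) * Real.exp (-(α₂ / s₀))
  refine ⟨K * C * S, by positivity, fun n p A k β hn hA hk hβ τ hτ s hs => ?_⟩
  have hn₁ : (1 : ℝ) ≤ n := by exact_mod_cast hn
  have hτ₁ : 1 ≤ τ := hn₁.trans hτ.1
  have hs_pos : 0 < s := hs₀.trans_le hs.1
  have le_pmom : K * (n : ℝ) ^ (-(((r : ℝ) + 1 / 2) * T)) ≤ pmomDensity A r k β τ s := by
    refine le_of_eq_of_le ?_ (hA.le_pmomDensity ha₁ ha₂ r hb.le hβ hs₀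
      (hs.1.trans (le_mul_of_one_le_left hs_pos.le hτ₁))
      (mul_le_mul hτ.2 hs.2 hs_pos.le (by positivity)))
    rw [hk, show 2 * (n : ℝ) * s₁ = 2 * s₁ * n by ring,
      Real.mul_rpow (by positivity) (by positivity)]
    ring
  have le_tau := le_tau n hn τ hτ
  have le_sigma : S ≤ sigmaSqDensity α₁ α₂ s := le_sigmaSqDensity hα₁ hα₂ hs₀ hs.1 hs.2
  calc _ = K * (n : ℝ) ^ (-(((r : ℝ) + 1 / 2) * T)) * (C * (n : ℝ)⁻¹) * S := by ring
    _ ≤ _ := mul_le_mul (mul_le_mul le_pmom le_tau (by positivity)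
        (le_trans (by positivity) le_pmom)) le_sigma (by positivity)
        (mul_nonneg (le_trans (by positivity) le_pmom) (le_trans (by positivity) le_tau))

/- The marginal density is bounded below by the integral over the box `n ≤ τ ≤ 2n`,
`W/n ≤ σ² ≤ (W/n)(1 + 1/n)`, `|β_i - c_i| ≤ h`. -/
lemma exists_le_emarginal (r : ℕ) {α₁ α₂ a₁ a₂ s₀ s₁ b : ℝ} (M : ℝ) (T : ℕ) (hα₁ : 0 < α₁)
    (hα₂ : 0 < α₂) (ha₁ : 0 < a₁) (ha₂ : 0 < a₂) (hs₀ : 0 < s₀) (hs₁ : 0 < s₁) (hb : 0 < b) :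
    ∃ C : ℝ, 0 < C ∧ ∀ (n p : ℕ) (X : Matrix (Fin n) (Fin p) ℝ) (A : Matrix (Fin p) (Fin p) ℝ)
      (k : Finset (Fin p)) (y : Fin n → ℝ) (c : k → ℝ) (h W : ℝ),
      1 ≤ n → EigenvaluesBetween A a₁ a₂ → k.card = T → 0 < h →
      (∀ β : k → ℝ, (∀ i, |β i - c i| ≤ h) → (∀ i, b ≤ |β i| ∧ |β i| ≤ M) ∧
        (y - subDesign X k *ᵥ β) ⬝ᵥ (y - subDesign X k *ᵥ β) ≤ W) →
      s₀ * n ≤ W → W ≤ s₁ * n →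
      ENNReal.ofReal (C * (n : ℝ) ^ (-(((r : ℝ) + 1 / 2) * T)) * (n : ℝ)⁻¹ * h ^ T *
        profileLikelihood n W) ≤ emarginal X A r α₁ α₂ k y := by
  obtain ⟨C, hC, le_prior⟩ := exists_le_priorDensities r M T hα₁ hα₂ ha₁ ha₂ hs₀
    (by positivity : 0 < 2 * s₁) hb
  refine ⟨Real.exp (-(1 / 2)) * C * s₀ * 2 ^ T, by positivity, ?_⟩
  intro n p X A k y c h W hn hA hk hh hβ hW₀ hW₁
  have hn₀ : (0 : ℝ) < n := by exact_mod_cast hn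
  have hW : 0 < W := lt_of_lt_of_le (by positivity) hW₀
  have hs₀W : s₀ ≤ W / n := (le_div_iff₀ hn₀).2 hW₀
  have hWs₁ : W / n ≤ s₁ := (div_le_iff₀ hn₀).2 hW₁
  have inv_le_one : (1 / n : ℝ) ≤ 1 := div_le_one_of_le₀ (by exact_mod_cast hn) hn₀.le
  have upper_le : W / n * (1 + 1 / n) ≤ 2 * s₁ := by
    calc W / n * (1 + 1 / n) ≤ s₁ * (1 + 1) := by gcongr
      _ = 2 * s₁ := by ring
  have hprofile := profileLikelihood_nonneg n hW
  set L := Real.exp (-(1 / 2)) * profileLikelihood n W *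
    (C * ((n : ℝ) ^ (-(((r : ℝ) + 1 / 2) * T)) * (n : ℝ)⁻¹))
  have box : ENNReal.ofReal
      (L * (2 * h) ^ k.card * (W / n * (1 + 1 / n) - W / n) * (2 * n - n)) ≤
      emarginal X A r α₁ α₂ k y := by
    refine ofReal_mul_box_le_emarginal (c := c) (by positivity) hh.le (by positivity)
      (le_mul_of_one_le_right (by positivity) (by simp)) hn₀ fun τ hτ s hs β hβc => ?_
    obtain ⟨hβb, hβW⟩ := hβ β hβc
    rw [mul_assoc (likelihood X k y β s), mul_assoc (likelihood X k y β s)]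
    exact mul_le_mul (exp_mul_profileLikelihood_le_likelihood hn hW hβW hs.1 hs.2)
      (le_prior n p A k β hn hA hk hβb τ hτ s ⟨hs₀W.trans hs.1, hs.2.trans upper_le⟩)
      (by positivity) (by unfold likelihood; have := hs₀.trans_le (hs₀W.trans hs.1); positivity)
  refine (ENNReal.ofReal_le_ofReal ?_).trans box
  calc _ = L * (2 * h) ^ T * (s₀ * (n : ℝ)⁻¹) * n := by
        simp only [L, mul_pow]
        field_simp
    _ ≤ L * (2 * h) ^ k.card * (W / n * (n : ℝ)⁻¹) * n := by
        rw [hk]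
        gcongr
    _ = _ := by ring

end MarginalLower

section TrueModel

variable {n p : ℕ}

lemma mem_trueModel {β₀ : ℕ →₀ ℝ} {j : Fin p} : j ∈ trueModel p β₀ ↔ β₀ j ≠ 0 := by
  simp [trueModel]

lemma card_trueModel {β₀ : ℕ →₀ ℝ} (h : ∀ j ∈ β₀.support, j < p) :
    (trueModel p β₀).card = β₀.support.card := by
  rw [← Finset.card_map Fin.valEmbedding]
  congr 1
  ext j
  simp only [Finset.mem_map, mem_trueModel, Fin.valEmbedding_apply, Finsupp.mem_support_iff]
  exact ⟨fun ⟨_, hi, hij⟩ => hij ▸ hi,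
    fun hj => ⟨⟨j, h j (Finsupp.mem_support_iff.2 hj)⟩, hj, rfl⟩⟩

lemma sum_sq_le_sum_support (β₀ : ℕ →₀ ℝ) (k : Finset (Fin p)) :
    ∑ j ∈ k, β₀ j ^ 2 ≤ ∑ j ∈ β₀.support, β₀ j ^ 2 := by
  calc ∑ j ∈ k, β₀ j ^ 2 = ∑ j ∈ k.map Fin.valEmbedding, β₀ j ^ 2 := by
        rw [Finset.sum_map]
        rfl
    _ = ∑ j ∈ k.map Fin.valEmbedding with β₀ j ^ 2 ≠ 0, β₀ j ^ 2 :=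
        (Finset.sum_filter_ne_zero _).symm
    _ ≤ ∑ j ∈ β₀.support, β₀ j ^ 2 :=
        Finset.sum_le_sum_of_subset_of_nonneg (fun j hj => Finsupp.mem_support_iff.2 <|
          (pow_ne_zero_iff two_ne_zero).1 (Finset.mem_filter.1 hj).2) fun _ _ _ => sq_nonneg _

lemma response_sub_subDesign_mulVec (X : Matrix (Fin n) (Fin p) ℝ) (β₀ : ℕ →₀ ℝ)
    (e : Fin n → ℝ) {k K : Finset (Fin p)} (hk : k ⊆ K) (ht : trueModel p β₀ ⊆ K) (β : k → ℝ) :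
    response X β₀ e - subDesign X k *ᵥ β =
      e - subDesign X K *ᵥ fun j => extendZero β j - β₀ j := by
  have extend_restrict : extendZero (fun j : K => extendZero β j - β₀ j) =
      extendZero β - fun j : Fin p => β₀ j := by
    ext j
    by_cases hj : j ∈ K
    · simp [extendZero, hj]
    · have hβ₀ : β₀ j = 0 := not_not.1 fun h => hj (ht (mem_trueModel.2 h))
      simp [extendZero_of_notMem _ hj, extendZero_of_notMem _ fun h => hj (hk h), hβ₀]
  rw [subDesign, subDesign, ← mulVec_extendZero, ← mulVec_extendZero, extend_restrict,
    Matrix.mulVec_sub, response]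
  abel

end TrueModel

section MarginalUpperTrueModel

variable {n p : ℕ}

lemma DesignEigenBounds.exists_le_residual {X : Matrix (Fin n) (Fin p) ℝ} {ε : ℝ}
    (h : DesignEigenBounds X ε) (hn : 1 ≤ n) (hε : 0 < ε) (β₀ : ℕ →₀ ℝ) (e : Fin n → ℝ)
    {k : Finset (Fin p)} (hK : (k ∪ trueModel p β₀).card ≤ n) :
    ∃ g : Fin p → ℝ, n * ε * ∑ j ∈ k ∪ trueModel p β₀, g j ^ 2 ≤
        projSq (subDesign X (k ∪ trueModel p β₀)) e ∧
      ∀ β : k → ℝ, e ⬝ᵥ e - projSq (subDesign X (k ∪ trueModel p β₀)) e +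
          n * ε * ∑ j ∈ trueModel p β₀ \ k, (β₀ j + g j) ^ 2 +
          n * ε * ∑ i : k, (β i - (β₀ i + g i)) ^ 2 ≤
        (response X β₀ e - subDesign X k *ᵥ β) ⬝ᵥ (response X β₀ e - subDesign X k *ᵥ β) := by
  set t := trueModel p β₀
  set g : Fin p → ℝ := extendZero (lsq (subDesign X (k ∪ t)) e)
  have lower (v : (k ∪ t : Finset (Fin p)) → ℝ) := (h.subDesign_mem_Icc hn hK v).1
  refine ⟨g, ?_, fun β => ?_⟩
  · refine le_of_eq_of_le ?_ (lower (lsq (subDesign X (k ∪ t)) e))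
    rw [← Finset.sum_coe_sort]
    simp only [g, extendZero_coe, dotProduct, ← sq]
  · have split_sum : ∑ j ∈ k ∪ t, (extendZero β j - β₀ j - g j) ^ 2 =
        ∑ i : k, (β i - (β₀ i + g i)) ^ 2 + ∑ j ∈ t \ k, (β₀ j + g j) ^ 2 := by
      rw [← Finset.union_sdiff_self_eq_union, Finset.sum_union Finset.disjoint_sdiff,
        ← Finset.sum_coe_sort k]
      congr 1
      · simp only [extendZero_coe, sub_sub]
      · refine Finset.sum_congr rfl fun j hj => ?_
        rw [extendZero_of_notMem β (Finset.mem_sdiff.1 hj).2]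
        ring
    rw [response_sub_subDesign_mulVec X β₀ e Finset.subset_union_left Finset.subset_union_right,
      sub_mulVec_dotProduct_self (h.injective_mulVec hn hε hK), add_assoc, ← mul_add,
      add_comm (∑ j ∈ t \ k, _), ← split_sum]
    gcongr
    refine le_of_eq_of_le ?_ (lower _)
    rw [← Finset.sum_coe_sort]
    simp only [g, extendZero_coe, dotProduct, ← sq, Pi.sub_apply]

lemma missing_signal_ge {β₀ : ℕ →₀ ℝ} {b : ℝ} (hb : 0 ≤ b) (hβ₀ : ∀ j ∈ β₀.support, b ≤ |β₀ j|)
    {k : Finset (Fin p)} (hk : ¬ trueModel p β₀ ⊆ k) (g : Fin p → ℝ) :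
    b ^ 2 / 2 - ∑ j ∈ k ∪ trueModel p β₀, g j ^ 2 ≤
      ∑ j ∈ trueModel p β₀ \ k, (β₀ j + g j) ^ 2 := by
  obtain ⟨j, hjt, hjk⟩ := Finset.not_subset.1 hk
  have hbj : b ^ 2 ≤ β₀ j ^ 2 := by
    rw [← sq_abs (β₀ j)]
    exact pow_le_pow_left₀ hb (hβ₀ j (Finsupp.mem_support_iff.2 (mem_trueModel.1 hjt))) 2
  calc b ^ 2 / 2 - ∑ j ∈ k ∪ trueModel p β₀, g j ^ 2 ≤ b ^ 2 / 2 - g j ^ 2 :=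
        sub_le_sub_left (Finset.single_le_sum (f := fun j => g j ^ 2) (fun _ _ => sq_nonneg _)
          (Finset.mem_union_right k hjt)) _
    _ ≤ (β₀ j + g j) ^ 2 := by nlinarith [sq_nonneg (β₀ j + 2 * g j)]
    _ ≤ _ := Finset.single_le_sum (f := fun j : Fin p => (β₀ j + g j) ^ 2)
        (fun _ _ => sq_nonneg _) (Finset.mem_sdiff.2 ⟨hjt, hjk⟩)

lemma one_add_le_mul_exp_div (x : ℝ) {K : ℝ} (hK : 1 ≤ K) : 1 + x ≤ K * Real.exp (x / K) := by
  have hK₀ : 0 < K := one_pos.trans_le hK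
  calc 1 + x ≤ K * (x / K + 1) := by
        rw [mul_add, mul_div_cancel₀ x hK₀.ne']
        linarith
    _ ≤ K * Real.exp (x / K) := by
        gcongr
        exact Real.add_one_le_exp _

/- An inactive coefficient costs the constant factor `K`, an active one a factor of order `n`, and
only a `K`-th part of the fitted noise `a g²` enters the exponent. -/
lemma one_add_mul_add_sq_div_le {a g b₀ s n K : ℝ} (hs : 0 < s) (ha : 0 < a) (han : a ≤ n)
    (hn : 1 ≤ n) (hK : 1 ≤ K) :
    1 + a * (b₀ + g) ^ 2 / s ≤ (K * if b₀ ≠ 0 then n else 1) *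
      Real.exp ((2 * a * g ^ 2 / K + 2 * b₀ ^ 2) / s) := by
  have hn₀ : 0 < n := one_pos.trans_le hn
  have signal_le : 1 + 2 * a * b₀ ^ 2 / s ≤
      (if b₀ ≠ 0 then n else 1) * Real.exp (2 * b₀ ^ 2 / s) := by
    split_ifs with h
    · refine (one_add_le_mul_exp_div _ hn).trans (mul_le_mul_of_nonneg_left
        (Real.exp_le_exp.2 ?_) hn₀.le)
      rw [div_right_comm]
      gcongr
      rw [div_le_iff₀ hn₀]
      nlinarith [mul_le_mul_of_nonneg_right han (sq_nonneg b₀)]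
    · simp [not_not.1 h]
  calc 1 + a * (b₀ + g) ^ 2 / s ≤ 1 + (2 * a * g ^ 2 / s + 2 * a * b₀ ^ 2 / s) := by
        rw [← add_div]
        gcongr
        nlinarith [mul_nonneg ha.le (sq_nonneg (b₀ - g))]
    _ ≤ (1 + 2 * a * g ^ 2 / s) * (1 + 2 * a * b₀ ^ 2 / s) := by
        have : 0 ≤ (2 * a * g ^ 2 / s) * (2 * a * b₀ ^ 2 / s) := by positivity
        linarith
    _ ≤ (K * Real.exp (2 * a * g ^ 2 / s / K)) *
        ((if b₀ ≠ 0 then n else 1) * Real.exp (2 * b₀ ^ 2 / s)) :=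
      mul_le_mul (one_add_le_mul_exp_div _ hK) signal_le (by positivity) (by positivity)
    _ = _ := by
        rw [add_div, Real.exp_add, div_right_comm]
        ring

lemma exists_factor_le_exp (r : ℕ) {x K : ℝ} (hx : 0 < x) (hK : 1 ≤ K) :
    ∃ C : ℝ, 0 < C ∧ ∀ (n m j : ℕ) (ε : ℝ), 1 ≤ n → 0 < ε →
      x ^ m * (K ^ m * (n : ℝ) ^ j) ^ r * (√2 * ((n * ε) ^ (-(((r : ℝ) + 1 / 2) * m)) *
        (2 * (((r : ℝ) + 1 / 2) * m) / n) ^ (((r : ℝ) + 1 / 2) * m))) ≤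
      Real.exp (C * (m + 1) + r * j * Real.log n +
        ((r : ℝ) + 1 / 2) * m * (Real.log m - 2 * Real.log n - Real.log ε)) := by
  set ρ : ℝ := (r : ℝ) + 1 / 2
  have hρ : 0 < ρ := by positivity
  have hlogK : 0 ≤ Real.log K := Real.log_nonneg hK
  refine ⟨1 + |Real.log x| + r * Real.log K + ρ * |Real.log (2 * ρ)|, by positivity, ?_⟩
  intro n m j ε hn hε
  have hn₀ : (0 : ℝ) < n := by exact_mod_cast hn
  have sqrt_two_le : √2 ≤ Real.exp 1 :=
    (Real.sqrt_le_left two_pos.le |>.2 (by norm_num)).trans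
      (by linarith [Real.add_one_le_exp (1 : ℝ)] : (2 : ℝ) ≤ Real.exp 1)
  have rpow_eq : (2 * (ρ * m) / n) ^ (ρ * m) =
      Real.exp ((Real.log (2 * ρ) + Real.log m - Real.log n) * (ρ * m)) := by
    rcases Nat.eq_zero_or_pos m with rfl | hm
    · simp
    · have hm₀ : (0 : ℝ) < m := by exact_mod_cast hm
      rw [Real.rpow_def_of_pos (by positivity), Real.log_div (by positivity) hn₀.ne',
        ← mul_assoc 2 ρ (m : ℝ),
        Real.log_mul (by positivity) hm₀.ne']
  have pow_eq : x ^ m * (K ^ m * (n : ℝ) ^ j) ^ r =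
      Real.exp (m * Real.log x + r * (m * Real.log K + j * Real.log n)) := by
    simp only [Real.exp_add, mul_comm _ (Real.log _), mul_comm _ (_ + _), Real.exp_mul,
      Real.exp_log hx, Real.exp_log (one_pos.trans_le hK), Real.exp_log hn₀, Real.rpow_natCast]
  rw [rpow_eq, pow_eq, Real.rpow_def_of_pos (mul_pos hn₀ hε), Real.log_mul hn₀.ne' hε.ne']
  calc _ ≤ Real.exp (m * Real.log x + r * (m * Real.log K + j * Real.log n)) * (Real.exp 1 *
          (Real.exp ((Real.log n + Real.log ε) * -(ρ * m)) *
          Real.exp ((Real.log (2 * ρ) + Real.log m - Real.log n) * (ρ * m)))) := by gcongr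
    _ ≤ _ := by
        rw [← Real.exp_add, ← Real.exp_add, ← Real.exp_add, Real.exp_le_exp]
        have hm₀ : (0 : ℝ) ≤ m := by positivity
        have hlogx := mul_le_mul_of_nonneg_left (le_abs_self (Real.log x)) hm₀
        have hlogρ := mul_le_mul_of_nonneg_left (le_abs_self (Real.log (2 * ρ)))
          (mul_nonneg hρ.le hm₀)
        have := abs_nonneg (Real.log x)
        have : 0 ≤ ρ * |Real.log (2 * ρ)| := by positivity
        have : 0 ≤ r * Real.log K := by positivity
        nlinarith

lemma sum_penalty_le (β₀ : ℕ →₀ ℝ) {δ a D : ℝ} (r : ℕ) (hδ : 0 < δ) (ha : 0 ≤ a)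
    {k K : Finset (Fin p)} (hk : k ⊆ K) {g : Fin p → ℝ} (hg : a * ∑ j ∈ K, g j ^ 2 ≤ D) :
    2 * r * ∑ i : k, (2 * a * g i ^ 2 / (1 + 4 * r / δ) + 2 * β₀ i ^ 2) ≤
      δ * D + 4 * r * ∑ j ∈ β₀.support, β₀ j ^ 2 := by
  have noise_le : a * ∑ j ∈ k, g j ^ 2 ≤ D := (mul_le_mul_of_nonneg_left
    (Finset.sum_le_sum_of_subset_of_nonneg hk fun _ _ _ => sq_nonneg _) ha).trans hg
  have coeff_le : 2 * r * (2 / (1 + 4 * r / δ)) ≤ δ := by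
    rw [mul_div_assoc', div_le_iff₀ (by positivity), mul_add, mul_div_cancel₀ _ hδ.ne']
    linarith
  calc 2 * r * ∑ i : k, (2 * a * g i ^ 2 / (1 + 4 * r / δ) + 2 * β₀ i ^ 2)
      = 2 * r * (2 / (1 + 4 * r / δ)) * (a * ∑ j ∈ k, g j ^ 2) + 4 * r * ∑ j ∈ k, β₀ j ^ 2 := by
        rw [Finset.sum_coe_sort k fun i : Fin p =>
            2 * a * g i ^ 2 / (1 + 4 * r / δ) + 2 * β₀ i ^ 2,
          Finset.sum_add_distrib, ← Finset.sum_div, ← Finset.mul_sum, ← Finset.mul_sum]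
        ring
    _ ≤ δ * D + 4 * r * ∑ j ∈ β₀.support, β₀ j ^ 2 := by
        gcongr
        exact sum_sq_le_sum_support β₀ k

lemma exists_emarginal_response_le (r : ℕ) {α₁ α₂ a₁ a₂ : ℝ} (hα₁ : 0 < α₁) (hα₂ : 0 < α₂)
    (ha₁ : 0 < a₁) (ha₂ : 0 < a₂) (β₀ : ℕ →₀ ℝ) {b δ : ℝ} (hb : 0 ≤ b)
    (hβ₀ : ∀ j ∈ β₀.support, b ≤ |β₀ j|) (hδ : 0 < δ) :
    ∃ C : ℝ, 0 < C ∧ ∀ (n p : ℕ) (X : Matrix (Fin n) (Fin p) ℝ) (A : Matrix (Fin p) (Fin p) ℝ)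
      (ε : ℝ) (k : Finset (Fin p)) (e : Fin n → ℝ) (W : ℝ),
      1 ≤ n → EigenvaluesBetween A a₁ a₂ → DesignEigenBounds X ε → 0 < ε → ε < 1 →
      (k ∪ trueModel p β₀).card ≤ n → 0 < W →
      (trueModel p β₀ ⊆ k →
        W ≤ e ⬝ᵥ e - (1 + δ) * projSq (subDesign X (k ∪ trueModel p β₀)) e - C) →
      (¬ trueModel p β₀ ⊆ k → W ≤ e ⬝ᵥ e + n * ε * (b ^ 2 / 2) -
        (2 + δ) * projSq (subDesign X (k ∪ trueModel p β₀)) e - C) →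
      emarginal X A r α₁ α₂ k (response X β₀ e) ≤
        ENNReal.ofReal (Real.exp (C * (k.card + 1) +
          r * (k ∩ trueModel p β₀).card * Real.log n +
          ((r : ℝ) + 1 / 2) * k.card * (Real.log k.card - 2 * Real.log n - Real.log ε)) *
          profileLikelihood n W) := by
  set K : ℝ := 1 + 4 * r / δ
  have hK : 1 ≤ K := le_add_of_nonneg_right (by positivity)
  set S : ℝ := ∑ j ∈ β₀.support, β₀ j ^ 2
  have hS : 0 ≤ S := Finset.sum_nonneg fun _ _ => sq_nonneg _
  obtain ⟨C, hC, factor_le⟩ := exists_factor_le_exp r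
    (div_pos (integral_momKernel_pos r) (pureMom_pos r ha₂)) hK
  refine ⟨C + 4 * r * S, by positivity, ?_⟩
  intro n p X A ε k e W hn hA hX hε hε₁ hKn hW hover hunder
  have hn₁ : (1 : ℝ) ≤ n := by exact_mod_cast hn
  have ha : (0 : ℝ) < n * ε := by positivity
  obtain ⟨g, fitted_le, residual_ge⟩ := hX.exists_le_residual hn hε β₀ e hKn
  set t := trueModel p β₀
  set D := projSq (subDesign X (k ∪ t)) e
  have penalty_le := sum_penalty_le β₀ r hδ ha.le Finset.subset_union_left fitted_le
  have W_le : W + 4 * r * S ≤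
      e ⬝ᵥ e - (1 + δ) * D + n * ε * ∑ j ∈ t \ k, (β₀ j + g j) ^ 2 := by
    by_cases htk : t ⊆ k
    · have : 0 ≤ n * ε * ∑ j ∈ t \ k, (β₀ j + g j) ^ 2 := by positivity
      linarith [hover htk]
    · have := mul_le_mul_of_nonneg_left (missing_signal_ge hb hβ₀ htk g) ha.le
      rw [mul_sub] at this
      linarith [hunder htk]
  have prod_eq : ∏ i : k, (K * if β₀ i ≠ 0 then (n : ℝ) else 1) =
      K ^ k.card * (n : ℝ) ^ (k ∩ t).card := by
    rw [Finset.prod_coe_sort k fun i : Fin p => (K * if β₀ i ≠ 0 then (n : ℝ) else 1),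
      Finset.prod_mul_distrib, Finset.prod_const, Finset.prod_ite, Finset.prod_const_one, mul_one,
      Finset.prod_const]
    congr 3
    ext j
    simp only [t, Finset.mem_filter, Finset.mem_inter, mem_trueModel]
  have hprofile := profileLikelihood_nonneg n hW
  refine (emarginal_le hA ha₁ ha₂ r hα₁ hα₂ hn ha residual_ge (fun i s hs =>
    one_add_mul_add_sq_div_le hs ha (mul_le_of_le_one_right (by positivity) hε₁.le) hn₁ hK)
    hW (by linarith)).trans (ENNReal.ofReal_le_ofReal ?_)
  rw [prod_eq, mul_right_comm]
  refine mul_le_mul_of_nonneg_right ((factor_le n k.card (k ∩ t).card ε hn hε).trans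
    (Real.exp_le_exp.2 ?_)) hprofile
  gcongr
  exact le_add_of_nonneg_right (by positivity)

end MarginalUpperTrueModel

section MarginalLowerTrueModel

lemma sub_mulVec_dotProduct_self_le {m ι : Type*} [Fintype m] [Fintype ι] [DecidableEq ι]
    {M : Matrix m ι ℝ} (hM : Function.Injective M.mulVec) (e : m → ℝ) (v : ι → ℝ) :
    (e - M *ᵥ v) ⬝ᵥ (e - M *ᵥ v) ≤ e ⬝ᵥ e + projSq M e + 2 * ((M *ᵥ v) ⬝ᵥ (M *ᵥ v)) := by
  have parallelogram : (e - M *ᵥ v) ⬝ᵥ (e - M *ᵥ v) + (e - M *ᵥ (-v)) ⬝ᵥ (e - M *ᵥ (-v)) =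
      2 * (e ⬝ᵥ e) + 2 * ((M *ᵥ v) ⬝ᵥ (M *ᵥ v)) := by
    simp only [Matrix.mulVec_neg, sub_neg_eq_add, sub_dotProduct, dotProduct_sub, add_dotProduct,
      dotProduct_add]
    ring
  have reflected := sub_mulVec_dotProduct_self hM e (-v)
  have := dotProduct_self_nonneg (M *ᵥ (-v - lsq M e))
  linarith

variable {n p : ℕ}

lemma DesignEigenBounds.residual_le {X : Matrix (Fin n) (Fin p) ℝ} {ε : ℝ}
    (h : DesignEigenBounds X ε) (hn : 1 ≤ n) (hε : 0 < ε) {β₀ : ℕ →₀ ℝ}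
    (hk : (trueModel p β₀).card ≤ n) (e : Fin n → ℝ) {β : trueModel p β₀ → ℝ}
    (hβ : ∀ i, |β i - β₀ i| ≤ √(ε / n)) :
    (response X β₀ e - subDesign X (trueModel p β₀) *ᵥ β) ⬝ᵥ
        (response X β₀ e - subDesign X (trueModel p β₀) *ᵥ β) ≤
      e ⬝ᵥ e + projSq (subDesign X (trueModel p β₀)) e + 2 * (trueModel p β₀).card := by
  rw [response_sub_subDesign_mulVec X β₀ e subset_rfl subset_rfl]
  set v : trueModel p β₀ → ℝ := fun j => extendZero β j - β₀ j with hv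
  have hn₀ : (0 : ℝ) < n := by exact_mod_cast hn
  have v_le : v ⬝ᵥ v ≤ (trueModel p β₀).card * (ε / n) := by
    have entry_le (i) (_ : i ∈ Finset.univ) : v i * v i ≤ ε / n := by
      rw [← sq, ← Real.sq_sqrt (show 0 ≤ ε / n by positivity), sq_le_sq, abs_of_nonneg
        (Real.sqrt_nonneg _)]
      simpa only [hv, extendZero_coe] using hβ i
    simpa [dotProduct] using Finset.sum_le_card_nsmul _ _ _ entry_le
  refine (sub_mulVec_dotProduct_self_le (h.injective_mulVec hn hε hk) e v).trans ?_
  gcongr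
  calc _ ≤ n * ε⁻¹ * (v ⬝ᵥ v) := (h.subDesign_mem_Icc hn hk v).2
    _ ≤ n * ε⁻¹ * ((trueModel p β₀).card * (ε / n)) := by gcongr
    _ = (trueModel p β₀).card := by field_simp

lemma mul_rpow_mul_inv_mul_sqrt_pow_eq_exp {c x ε : ℝ} (hc : 0 < c) (hx : 0 < x) (hε : 0 < ε)
    (a : ℝ) (T : ℕ) :
    c * x ^ (-a) * x⁻¹ * √(ε / x) ^ T =
      Real.exp (Real.log c - (a + 1) * Real.log x + T / 2 * (Real.log ε - Real.log x)) := by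
  have sqrt_pow_eq : √(ε / x) ^ T = Real.exp (T / 2 * (Real.log ε - Real.log x)) := by
    rw [← Real.log_div hε.ne' hx.ne', div_mul_eq_mul_div, mul_div_assoc,
      ← Real.log_sqrt (by positivity), Real.exp_nat_mul, Real.exp_log (by positivity)]
  rw [mul_assoc c, ← Real.rpow_neg_one, ← Real.rpow_add hx, Real.rpow_def_of_pos hx, sqrt_pow_eq]
  nth_rewrite 1 [← Real.exp_log hc]
  rw [← Real.exp_add, ← Real.exp_add]
  congr 1
  ring

lemma exists_le_emarginal_response (r : ℕ) {α₁ α₂ a₁ a₂ s₀ s₁ : ℝ} (hα₁ : 0 < α₁) (hα₂ : 0 < α₂)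
    (ha₁ : 0 < a₁) (ha₂ : 0 < a₂) (hs₀ : 0 < s₀) (hs₁ : 0 < s₁) (β₀ : ℕ →₀ ℝ) {b : ℝ} (hb : 0 < b)
    (hβ₀ : ∀ j ∈ β₀.support, b ≤ |β₀ j|) :
    ∃ C : ℝ, ∀ (n p : ℕ) (X : Matrix (Fin n) (Fin p) ℝ) (A : Matrix (Fin p) (Fin p) ℝ)
      (ε : ℝ) (e : Fin n → ℝ) (W : ℝ),
      1 ≤ n → EigenvaluesBetween A a₁ a₂ → DesignEigenBounds X ε → 0 < ε →
      (∀ j ∈ β₀.support, j < p) → β₀.support.card ≤ n → √(ε / n) ≤ b / 2 →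
      W = e ⬝ᵥ e + projSq (subDesign X (trueModel p β₀)) e + 2 * β₀.support.card →
      s₀ * n ≤ W → W ≤ s₁ * n →
      ENNReal.ofReal (Real.exp (C - (((r : ℝ) + 1 / 2) * β₀.support.card + 1) * Real.log n +
        β₀.support.card / 2 * (Real.log ε - Real.log n)) * profileLikelihood n W) ≤
      emarginal X A r α₁ α₂ (trueModel p β₀) (response X β₀ e) := by
  obtain ⟨C, hC, le_emarginal⟩ := exists_le_emarginal r (∑ j ∈ β₀.support, |β₀ j| + b)
    β₀.support.card hα₁ hα₂ ha₁ ha₂ hs₀ hs₁ (half_pos hb)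
  refine ⟨Real.log C, ?_⟩
  intro n p X A ε e W hn hA hX hε hp hTn hradius hW hW₀ hW₁
  have hn₀ : (0 : ℝ) < n := by exact_mod_cast hn
  have hcard := card_trueModel hp
  rw [← mul_rpow_mul_inv_mul_sqrt_pow_eq_exp hC hn₀ hε]
  refine le_emarginal n p X A (trueModel p β₀) (response X β₀ e) (fun i => β₀ i) (√(ε / n)) W hn hA
    hcard (Real.sqrt_pos.2 (by positivity)) (fun β hβ => ⟨fun i => ?_, ?_⟩) hW₀ hW₁
  · have hi : (i : ℕ) ∈ β₀.support := Finsupp.mem_support_iff.2 (mem_trueModel.1 i.2)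
    have coeff_ge := hβ₀ i hi
    have coeff_le : |β₀ i| ≤ ∑ j ∈ β₀.support, |β₀ j| :=
      Finset.single_le_sum (f := fun j => |β₀ j|) (fun _ _ => abs_nonneg _) hi
    have dist_le := abs_le.1 ((abs_abs_sub_abs_le _ _).trans ((hβ i).trans hradius))
    constructor <;> linarith
  · rw [hW, ← hcard]
    exact hX.residual_le hn hε (hcard ▸ hTn) e hβ

end MarginalLowerTrueModel

section Exponents

lemma profileLikelihood_le_exp_mul (n : ℕ) {V W : ℝ} (hV : 0 < V) (hW : 0 < W) :
    profileLikelihood n V ≤ Real.exp (n / 2 * ((W - V) / V)) * profileLikelihood n W := by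
  have rpow_le : (W / V) ^ ((n : ℝ) / 2) ≤ Real.exp (n / 2 * ((W - V) / V)) := by
    have div_le : W / V ≤ Real.exp ((W - V) / V) := by
      rw [sub_div, div_self hV.ne']
      linarith [Real.add_one_le_exp (W / V - 1)]
    rw [mul_comm, Real.exp_mul]
    exact Real.rpow_le_rpow (by positivity) div_le (by positivity)
  have rpow_eq : (n / (Real.exp 1 * V)) ^ ((n : ℝ) / 2) =
      (W / V) ^ ((n : ℝ) / 2) * (n / (Real.exp 1 * W)) ^ ((n : ℝ) / 2) := by
    rw [← Real.mul_rpow (by positivity) (by positivity)]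
    congr 1
    field_simp
  rw [profileLikelihood, profileLikelihood, rpow_eq, mul_left_comm]
  exact mul_le_mul_of_nonneg_right rpow_le (by positivity)

/-- The exponent of the upper bound for the prior weight times the marginal density of a model with
`m` variables, `j` of which belong to the true model. Here `lam = log c₁ + c₂ log p` is the price of
a variable in the complexity prior and `C` a constant of the marginal likelihood bound. -/
def upperExponent (r : ℕ) (C lam : ℝ) (n : ℕ) (ε : ℝ) (m j : ℕ) : ℝ :=
  -(m * lam) + (C * (m + 1) + r * j * Real.log n +
    ((r : ℝ) + 1 / 2) * m * (Real.log m - 2 * Real.log n - Real.log ε))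

/-- The exponent of the lower bound for the prior weight times the marginal density of the true
model of size `T`, with `lam` and `C` as in `upperExponent`. -/
def lowerExponent (r T : ℕ) (C lam : ℝ) (n : ℕ) (ε : ℝ) : ℝ :=
  -(T * lam) + (C - (((r : ℝ) + 1 / 2) * T + 1) * Real.log n +
    T / 2 * (Real.log ε - Real.log n))

lemma log_le_mul_log_two (m : ℕ) : Real.log m ≤ m * Real.log 2 := by
  rcases Nat.eq_zero_or_pos m with rfl | hm
  · simp
  · rw [← Real.log_pow]
    exact Real.log_le_log (by exact_mod_cast hm) (by exact_mod_cast Nat.lt_two_pow_self.le)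

/- Each of the `d` superfluous variables gains at most `5/4 log n` of likelihood and loses
`2 (r + 1/2) log n`, of which the term `(r + 1/2) log m` gives back at most a half, by `m ≤ n`. As
`r + 1/2 ≥ 3/2`, a loss of `1/4 log n` remains. Only `d - 1` variables are charged `m ≤ n`, and
what is saved pays for the additive multiples of `log n`; for the others `log m ≤ m log 2`. -/
lemma exists_upperExponent_le_of_overfit {r : ℕ} (hr : 1 ≤ r) (T : ℕ) {C lam₀ : ℝ} (C' K : ℝ)
    (hC : 0 ≤ C) (hlam₀ : 0 ≤ lam₀) :
    ∃ B E : ℝ, 0 ≤ E ∧ ∀ (n d : ℕ) (ε lam x : ℝ), 1 ≤ d → T + d ≤ n → 0 < ε → ε < 1 →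
      -lam₀ ≤ lam → x ≤ (5 / 4 * d + 1 / 4) * Real.log n + K →
      upperExponent r C lam n ε (T + d) T + x ≤
        (d + 1) * (B - E * Real.log ε - 1 / 4 * Real.log n) + lowerExponent r T C' lam n ε := by
  obtain ⟨ρ, hρ⟩ : ∃ ρ : ℝ, ρ = (r : ℝ) + 1 / 2 := ⟨_, rfl⟩
  have hr₁ : (1 : ℝ) ≤ r := by exact_mod_cast hr
  refine ⟨lam₀ + C * (T + 1) + |C'| + |K| + ρ * (T + 1) * (T + 1) * Real.log 2,
    ρ * (T + 1) + T / 2, by rw [hρ]; positivity, ?_⟩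
  intro n d ε lam x hd hTd hε hε₁ hlam hx
  have hd₁ : (1 : ℝ) ≤ d := by exact_mod_cast hd
  have hlogε : Real.log ε ≤ 0 := Real.log_nonpos hε.le hε₁.le
  have hρ₀ : 0 < ρ := by linarith
  have entropy_le : ρ * ((T + d) * Real.log (T + d)) ≤
      ρ * ((T + 1) * ((T + d) * Real.log 2) + (d - 1) * Real.log n) := by
    have le_log_two := log_le_mul_log_two (T + d)
    have le_log : Real.log (T + d) ≤ Real.log n :=
      Real.log_le_log (by positivity) (by exact_mod_cast hTd)
    rw [Nat.cast_add] at le_log_two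
    refine mul_le_mul_of_nonneg_left ?_ hρ₀.le
    linarith [mul_le_mul_of_nonneg_left le_log_two (by positivity : (0 : ℝ) ≤ T + 1),
      mul_le_mul_of_nonneg_left le_log (by linarith : (0 : ℝ) ≤ d - 1)]
  have log_n_le : (3 / 2 - ρ) * ((d + 1) * Real.log n) ≤ 0 :=
    mul_nonpos_of_nonpos_of_nonneg (by linarith) (by positivity)
  have log_ε_le : (ρ * (T * d + 1) + d * (T / 2)) * Real.log ε ≤ 0 :=
    mul_nonpos_of_nonneg_of_nonpos (by positivity) hlogε
  have prior_le : -(d * lam) ≤ (d + 1) * lam₀ := by nlinarith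
  have C_le : C * (T + d + 1) ≤ (d + 1) * (C * (T + 1)) := by
    have : 0 ≤ C * (T * d) := by positivity
    linarith
  have K_le : K ≤ (d + 1) * |K| :=
    (le_abs_self _).trans (le_mul_of_one_le_left (abs_nonneg _) (by linarith))
  have C'_le : -C' ≤ (d + 1) * |C'| :=
    (neg_le_abs _).trans (le_mul_of_one_le_left (abs_nonneg _) (by linarith))
  have log_two_le : ρ * ((T + 1) * ((T + d) * Real.log 2)) ≤
      (d + 1) * (ρ * (T + 1) * (T + 1) * Real.log 2) := by
    have : 0 ≤ ρ * (T + 1) * Real.log 2 * (T * d + 1) := by positivity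
    linarith
  rw [upperExponent, lowerExponent, ← hρ, eq_sub_of_add_eq hρ.symm, Nat.cast_add]
  linarith

/- Every variable of the model costs at least a power of `n`, so that the size of the model does not
enter the bound. -/
lemma exists_upperExponent_le_of_underfit (r T : ℕ) {C C' lam₀ lam₁ : ℝ} (hC : 0 ≤ C)
    (hlam₀ : 0 ≤ lam₀) (hlam₁ : 0 ≤ lam₁) :
    ∃ B : ℝ, ∀ (n m j : ℕ) (ε lam : ℝ), m ≤ n → j ≤ T → -Real.log ε ≤ Real.log n / 2 →
      B ≤ Real.log n → -lam₀ ≤ lam → lam ≤ lam₀ + lam₁ * Real.log n →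
      upperExponent r C lam n ε m j ≤ B * Real.log n + lowerExponent r T C' lam n ε := by
  obtain ⟨ρ, hρ⟩ : ∃ ρ : ℝ, ρ = (r : ℝ) + 1 / 2 := ⟨_, rfl⟩
  have hρ₀ : 1 / 2 ≤ ρ := by rw [hρ]; linarith [(Nat.cast_nonneg r : (0 : ℝ) ≤ r)]
  refine ⟨4 * (lam₀ + C) + 1 + (T * lam₀ + T * lam₁ + C + |C'| + r * T + ρ * T + 1 + T), ?_⟩
  intro n m j ε lam hmn hj hε hB hlam hlam'
  have hjT : (j : ℝ) ≤ T := by exact_mod_cast hj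
  have rest_nonneg : 0 ≤ T * lam₀ + T * lam₁ + C + |C'| + r * T + ρ * T + 1 + T := by positivity
  have hlog : 1 ≤ Real.log n := by linarith
  have log_m_le : m * (ρ * Real.log m) ≤ m * (ρ * Real.log n) := by
    rcases Nat.eq_zero_or_pos m with rfl | hm
    · simp
    · gcongr
  have variables_le : m * (lam₀ + C - ρ * (Real.log n + Real.log ε)) ≤ 0 := by
    refine mul_nonpos_of_nonneg_of_nonpos (Nat.cast_nonneg m) ?_
    nlinarith
  have prior_le : -(m * lam) ≤ m * lam₀ := by
    nlinarith [(Nat.cast_nonneg m : (0 : ℝ) ≤ m)]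
  have true_prior_le : T * lam ≤ T * (lam₀ * Real.log n + lam₁ * Real.log n) :=
    mul_le_mul_of_nonneg_left
      (hlam'.trans (add_le_add_left (le_mul_of_one_le_right hlam₀ hlog) _)) (Nat.cast_nonneg T)
  have C_le : C ≤ C * Real.log n := le_mul_of_one_le_right hC hlog
  have C'_le : -C' ≤ |C'| * Real.log n :=
    (neg_le_abs _).trans (le_mul_of_one_le_right (abs_nonneg _) hlog)
  have active_le : r * j * Real.log n ≤ r * T * Real.log n := by gcongr
  have radius_le : T / 2 * (Real.log n - Real.log ε) ≤ T * Real.log n := by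
    nlinarith [(Nat.cast_nonneg T : (0 : ℝ) ≤ T)]
  have slack : 0 ≤ (4 * (lam₀ + C) + 1) * Real.log n := by positivity
  rw [upperExponent, lowerExponent, ← hρ]
  linarith

end Exponents

section WeightedMarginals

lemma priorWeight_eq_exp {p : ℕ} {q c₁ : ℝ} (hc₁ : 0 < c₁) (c₂ : ℝ) {k : Finset (Fin p)}
    (hp : 1 ≤ p) (hk : (k.card : ℝ) ≤ q) :
    priorWeight q c₁ c₂ k = Real.exp (-(k.card * (Real.log c₁ + c₂ * Real.log p))) := by
  rw [priorWeight, if_pos hk, Real.rpow_def_of_pos hc₁,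
    Real.rpow_def_of_pos (by exact_mod_cast hp), ← Real.exp_add]
  congr 1
  ring

lemma exists_priorWeight_mul_marginal_le (r : ℕ) {α₁ α₂ a₁ a₂ c₁ : ℝ} (hα₁ : 0 < α₁)
    (hα₂ : 0 < α₂) (ha₁ : 0 < a₁) (ha₂ : 0 < a₂) (hc₁ : 0 < c₁) (c₂ : ℝ) (β₀ : ℕ →₀ ℝ) {b δ : ℝ}
    (hb : 0 ≤ b) (hβ₀ : ∀ j ∈ β₀.support, b ≤ |β₀ j|) (hδ : 0 < δ) :
    ∃ C : ℝ, 0 < C ∧ ∀ (n p : ℕ) (X : Matrix (Fin n) (Fin p) ℝ) (A : Matrix (Fin p) (Fin p) ℝ)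
      (q ε : ℝ) (k : Finset (Fin p)) (e : Fin n → ℝ) (V W : ℝ),
      1 ≤ n → 1 ≤ p → EigenvaluesBetween A a₁ a₂ → DesignEigenBounds X ε → 0 < ε → ε < 1 →
      (k ∪ trueModel p β₀).card ≤ n → (k.card : ℝ) ≤ q → 0 < V → 0 < W →
      (trueModel p β₀ ⊆ k →
        V ≤ e ⬝ᵥ e - (1 + δ) * projSq (subDesign X (k ∪ trueModel p β₀)) e - C) →
      (¬ trueModel p β₀ ⊆ k → V ≤ e ⬝ᵥ e + n * ε * (b ^ 2 / 2) -
        (2 + δ) * projSq (subDesign X (k ∪ trueModel p β₀)) e - C) →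
      emarginal X A r α₁ α₂ k (response X β₀ e) ≠ ⊤ ∧
      priorWeight q c₁ c₂ k * marginal X A r α₁ α₂ k (response X β₀ e) ≤
        Real.exp (upperExponent r C (Real.log c₁ + c₂ * Real.log p) n ε k.card
          (k ∩ trueModel p β₀).card + n / 2 * ((W - V) / V)) * profileLikelihood n W := by
  obtain ⟨C, hC, emarginal_le⟩ := exists_emarginal_response_le r hα₁ hα₂ ha₁ ha₂ β₀ hb hβ₀ hδ
  refine ⟨C, hC, ?_⟩
  intro n p X A q ε k e V W hn hp hA hX hε hε₁ hkn hkq hV hW hover hunder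
  have emarginal_le' := emarginal_le n p X A ε k e V hn hA hX hε hε₁ hkn hV hover hunder
  refine ⟨ne_top_of_le_ne_top ENNReal.ofReal_ne_top emarginal_le', ?_⟩
  have profile_nonneg := profileLikelihood_nonneg n hV
  have marginal_le : marginal X A r α₁ α₂ k (response X β₀ e) ≤ _ :=
    ENNReal.toReal_le_of_le_ofReal (by positivity) emarginal_le'
  rw [priorWeight_eq_exp hc₁ c₂ hp hkq]
  refine (mul_le_mul_of_nonneg_left (marginal_le.trans (mul_le_mul_of_nonneg_left
    (profileLikelihood_le_exp_mul n hV hW) (Real.exp_pos _).le)) (Real.exp_pos _).le).trans_eq ?_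
  rw [← mul_assoc, ← mul_assoc, ← Real.exp_add, ← Real.exp_add, upperExponent]

lemma exists_le_priorWeight_mul_marginal (r : ℕ) {α₁ α₂ a₁ a₂ s₀ s₁ c₁ : ℝ} (hα₁ : 0 < α₁)
    (hα₂ : 0 < α₂) (ha₁ : 0 < a₁) (ha₂ : 0 < a₂) (hs₀ : 0 < s₀) (hs₁ : 0 < s₁) (hc₁ : 0 < c₁)
    (c₂ : ℝ) (β₀ : ℕ →₀ ℝ) {b : ℝ} (hb : 0 < b) (hβ₀ : ∀ j ∈ β₀.support, b ≤ |β₀ j|) :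
    ∃ C : ℝ, ∀ (n p : ℕ) (X : Matrix (Fin n) (Fin p) ℝ) (A : Matrix (Fin p) (Fin p) ℝ)
      (q ε : ℝ) (e : Fin n → ℝ) (W : ℝ),
      1 ≤ n → 1 ≤ p → EigenvaluesBetween A a₁ a₂ → DesignEigenBounds X ε → 0 < ε →
      (∀ j ∈ β₀.support, j < p) → β₀.support.card ≤ n → (β₀.support.card : ℝ) ≤ q →
      √(ε / n) ≤ b / 2 →
      W = e ⬝ᵥ e + projSq (subDesign X (trueModel p β₀)) e + 2 * β₀.support.card →
      s₀ * n ≤ W → W ≤ s₁ * n →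
      emarginal X A r α₁ α₂ (trueModel p β₀) (response X β₀ e) ≠ ⊤ →
      Real.exp (lowerExponent r β₀.support.card C (Real.log c₁ + c₂ * Real.log p) n ε) *
          profileLikelihood n W ≤
        priorWeight q c₁ c₂ (trueModel p β₀) *
          marginal X A r α₁ α₂ (trueModel p β₀) (response X β₀ e) := by
  obtain ⟨C, le_emarginal⟩ := exists_le_emarginal_response r hα₁ hα₂ ha₁ ha₂ hs₀ hs₁ β₀ hb hβ₀
  refine ⟨C, ?_⟩
  intro n p X A q ε e W hn hp hA hX hε hβp hTn hTq hradius hW hW₀ hW₁ hfinite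
  have hcard := card_trueModel hβp
  have le_marginal := (ENNReal.ofReal_le_iff_le_toReal hfinite).1
    (le_emarginal n p X A ε e W hn hA hX hε hβp hTn hradius hW hW₀ hW₁)
  rw [priorWeight_eq_exp hc₁ c₂ hp (hcard.symm ▸ hTq), hcard, lowerExponent, Real.exp_add,
    mul_assoc]
  exact mul_le_mul_of_nonneg_left le_marginal (Real.exp_pos _).le

end WeightedMarginals

section Growth

lemma isLittleO_natCast_rpow {a b : ℝ} (hab : a < b) :
    (fun n : ℕ => (n : ℝ) ^ a) =o[atTop] fun n : ℕ => (n : ℝ) ^ b := by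
  refine (Asymptotics.isLittleO_iff_tendsto' ?_).2 ?_
  · filter_upwards [eventually_gt_atTop 0] with n hn h
    exact absurd h (Real.rpow_pos_of_pos (Nat.cast_pos.2 hn) b).ne'
  · refine ((tendsto_rpow_neg_atTop (sub_pos.2 hab)).comp tendsto_natCast_atTop_atTop).congr' ?_
    filter_upwards [eventually_gt_atTop 0] with n hn
    rw [Function.comp_apply, neg_sub, Real.rpow_sub (Nat.cast_pos.2 hn)]

lemma eventually_le_natCast_rpow {f : ℕ → ℝ} {η : ℝ}
    (h : f =o[atTop] fun n : ℕ => (n : ℝ) ^ η) : ∀ᶠ n : ℕ in atTop, f n ≤ (n : ℝ) ^ η := by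
  filter_upwards [h.bound one_pos] with n hn
  rw [one_mul, Real.norm_of_nonneg (Real.rpow_nonneg (Nat.cast_nonneg n) _)] at hn
  exact (le_abs_self _).trans hn

lemma isLittleO_log_natCast_rpow {η : ℝ} (hη : 0 < η) :
    (fun n : ℕ => Real.log n) =o[atTop] fun n : ℕ => (n : ℝ) ^ η :=
  (isLittleO_log_rpow_atTop hη).comp_tendsto tendsto_natCast_atTop_atTop

variable {ε : ℕ → ℝ}

lemma eventually_inv_le_rpow
    (hεO : ∀ η : ℝ, 0 < η → (fun n => (ε n)⁻¹) =O[atTop] fun n : ℕ => (n : ℝ) ^ η) {η : ℝ}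
    (hη : 0 < η) : ∀ᶠ n : ℕ in atTop, (ε n)⁻¹ ≤ (n : ℝ) ^ η :=
  eventually_le_natCast_rpow <|
    (hεO (η / 2) (half_pos hη)).trans_isLittleO (isLittleO_natCast_rpow (half_lt_self hη))

lemma eventually_mul_le_mul_of_isBigO (hε : ∀ n, 1 ≤ n → 0 < ε n)
    (hεO : ∀ η : ℝ, 0 < η → (fun n => (ε n)⁻¹) =O[atTop] fun n : ℕ => (n : ℝ) ^ η)
    {f : ℕ → ℝ} {ζ : ℝ} (hζ : ζ < 1) (hf : f =O[atTop] fun n : ℕ => (n : ℝ) ^ ζ) (C : ℝ) :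
    ∀ᶠ n : ℕ in atTop, C * f n ≤ n * ε n := by
  have product : (fun n => f n * (ε n)⁻¹) =O[atTop] fun n : ℕ => (n : ℝ) ^ ((ζ + 1) / 2) := by
    refine (hf.mul (hεO ((1 - ζ) / 2) (by linarith))).trans_eventuallyEq ?_
    filter_upwards [eventually_gt_atTop 0] with n hn
    rw [← Real.rpow_add (Nat.cast_pos.2 hn)]
    congr 1
    ring
  filter_upwards [eventually_le_natCast_rpow
    ((product.const_mul_left C).trans_isLittleO (isLittleO_natCast_rpow (b := 1) (by linarith))),
    eventually_ge_atTop 1] with n hn hn₁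
  rwa [Real.rpow_one, ← mul_assoc, ← div_eq_mul_inv, div_le_iff₀ (hε n hn₁)] at hn

lemma isBigO_abs_add_one_mul_log_add_one {q : ℕ → ℝ} {ξ : ℝ} (hξ : ξ < 1)
    (hq : q =O[atTop] fun n : ℕ => (n : ℝ) ^ ξ) :
    ∃ ζ : ℝ, ζ < 1 ∧
      (fun n => (|q n| + 1) * Real.log n + 1) =O[atTop] fun n : ℕ => (n : ℝ) ^ ζ := by
  obtain ⟨ζ, hζ, hζ₁⟩ := exists_between (max_lt hξ one_pos)
  obtain ⟨ζ', hζ', hζ'₁⟩ := exists_between hζ₁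
  obtain ⟨hξζ, hζ₀⟩ := max_lt_iff.1 hζ
  have one_isBigO {a : ℝ} (ha : 0 < a) : (fun _ : ℕ => (1 : ℝ)) =O[atTop] fun n => (n : ℝ) ^ a := by
    simpa only [Real.rpow_zero] using (isLittleO_natCast_rpow ha).isBigO
  have size : (fun n => |q n| + 1) =O[atTop] fun n : ℕ => (n : ℝ) ^ ζ :=
    (hq.trans (isLittleO_natCast_rpow hξζ).isBigO).norm_left.add (one_isBigO hζ₀)
  refine ⟨ζ', hζ'₁, .add ?_ (one_isBigO (hζ₀.trans hζ'))⟩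
  refine (size.mul (isLittleO_log_natCast_rpow (sub_pos.2 hζ')).isBigO).trans_eventuallyEq ?_
  filter_upwards [eventually_gt_atTop 0] with n hn
  rw [← Real.rpow_add (Nat.cast_pos.2 hn), add_sub_cancel]

lemma tendsto_inv_rpow_mul_rpow_neg (hε : ∀ n, 1 ≤ n → 0 < ε n)
    (hεO : ∀ η : ℝ, 0 < η → (fun n => (ε n)⁻¹) =O[atTop] fun n : ℕ => (n : ℝ) ^ η) {E a : ℝ}
    (hE : 0 ≤ E) (ha : 0 < a) :
    Tendsto (fun n : ℕ => (ε n)⁻¹ ^ E * (n : ℝ) ^ (-a)) atTop (𝓝 0) := by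
  refine squeeze_zero' ?_ ?_
    ((tendsto_rpow_neg_atTop (half_pos ha)).comp tendsto_natCast_atTop_atTop)
  · filter_upwards [eventually_ge_atTop 1] with n hn
    have := hε n hn
    positivity
  · filter_upwards [eventually_inv_le_rpow hεO (show 0 < a / (2 * (E + 1)) by positivity),
      eventually_ge_atTop 1] with n hinv hn
    have hn₁ : (1 : ℝ) ≤ n := by exact_mod_cast hn
    have hε₀ := hε n hn
    calc (ε n)⁻¹ ^ E * (n : ℝ) ^ (-a) ≤ ((n : ℝ) ^ (a / (2 * (E + 1)))) ^ E * (n : ℝ) ^ (-a) := by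
          gcongr
      _ = (n : ℝ) ^ (a / (2 * (E + 1)) * E + -a) := by
          rw [← Real.rpow_mul (by positivity), ← Real.rpow_add (by positivity)]
      _ ≤ (n : ℝ) ^ (-(a / 2)) := by
          refine Real.rpow_le_rpow_of_exponent_le hn₁ ?_
          have : a / (2 * (E + 1)) * E ≤ a / 2 := by
            rw [div_mul_eq_mul_div, div_le_div_iff₀ (by positivity) two_pos]
            nlinarith
          linarith

lemma tendsto_exp_log_sub_mul (hε : ∀ n, 1 ≤ n → 0 < ε n)
    (hεO : ∀ η : ℝ, 0 < η → (fun n => (ε n)⁻¹) =O[atTop] fun n : ℕ => (n : ℝ) ^ η) (C : ℝ)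
    {c : ℝ} (hc : 0 < c) :
    Tendsto (fun n : ℕ => Real.exp (C * Real.log n - c * (n * ε n))) atTop (𝓝 0) := by
  refine Real.tendsto_exp_atBot.comp (tendsto_atBot_mono' _ ?_
    (tendsto_neg_atTop_atBot.comp (Real.tendsto_log_atTop.comp tendsto_natCast_atTop_atTop)))
  filter_upwards [eventually_mul_le_mul_of_isBigO hε hεO one_half_lt_one
    (isLittleO_log_natCast_rpow one_half_pos).isBigO ((C + 1) / c)] with n hn
  have := mul_le_mul_of_nonneg_left hn hc.le
  rw [← mul_assoc, mul_div_cancel₀ _ hc.ne'] at this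
  rw [Function.comp_apply, Function.comp_apply]
  linarith

end Growth

section LargeSample

/-- The sample size `n` is large relative to the constant `C`: the design, the bound `q` on the
model size and the eigenvalue bound `ε` of a single `n` satisfy the inequalities that the comparison
of posterior weights needs. The first one keeps the noise absorbed by any admissible model below the
signal of a missing variable. -/
structure LargeSample {n p : ℕ} (X : Matrix (Fin n) (Fin p) ℝ) (β₀ : ℕ →₀ ℝ) (q ε C : ℝ) :
    Prop where
  mul_size_le : C * ((|q| + 1) * Real.log n + 1) ≤ n * ε
  le_log : C ≤ Real.log n
  inv_le : ε⁻¹ ≤ (n : ℝ) ^ (1 / 2 : ℝ)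
  one_le : 1 ≤ n
  eps_pos : 0 < ε
  eps_lt_one : ε < 1
  design : DesignEigenBounds X ε
  support_lt : ∀ j ∈ β₀.support, j < p
  card_support_le : (β₀.support.card : ℝ) ≤ q

lemma eventually_largeSample {p : ℕ → ℕ} {X : (n : ℕ) → Matrix (Fin n) (Fin (p n)) ℝ}
    {β₀ : ℕ →₀ ℝ} {q ε : ℕ → ℝ} {ξ : ℝ} (hβ₀ : ∀ n, 1 ≤ n → ∀ j ∈ β₀.support, j < p n)
    (hε : ∀ n, 1 ≤ n → 0 < ε n ∧ ε n < 1 ∧ DesignEigenBounds (X n) (ε n))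
    (hεO : ∀ η : ℝ, 0 < η → (fun n => (ε n)⁻¹) =O[atTop] fun n : ℕ => (n : ℝ) ^ η)
    (hξ : ξ < 1) (hq : q =O[atTop] fun n : ℕ => (n : ℝ) ^ ξ)
    (htq : ∀ᶠ n in atTop, (β₀.support.card : ℝ) ≤ q n) (C : ℝ) :
    ∀ᶠ n in atTop, LargeSample (X n) β₀ (q n) (ε n) C := by
  obtain ⟨ζ, hζ, hsize⟩ := isBigO_abs_add_one_mul_log_add_one hξ hq
  filter_upwards [eventually_mul_le_mul_of_isBigO (fun n hn => (hε n hn).1) hεO hζ hsize C,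
    (Real.tendsto_log_atTop.comp tendsto_natCast_atTop_atTop).eventually_ge_atTop C,
    eventually_inv_le_rpow hεO one_half_pos, eventually_ge_atTop 1, htq]
    with n mul_size_le le_log inv_le hn htq
  exact ⟨mul_size_le, le_log, inv_le, hn, (hε n hn).1, (hε n hn).2.1, (hε n hn).2.2, hβ₀ n hn, htq⟩

namespace LargeSample

variable {n p : ℕ} {X : Matrix (Fin n) (Fin p) ℝ} {β₀ : ℕ →₀ ℝ} {q ε C C' : ℝ}

lemma mono (h : LargeSample X β₀ q ε C) (hC : C' ≤ C) : LargeSample X β₀ q ε C' where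
  __ := h
  mul_size_le := (mul_le_mul_of_nonneg_right hC (by positivity)).trans h.mul_size_le
  le_log := hC.trans h.le_log

lemma card_trueModel_le (h : LargeSample X β₀ q ε C) : ((trueModel p β₀).card : ℝ) ≤ q := by
  rw [card_trueModel h.support_lt]
  exact h.card_support_le

lemma mul_eps_le (h : LargeSample X β₀ q ε C) : n * ε ≤ n :=
  mul_le_of_le_one_right (Nat.cast_nonneg n) h.eps_lt_one.le

lemma neg_log_eps_le (h : LargeSample X β₀ q ε C) : -Real.log ε ≤ Real.log n / 2 := by
  have := Real.log_le_log (inv_pos.2 h.eps_pos) h.inv_le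
  rw [Real.log_inv, Real.log_rpow (by exact_mod_cast h.one_le)] at this
  linarith

lemma log_numVars_le (h : LargeSample X β₀ q ε C) (hp : 1 ≤ p) :
    Real.log p ≤ 2 * Real.log n := by
  have hn : (0 : ℝ) < n := by exact_mod_cast h.one_le
  have hε := h.eps_pos
  have inv_mul_inv_le : ε⁻¹ * ε⁻¹ ≤ n := by
    calc ε⁻¹ * ε⁻¹ ≤ (n : ℝ) ^ (1 / 2 : ℝ) * (n : ℝ) ^ (1 / 2 : ℝ) := by
          gcongr <;> exact h.inv_le
      _ = n := by rw [← Real.rpow_add hn, add_halves, Real.rpow_one]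
  have p_le : (p : ℝ) ≤ n ^ 2 := by
    rw [sq]
    exact (h.design.card_le h.one_le hε).trans (mul_le_mul_of_nonneg_left inv_mul_inv_le hn.le)
  rw [← Nat.cast_ofNat, ← Real.log_pow]
  exact Real.log_le_log (by exact_mod_cast hp) p_le

lemma card_union_le (h : LargeSample X β₀ q ε (β₀.support.card + 1)) {k : Finset (Fin p)}
    (hk : (k.card : ℝ) ≤ q) : (k ∪ trueModel p β₀).card ≤ n := by
  have union_le : ((k ∪ trueModel p β₀).card : ℝ) ≤ k.card + β₀.support.card := by
    rw [← card_trueModel h.support_lt]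
    exact_mod_cast Finset.card_union_le k (trueModel p β₀)
  have log_ge : 1 ≤ Real.log n := (le_add_of_nonneg_left (Nat.cast_nonneg _)).trans h.le_log
  have size_le : |q| + 1 ≤ (|q| + 1) * Real.log n := le_mul_of_one_le_right (by positivity) log_ge
  have : 0 ≤ β₀.support.card * ((|q| + 1) * Real.log n) := by positivity
  have : (k ∪ trueModel p β₀).card ≤ (n : ℝ) := by
    linarith [h.mul_size_le, h.mul_eps_le, le_abs_self q]
  exact_mod_cast this

lemma sqrt_eps_div_le {b : ℝ} (h : LargeSample X β₀ q ε (4 / b ^ 2)) (hb : 0 < b) :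
    √(ε / n) ≤ b / 2 := by
  have hn : (0 : ℝ) < n := by exact_mod_cast h.one_le
  have size_ge : 1 ≤ (|q| + 1) * Real.log n + 1 := le_add_of_nonneg_left (by positivity)
  have n_ge : 4 / b ^ 2 ≤ n :=
    ((le_mul_of_one_le_right (by positivity) size_ge).trans h.mul_size_le).trans h.mul_eps_le
  rw [Real.sqrt_le_left (by positivity), div_le_iff₀ hn]
  rw [div_le_iff₀ (by positivity)] at n_ge
  linarith [h.eps_lt_one]

end LargeSample

end LargeSample

section Comparison

variable {n p : ℕ} {X : Matrix (Fin n) (Fin p) ℝ} {A : Matrix (Fin p) (Fin p) ℝ} {r : ℕ}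
  {α₁ α₂ a₁ a₂ c₁ c₂ v : ℝ} {β₀ : ℕ →₀ ℝ} {q ε : ℝ} {k : Finset (Fin p)} {e : Fin n → ℝ}

/-- The error vectors of typical length, for errors of variance `v`, of which no model containing
`t` absorbs much more than `2 v log n` per superfluous variable. -/
def typicalErrors {n p : ℕ} (X : Matrix (Fin n) (Fin p) ℝ) (t : Finset (Fin p)) (v : ℝ) :
    Set (Fin n → ℝ) :=
  {e | 19 / 20 * v * n ≤ e ⬝ᵥ e ∧ e ⬝ᵥ e ≤ 21 / 20 * v * n ∧
    ∀ K : Finset (Fin p), t ⊆ K → K.card ≤ n → projSq (subDesign X K) e ≤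
      2 * v * (21 / 20 * ((K \ t).card + 1 / 20) * Real.log n)}

/-- The value at which the profile likelihood bounds the marginal density of the true model from
below: an upper bound for the residual sum of squares on a small ball around the true
coefficients. -/
def trueScale {n p : ℕ} (X : Matrix (Fin n) (Fin p) ℝ) (β₀ : ℕ →₀ ℝ) (e : Fin n → ℝ) : ℝ :=
  e ⬝ᵥ e + projSq (subDesign X (trueModel p β₀)) e + 2 * β₀.support.card

lemma priorWeight_nonneg {p : ℕ} (q : ℝ) {c₁ : ℝ} (hc₁ : 0 ≤ c₁) (c₂ : ℝ) (k : Finset (Fin p)) :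
    0 ≤ priorWeight q c₁ c₂ k := by
  unfold priorWeight
  split_ifs <;> positivity

lemma marginal_nonneg {n p : ℕ} (X : Matrix (Fin n) (Fin p) ℝ) (A : Matrix (Fin p) (Fin p) ℝ)
    (r : ℕ) (α₁ α₂ : ℝ) (k : Finset (Fin p)) (y : Fin n → ℝ) : 0 ≤ marginal X A r α₁ α₂ k y :=
  ENNReal.toReal_nonneg

lemma exists_pos_le_abs (β₀ : ℕ →₀ ℝ) : ∃ b : ℝ, 0 < b ∧ ∀ j ∈ β₀.support, b ≤ |β₀ j| := by
  rcases β₀.support.eq_empty_or_nonempty with h | h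
  · exact ⟨1, one_pos, by simp [h]⟩
  · obtain ⟨j, hj, hmin⟩ := Finset.exists_min_image β₀.support (fun j => |β₀ j|) h
    exact ⟨|β₀ j|, abs_pos.2 (Finsupp.mem_support_iff.1 hj), hmin⟩

lemma half_mul_sub_div_le {n v x K V W : ℝ} (hn : 0 < n) (hv : 0 < v) (hV : 9 / 10 * v * n ≤ V)
    (hVW : V ≤ W) (h : W - V ≤ 9 / 5 * v * x + K) :
    n / 2 * ((W - V) / V) ≤ x + K / (9 / 5 * v) := by
  calc n / 2 * ((W - V) / V) ≤ n / 2 * ((W - V) / (9 / 10 * v * n)) := by gcongr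
    _ = (W - V) / (9 / 5 * v) := by field_simp; ring
    _ ≤ (9 / 5 * v * x + K) / (9 / 5 * v) := by gcongr
    _ = x + K / (9 / 5 * v) := by field_simp

lemma half_mul_sub_add_div_le {n v c x W : ℝ} (hn : 0 ≤ n) (hc : 0 ≤ c) (hx : 0 ≤ x) (hxn : x ≤ n)
    (hW : 0 < W) (hWn : W ≤ v * n) :
    n / 2 * ((W - (W + c * x)) / (W + c * x)) ≤ -(c / (2 * (v + c)) * x) := by
  rcases hn.eq_or_lt with rfl | hn
  · simp [le_antisymm hxn hx]
  have hvn : 0 < v * n := hW.trans_le hWn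
  have hv : 0 < v := pos_of_mul_pos_left hvn hn.le
  have le_scale : W + c * x ≤ (v + c) * n := by
    linarith [mul_le_mul_of_nonneg_left hxn hc]
  rw [sub_add_cancel_left, neg_div, mul_neg, neg_le_neg_iff]
  calc c / (2 * (v + c)) * x = n / 2 * (c * x / ((v + c) * n)) := by field_simp
    _ ≤ n / 2 * (c * x / (W + c * x)) := by gcongr

namespace LargeSample

lemma projSq_le (h : LargeSample X β₀ q ε (β₀.support.card + 1)) (hv : 0 ≤ v)
    (he : e ∈ typicalErrors X (trueModel p β₀) v) (hk : (k.card : ℝ) ≤ q) :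
    projSq (subDesign X (k ∪ trueModel p β₀)) e ≤ 21 / 10 * v * ((|q| + 1) * Real.log n) := by
  have le_size : ((k ∪ trueModel p β₀) \ trueModel p β₀).card + 1 / 20 ≤ |q| + 1 := by
    have sdiff_le : (((k ∪ trueModel p β₀) \ trueModel p β₀).card : ℝ) ≤ k.card := by
      rw [Finset.union_sdiff_right]
      exact_mod_cast Finset.card_le_card Finset.sdiff_subset
    linarith [le_abs_self q]
  refine (he.2.2 _ Finset.subset_union_right (h.card_union_le hk)).trans ?_
  calc 2 * v * (21 / 20 * (((k ∪ trueModel p β₀) \ trueModel p β₀).card + 1 / 20) * Real.log n)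
      = 21 / 10 * v * ((((k ∪ trueModel p β₀) \ trueModel p β₀).card + 1 / 20) * Real.log n) := by
        ring
    _ ≤ 21 / 10 * v * ((|q| + 1) * Real.log n) := by gcongr

lemma projSq_trueModel_le (h : LargeSample X β₀ q ε (β₀.support.card + 1)) (hv : 0 ≤ v)
    (he : e ∈ typicalErrors X (trueModel p β₀) v) :
    projSq (subDesign X (trueModel p β₀)) e ≤ 21 / 10 * v * ((|q| + 1) * Real.log n) := by
  have := h.projSq_le hv he h.card_trueModel_le
  rwa [Finset.union_self] at this

lemma noise_le {C c : ℝ} (h : LargeSample X β₀ q ε ((10 * v + C) / c)) (hv : 0 ≤ v) (hC : 0 ≤ C)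
    (hc : 0 < c) : 10 * v * ((|q| + 1) * Real.log n) + C ≤ c * (n * ε) := by
  have mul_le := mul_le_mul_of_nonneg_left h.mul_size_le hc.le
  rw [← mul_assoc, mul_div_cancel₀ _ hc.ne'] at mul_le
  have : 0 ≤ C * ((|q| + 1) * Real.log n) := by positivity
  linarith

lemma trueScale_mem_Icc {C : ℝ} (h : LargeSample X β₀ q ε (β₀.support.card + 1))
    (hnoise : LargeSample X β₀ q ε ((10 * v + C) / (v / 20))) (hv : 0 < v)
    (hC : 2 * β₀.support.card ≤ C) (he : e ∈ typicalErrors X (trueModel p β₀) v) :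
    trueScale X β₀ e ∈ Set.Icc (v / 2 * n) (2 * v * n) := by
  have noise_le := hnoise.noise_le hv.le (by linarith [β₀.support.card.cast_nonneg (α := ℝ)])
    (by positivity)
  have le_projSq := projSq_nonneg (subDesign X (trueModel p β₀)) e
  have projSq_le := h.projSq_trueModel_le hv.le he
  have mul_eps_le := mul_le_mul_of_nonneg_left h.mul_eps_le (by positivity : 0 ≤ v / 20)
  have : 0 ≤ v * n := by positivity
  have : 0 ≤ v * ((|q| + 1) * Real.log n) := by positivity
  rw [trueScale]
  constructor <;> linarith [he.1, he.2.1]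

lemma overfit_gain_le {C : ℝ} (h : LargeSample X β₀ q ε (β₀.support.card + 1))
    (hnoise : LargeSample X β₀ q ε ((10 * v + (2 * β₀.support.card + C)) / (v / 20))) (hv : 0 < v)
    (hC : 0 ≤ C) (he : e ∈ typicalErrors X (trueModel p β₀) v) (hk : (k.card : ℝ) ≤ q) {V : ℝ}
    (hV : V = e ⬝ᵥ e - (1 + 1 / 20) * projSq (subDesign X (k ∪ trueModel p β₀)) e - C) :
    0 < V ∧ n / 2 * ((trueScale X β₀ e - V) / V) ≤
      (5 / 4 * (k \ trueModel p β₀).card + 1 / 4) * Real.log n +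
        (2 * β₀.support.card + C) / (9 / 5 * v) := by
  have hn : (0 : ℝ) < n := by exact_mod_cast h.one_le
  have hlog : 0 ≤ v * Real.log n := mul_nonneg hv.le (Real.log_natCast_nonneg n)
  have hdlog : 0 ≤ (k \ trueModel p β₀).card * (v * Real.log n) := by positivity
  have : 0 ≤ v * ((|q| + 1) * Real.log n) := by positivity
  have noise_le := hnoise.noise_le hv.le (by positivity) (by positivity)
  have mul_eps_le := mul_le_mul_of_nonneg_left h.mul_eps_le (by positivity : 0 ≤ v / 20)
  have projSq_le := h.projSq_le hv.le he hk
  have le_V : 9 / 10 * v * n ≤ V := by linarith [he.1]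
  refine ⟨(by positivity : 0 < 9 / 10 * v * n).trans_le le_V, half_mul_sub_div_le hn hv le_V ?_ ?_⟩
  · rw [trueScale]
    linarith [projSq_nonneg (subDesign X (trueModel p β₀)) e,
      projSq_nonneg (subDesign X (k ∪ trueModel p β₀)) e]
  have hkn := h.card_union_le hk
  have projSq_superfluous := he.2.2 _ Finset.subset_union_right hkn
  have projSq_true :=
    he.2.2 _ subset_rfl ((Finset.card_le_card Finset.subset_union_right).trans hkn)
  rw [Finset.union_sdiff_right] at projSq_superfluous
  rw [sdiff_self, Finset.bot_eq_empty, Finset.card_empty, Nat.cast_zero] at projSq_true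
  rw [trueScale]
  linarith

lemma trueScale_add_le {b C : ℝ} (h : LargeSample X β₀ q ε (β₀.support.card + 1))
    (hsignal : LargeSample X β₀ q ε ((10 * v + (2 * β₀.support.card + C)) / (b ^ 2 / 4)))
    (hv : 0 ≤ v) (hb : 0 < b) (hC : 0 ≤ C) (he : e ∈ typicalErrors X (trueModel p β₀) v)
    (hk : (k.card : ℝ) ≤ q) :
    trueScale X β₀ e + b ^ 2 / 4 * (n * ε) ≤ e ⬝ᵥ e + n * ε * (b ^ 2 / 2) -
      (2 + 1 / 20) * projSq (subDesign X (k ∪ trueModel p β₀)) e - C := by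
  have noise_le := hsignal.noise_le hv (by positivity) (by positivity)
  have := h.projSq_le hv he hk
  have := h.projSq_trueModel_le hv he
  have : 0 ≤ v * ((|q| + 1) * Real.log n) := by positivity
  rw [trueScale]
  linarith

end LargeSample

lemma exists_le_priorWeight_mul_marginal_trueModel (r : ℕ) (hα₁ : 0 < α₁) (hα₂ : 0 < α₂)
    (ha₁ : 0 < a₁) (ha₂ : 0 < a₂) (hc₁ : 0 < c₁) (c₂ : ℝ) (β₀ : ℕ →₀ ℝ) (hv : 0 < v) :
    ∃ C₀ C : ℝ, ∀ (n p : ℕ) (X : Matrix (Fin n) (Fin p) ℝ) (A : Matrix (Fin p) (Fin p) ℝ)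
      (q ε : ℝ) (e : Fin n → ℝ), 1 ≤ p → LargeSample X β₀ q ε C₀ → EigenvaluesBetween A a₁ a₂ →
      e ∈ typicalErrors X (trueModel p β₀) v →
      Real.exp (lowerExponent r β₀.support.card C (Real.log c₁ + c₂ * Real.log p) n ε) *
          profileLikelihood n (trueScale X β₀ e) ≤
        priorWeight q c₁ c₂ (trueModel p β₀) *
          marginal X A r α₁ α₂ (trueModel p β₀) (response X β₀ e) := by
  obtain ⟨b, hb, hβ₀⟩ := exists_pos_le_abs β₀
  obtain ⟨Cu, hCu, upper⟩ := exists_priorWeight_mul_marginal_le r hα₁ hα₂ ha₁ ha₂ hc₁ c₂ β₀ hb.le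
    hβ₀ (δ := 1 / 20) (by norm_num)
  obtain ⟨C, lower⟩ := exists_le_priorWeight_mul_marginal r hα₁ hα₂ ha₁ ha₂ (s₀ := v / 2)
    (s₁ := 2 * v) (by positivity) (by positivity) hc₁ c₂ β₀ hb hβ₀
  refine ⟨max (max (β₀.support.card + 1) (4 / b ^ 2))
    ((10 * v + (2 * β₀.support.card + Cu)) / (v / 20)), C, ?_⟩
  intro n p X A q ε e hp h hA he
  have size := h.mono ((le_max_left _ _).trans (le_max_left _ _))
  have radius := h.mono ((le_max_right _ _).trans (le_max_left _ _))
  have noise := h.mono (le_max_right _ _)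
  obtain ⟨le_scale, scale_le⟩ := size.trueScale_mem_Icc noise hv (by linarith) he
  have card_le : (trueModel p β₀ ∪ trueModel p β₀).card ≤ n :=
    size.card_union_le h.card_trueModel_le
  have residual_pos :=
    (size.overfit_gain_le noise hv hCu.le he h.card_trueModel_le rfl).1
  have finite := (upper n p X A q ε (trueModel p β₀) e _ _ h.one_le hp hA h.design h.eps_pos
    h.eps_lt_one card_le h.card_trueModel_le residual_pos residual_pos (fun _ => le_rfl)
    (fun hsub => absurd subset_rfl hsub)).1
  rw [Finset.union_self, card_trueModel h.support_lt] at card_le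
  exact lower n p X A q ε e _ h.one_le hp hA h.design h.eps_pos h.support_lt card_le
    h.card_support_le (radius.sqrt_eps_div_le hb) rfl le_scale scale_le finite

lemma neg_abs_log_le_log_add_mul (hc₂ : 0 ≤ c₂) (p : ℕ) :
    -|Real.log c₁| ≤ Real.log c₁ + c₂ * Real.log p := by
  linarith [neg_abs_le (Real.log c₁), mul_nonneg hc₂ (Real.log_natCast_nonneg p)]

lemma exp_overfitExponent_eq {n d : ℕ} {ε : ℝ} (hn : 1 ≤ n) (hε : 0 < ε) (B E : ℝ) :
    Real.exp ((d + 1) * (B - E * Real.log ε - 1 / 4 * Real.log n)) =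
      (Real.exp B * (ε⁻¹ ^ E * (n : ℝ) ^ (-(1 / 4) : ℝ))) ^ (d + 1) := by
  have hn₀ : (0 : ℝ) < n := by exact_mod_cast hn
  rw [Real.rpow_def_of_pos (inv_pos.2 hε), Real.rpow_def_of_pos hn₀, ← Real.exp_add,
    ← Real.exp_add, ← Real.exp_nat_mul, Real.log_inv]
  congr 1
  push_cast
  ring

lemma exists_priorWeight_mul_marginal_le_of_overfit {r : ℕ} (hr : 1 ≤ r) (hα₁ : 0 < α₁)
    (hα₂ : 0 < α₂) (ha₁ : 0 < a₁) (ha₂ : 0 < a₂) (hc₁ : 0 < c₁) (hc₂ : 0 ≤ c₂) (β₀ : ℕ →₀ ℝ)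
    (hv : 0 < v) :
    ∃ C₀ B E : ℝ, 0 ≤ E ∧ ∀ (n p : ℕ) (X : Matrix (Fin n) (Fin p) ℝ)
      (A : Matrix (Fin p) (Fin p) ℝ) (q ε : ℝ) (k : Finset (Fin p)) (e : Fin n → ℝ),
      1 ≤ p → LargeSample X β₀ q ε C₀ → EigenvaluesBetween A a₁ a₂ →
      e ∈ typicalErrors X (trueModel p β₀) v → (k.card : ℝ) ≤ q → trueModel p β₀ ⊂ k →
      priorWeight q c₁ c₂ k * marginal X A r α₁ α₂ k (response X β₀ e) ≤
        (Real.exp B * (ε⁻¹ ^ E * (n : ℝ) ^ (-(1 / 4) : ℝ))) ^ ((k \ trueModel p β₀).card + 1) *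
          (priorWeight q c₁ c₂ (trueModel p β₀) *
            marginal X A r α₁ α₂ (trueModel p β₀) (response X β₀ e)) := by
  obtain ⟨Cu, hCu, upper⟩ := exists_priorWeight_mul_marginal_le r hα₁ hα₂ ha₁ ha₂ hc₁ c₂ β₀ le_rfl
    (fun j _ => abs_nonneg (β₀ j)) (δ := 1 / 20) (by norm_num)
  obtain ⟨C₁, C, lower⟩ :=
    exists_le_priorWeight_mul_marginal_trueModel r hα₁ hα₂ ha₁ ha₂ hc₁ c₂ β₀ hv
  obtain ⟨B, E, hE, exponent_le⟩ := exists_upperExponent_le_of_overfit hr β₀.support.card C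
    ((2 * β₀.support.card + Cu) / (9 / 5 * v)) hCu.le (abs_nonneg (Real.log c₁))
  refine ⟨max C₁ (max (β₀.support.card + 1)
    ((10 * v + (2 * β₀.support.card + Cu)) / (v / 20))), B, E, hE, ?_⟩
  intro n p X A q ε k e hp h hA he hkq htk
  have size := h.mono ((le_max_left _ _).trans (le_max_right _ _))
  have noise := h.mono ((le_max_right _ _).trans (le_max_right _ _))
  have hn : (0 : ℝ) < n := by exact_mod_cast h.one_le
  have hkn := size.card_union_le hkq
  have card_eq : k.card = β₀.support.card + (k \ trueModel p β₀).card := by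
    rw [← card_trueModel h.support_lt, add_comm, Finset.card_sdiff_add_card_eq_card htk.subset]
  obtain ⟨residual_pos, gain_le⟩ := size.overfit_gain_le noise hv hCu.le he hkq rfl
  have scale_pos : 0 < trueScale X β₀ e :=
    (by positivity : 0 < v / 2 * n).trans_le (size.trueScale_mem_Icc noise hv (by linarith) he).1
  have upper_k := (upper n p X A q ε k e _ _ h.one_le hp hA h.design h.eps_pos h.eps_lt_one hkn hkq
    residual_pos scale_pos (fun _ => le_rfl) (fun hsub => absurd htk.subset hsub)).2
  have exponent_k := exponent_le n (k \ trueModel p β₀).card ε _ _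
    (Finset.card_pos.2 (Finset.sdiff_nonempty.2 htk.not_subset))
    (card_eq ▸ (Finset.card_le_card Finset.subset_union_left).trans hkn) h.eps_pos h.eps_lt_one
    (neg_abs_log_le_log_add_mul hc₂ p) gain_le
  rw [card_eq, Finset.inter_eq_right.2 htk.subset, card_trueModel h.support_lt] at upper_k
  calc priorWeight q c₁ c₂ k * marginal X A r α₁ α₂ k (response X β₀ e) ≤ _ := upper_k
    _ ≤ _ := mul_le_mul_of_nonneg_right (Real.exp_le_exp.2 exponent_k)
        (profileLikelihood_nonneg n scale_pos)
    _ = _ := by rw [Real.exp_add, exp_overfitExponent_eq h.one_le h.eps_pos, mul_assoc]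
    _ ≤ _ := mul_le_mul_of_nonneg_left
        (lower n p X A q ε e hp (h.mono (le_max_left _ _)) hA he) ?_
  have := h.eps_pos
  positivity

lemma exists_priorWeight_mul_marginal_le_of_underfit (r : ℕ) (hα₁ : 0 < α₁)
    (hα₂ : 0 < α₂) (ha₁ : 0 < a₁) (ha₂ : 0 < a₂) (hc₁ : 0 < c₁) (hc₂ : 0 ≤ c₂) (β₀ : ℕ →₀ ℝ)
    (hv : 0 < v) :
    ∃ C₀ B η : ℝ, 0 < η ∧ ∀ (n p : ℕ) (X : Matrix (Fin n) (Fin p) ℝ)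
      (A : Matrix (Fin p) (Fin p) ℝ) (q ε : ℝ) (k : Finset (Fin p)) (e : Fin n → ℝ),
      1 ≤ p → LargeSample X β₀ q ε C₀ → EigenvaluesBetween A a₁ a₂ →
      e ∈ typicalErrors X (trueModel p β₀) v → (k.card : ℝ) ≤ q → ¬ trueModel p β₀ ⊆ k →
      priorWeight q c₁ c₂ k * marginal X A r α₁ α₂ k (response X β₀ e) ≤
        Real.exp (B * Real.log n - η * (n * ε)) * (priorWeight q c₁ c₂ (trueModel p β₀) *
          marginal X A r α₁ α₂ (trueModel p β₀) (response X β₀ e)) := by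
  obtain ⟨b, hb, hβ₀⟩ := exists_pos_le_abs β₀
  obtain ⟨Cu, hCu, upper⟩ := exists_priorWeight_mul_marginal_le r hα₁ hα₂ ha₁ ha₂ hc₁ c₂ β₀ hb.le
    hβ₀ (δ := 1 / 20) (by norm_num)
  obtain ⟨C₁, C, lower⟩ :=
    exists_le_priorWeight_mul_marginal_trueModel r hα₁ hα₂ ha₁ ha₂ hc₁ c₂ β₀ hv
  obtain ⟨B, exponent_le⟩ := exists_upperExponent_le_of_underfit r β₀.support.card (C' := C) hCu.le
    (abs_nonneg (Real.log c₁)) (by positivity : 0 ≤ c₂ * 2)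
  refine ⟨max (max C₁ B) (max (β₀.support.card + 1)
    (max ((10 * v + (2 * β₀.support.card + Cu)) / (v / 20))
      ((10 * v + (2 * β₀.support.card + Cu)) / (b ^ 2 / 4)))), B,
    b ^ 2 / 4 / (2 * (2 * v + b ^ 2 / 4)), by positivity, ?_⟩
  intro n p X A q ε k e hp h hA he hkq htk
  have size := h.mono ((le_max_left _ _).trans (le_max_right _ _))
  have noise := h.mono
    ((le_max_left _ _).trans ((le_max_right _ _).trans (le_max_right _ _)))
  have signal := h.mono
    ((le_max_right _ _).trans ((le_max_right _ _).trans (le_max_right _ _)))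
  have hn : (0 : ℝ) < n := by exact_mod_cast h.one_le
  have hε := h.eps_pos
  have hkn := size.card_union_le hkq
  obtain ⟨le_scale, scale_le⟩ := size.trueScale_mem_Icc noise hv (by linarith) he
  have scale_pos : 0 < trueScale X β₀ e := (by positivity : 0 < v / 2 * n).trans_le le_scale
  have loss_le := size.trueScale_add_le signal hv.le hb hCu.le he hkq
  have upper_k := (upper n p X A q ε k e (trueScale X β₀ e + b ^ 2 / 4 * (n * ε)) _ h.one_le hp hA
    h.design hε h.eps_lt_one hkn hkq (by positivity) scale_pos (fun hsub => absurd hsub htk)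
    (fun _ => loss_le)).2
  have relative_le := half_mul_sub_add_div_le hn.le (by positivity : 0 ≤ b ^ 2 / 4)
    (by positivity) h.mul_eps_le scale_pos scale_le
  have exponent_k := exponent_le n k.card (k ∩ trueModel p β₀).card ε _
    ((Finset.card_le_card Finset.subset_union_left).trans hkn)
    ((Finset.card_le_card Finset.inter_subset_right).trans_eq (card_trueModel h.support_lt))
    h.neg_log_eps_le (((le_max_right _ _).trans (le_max_left _ _)).trans h.le_log)
    (neg_abs_log_le_log_add_mul hc₂ p)
    (by linarith [le_abs_self (Real.log c₁), mul_le_mul_of_nonneg_left (h.log_numVars_le hp) hc₂])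
  calc priorWeight q c₁ c₂ k * marginal X A r α₁ α₂ k (response X β₀ e) ≤ _ := upper_k
    _ ≤ _ := mul_le_mul_of_nonneg_right (Real.exp_le_exp.2 (add_le_add exponent_k relative_le))
        (profileLikelihood_nonneg n scale_pos)
    _ = _ := by rw [add_right_comm, ← sub_eq_add_neg, Real.exp_add, mul_assoc]
    _ ≤ _ := mul_le_mul_of_nonneg_left
        (lower n p X A q ε e hp (h.mono ((le_max_left _ _).trans (le_max_left _ _))) hA he)
        (Real.exp_pos _).le

end Comparison

lemma exists_tendsto_zero_priorWeight_mul_marginal_le {r : ℕ} (hr : 1 ≤ r) {α₁ α₂ a₁ a₂ c₁ c₂ : ℝ}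
    (hα₁ : 0 < α₁) (hα₂ : 0 < α₂) (ha₁ : 0 < a₁) (ha₂ : 0 < a₂) (hc₁ : 0 < c₁) (hc₂ : 0 ≤ c₂)
    {β₀ : ℕ →₀ ℝ} {p : ℕ → ℕ} {X : (n : ℕ) → Matrix (Fin n) (Fin (p n)) ℝ}
    {A : (n : ℕ) → Matrix (Fin (p n)) (Fin (p n)) ℝ} {q ε : ℕ → ℝ} {v : ℝ} (hv : 0 < v)
    (hA : ∀ n, 1 ≤ n → EigenvaluesBetween (A n) a₁ a₂) (hε : ∀ n, 1 ≤ n → 0 < ε n)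
    (hεO : ∀ η : ℝ, 0 < η → (fun n => (ε n)⁻¹) =O[atTop] fun n : ℕ => (n : ℝ) ^ η)
    (hlarge : ∀ C, ∀ᶠ n in atTop, LargeSample (X n) β₀ (q n) (ε n) C) :
    ∃ c : ℕ → ℝ, Tendsto c atTop (𝓝 0) ∧ ∀ᶠ n in atTop, 0 ≤ c n ∧
      ∀ e ∈ typicalErrors (X n) (trueModel (p n) β₀) v, ∀ k, k ≠ trueModel (p n) β₀ →
        priorWeight (q n) c₁ c₂ k * marginal (X n) (A n) r α₁ α₂ k (response (X n) β₀ e) ≤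
        c n * (priorWeight (q n) c₁ c₂ (trueModel (p n) β₀) *
          marginal (X n) (A n) r α₁ α₂ (trueModel (p n) β₀) (response (X n) β₀ e)) := by
  obtain ⟨C, B, E, hE, overfit⟩ :=
    exists_priorWeight_mul_marginal_le_of_overfit hr hα₁ hα₂ ha₁ ha₂ hc₁ hc₂ β₀ hv
  obtain ⟨C', B', η, hη, underfit⟩ :=
    exists_priorWeight_mul_marginal_le_of_underfit r hα₁ hα₂ ha₁ ha₂ hc₁ hc₂ β₀ hv
  have overfit_tendsto := (tendsto_inv_rpow_mul_rpow_neg hε hεO hE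
    (by norm_num : (0 : ℝ) < 1 / 4)).const_mul (Real.exp B)
  have underfit_tendsto := tendsto_exp_log_sub_mul hε hεO B' hη
  rw [mul_zero] at overfit_tendsto
  refine ⟨_, (max_self (0 : ℝ)) ▸ overfit_tendsto.max underfit_tendsto, ?_⟩
  filter_upwards [hlarge C, hlarge C', overfit_tendsto.eventually_le_const one_pos]
    with n large large' base_le_one
  have c_nonneg : 0 ≤ max (Real.exp B * ((ε n)⁻¹ ^ E * (n : ℝ) ^ (-(1 / 4) : ℝ)))
      (Real.exp (B' * Real.log n - η * (n * ε n))) :=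
    le_max_of_le_right (Real.exp_pos _).le
  refine ⟨c_nonneg, fun e he k hkt => ?_⟩
  have hp : 1 ≤ p n := by
    by_contra! h
    have : IsEmpty (Fin (p n)) := by rw [Nat.lt_one_iff.1 h]; infer_instance
    exact hkt (Subsingleton.elim _ _)
  have weight_nonneg := mul_nonneg (priorWeight_nonneg (q n) hc₁.le c₂ (trueModel (p n) β₀))
    (marginal_nonneg (X n) (A n) r α₁ α₂ (trueModel (p n) β₀) (response (X n) β₀ e))
  rcases lt_or_ge (q n) k.card with hqk | hkq
  · rw [priorWeight, if_neg hqk.not_ge, zero_mul]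
    exact mul_nonneg c_nonneg weight_nonneg
  by_cases htk : trueModel (p n) β₀ ⊆ k
  · have := hε n large.one_le
    refine (overfit n (p n) (X n) (A n) (q n) (ε n) k e hp large (hA n large.one_le) he hkq
      (htk.ssubset_of_ne hkt.symm)).trans (mul_le_mul_of_nonneg_right ?_ weight_nonneg)
    exact (pow_le_of_le_one (by positivity) base_le_one (Nat.succ_ne_zero _)).trans
      (le_max_left _ _)
  · exact (underfit n (p n) (X n) (A n) (q n) (ε n) k e hp large' (hA n large.one_le) he hkq
      htk).trans (mul_le_mul_of_nonneg_right (le_max_right _ _) weight_nonneg)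

section Probability

lemma memLp_sq_gaussianReal (v : ℝ≥0) : MemLp (fun x : ℝ => x ^ 2) 2 (gaussianReal 0 v) := by
  rw [memLp_two_iff_integrable_sq (by fun_prop)]
  refine ((memLp_id_gaussianReal (μ := 0) (v := v) 4).integrable_norm_pow (by norm_num)).congr
    (ae_of_all _ fun x => ?_)
  simp only [id, Real.norm_eq_abs]
  rw [← pow_mul]
  exact (Even.pow_abs (by decide : Even (2 * 2)) x)

lemma integral_sq_gaussianReal (v : ℝ≥0) : ∫ x, x ^ 2 ∂(gaussianReal 0 v) = v := by
  have variance_eq := variance_of_integral_eq_zero (μ := gaussianReal 0 v) (X := id)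
    aemeasurable_id (by simp)
  rw [variance_id_gaussianReal] at variance_eq
  simpa using variance_eq.symm

lemma measure_le_abs_dotProduct_self_sub_le (ι : Type*) [Fintype ι] (v : ℝ≥0) {c : ℝ}
    (hc : 0 < c) :
    (Measure.pi fun _ : ι => gaussianReal 0 v) {e | c ≤ |e ⬝ᵥ e - v * Fintype.card ι|} ≤
      ENNReal.ofReal (Fintype.card ι * Var[fun x => x ^ 2; gaussianReal 0 v] / c ^ 2) := by
  obtain ⟨ν, hν⟩ : ∃ ν, ν = Measure.pi fun _ : ι => gaussianReal 0 v := ⟨_, rfl⟩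
  have : IsFiniteMeasure ν := by
    rw [hν]
    infer_instance
  have memLp_sq (i : ι) : MemLp (fun e : ι → ℝ => e i ^ 2) 2 ν := by
    rw [hν]
    exact (memLp_sq_gaussianReal v).comp_measurePreserving (measurePreserving_eval _ i)
  have sum_sq : (∑ i, fun e : ι → ℝ => e i ^ 2) = fun e => e ⬝ᵥ e := by
    ext e
    simp [dotProduct, sq]
  have integral_coord_sq (i : ι) : ∫ e : ι → ℝ, e i ^ 2 ∂ν = v := by
    rw [hν, ← integral_sq_gaussianReal v]
    exact integral_comp_eval (μ := fun _ : ι => gaussianReal 0 v) (i := i)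
      (f := fun x : ℝ => x ^ 2) (by fun_prop)
  have mean : ∫ e : ι → ℝ, e ⬝ᵥ e ∂ν = v * Fintype.card ι := by
    simp only [dotProduct, ← sq]
    rw [integral_finsetSum _ fun i _ => (memLp_sq i).integrable (by norm_num)]
    simp [integral_coord_sq, mul_comm]
  have variance_eq : Var[fun e : ι → ℝ => e ⬝ᵥ e; ν] =
      Fintype.card ι * Var[fun x => x ^ 2; gaussianReal 0 v] := by
    rw [hν, ← sum_sq, variance_sum_pi (X := fun _ x => x ^ 2) fun _ => memLp_sq_gaussianReal v,
      Finset.sum_const, Finset.card_univ, nsmul_eq_mul]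
  have memLp : MemLp (fun e : ι → ℝ => e ⬝ᵥ e) 2 ν := by
    rw [← sum_sq]
    exact memLp_finsetSum' _ fun i _ => memLp_sq i
  have chebyshev := meas_ge_le_variance_div_sq memLp hc
  rwa [mean, variance_eq, hν] at chebyshev

lemma sum_pow_card_sdiff_le_exp {p : ℕ} (t : Finset (Fin p)) {a : ℝ} (ha : 0 ≤ a) :
    ∑ K : Finset (Fin p) with t ⊆ K, a ^ (K \ t).card ≤ Real.exp (p * a) := by
  have sdiff_injOn : Set.InjOn (fun K : Finset (Fin p) => K \ t)
      (Finset.univ.filter fun K : Finset (Fin p) => t ⊆ K) := by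
    intro K hK L hL hKL
    have htK : t ⊆ K := by simpa using hK
    have htL : t ⊆ L := by simpa using hL
    rw [← Finset.sdiff_union_of_subset htK, ← Finset.sdiff_union_of_subset htL]
    exact congrArg (· ∪ t) hKL
  calc ∑ K : Finset (Fin p) with t ⊆ K, a ^ (K \ t).card
      ≤ ∑ s : Finset (Fin p), a ^ s.card := by
        rw [← Finset.sum_image (f := fun s : Finset (Fin p) => a ^ s.card) sdiff_injOn]
        exact Finset.sum_le_sum_of_subset_of_nonneg (Finset.subset_univ _)
          fun _ _ _ => by positivity
    _ = (a + 1) ^ p := by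
        simpa only [one_pow, mul_one] using Fin.sum_pow_mul_eq_add_pow (n := p) a 1
    _ ≤ Real.exp (p * a) := by
        rw [Real.exp_nat_mul]
        exact pow_le_pow_left₀ (by positivity) (Real.add_one_le_exp a) p

section UnionBound

variable {n p : ℕ} {X : Matrix (Fin n) (Fin p) ℝ} {ε : ℝ} {v : ℝ≥0}

lemma measure_lt_projSq_subDesign_le (hX : DesignEigenBounds X ε) (hn : 1 ≤ n) (hε : 0 < ε)
    (hv : 0 < v) {t K : Finset (Fin p)} (htK : t ⊆ K) (hKn : K.card ≤ n) :
    (Measure.pi fun _ : Fin n => gaussianReal 0 v)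
        {e | 2 * v * (21 / 20 * ((K \ t).card + 1 / 20) * Real.log n) <
          projSq (subDesign X K) e} ≤
      ENNReal.ofReal (10 ^ t.card * (n : ℝ) ^ (-(1 / 20) : ℝ) *
        (10 * (n : ℝ) ^ (-(103 / 100) : ℝ)) ^ (K \ t).card) := by
  have hn₀ : (0 : ℝ) < n := by exact_mod_cast hn
  refine (measure_lt_projSq_le (hX.injective_mulVec hn hε hKn) hv (θ := 99 / 100) (by norm_num)
    (by norm_num) _).trans (ENNReal.ofReal_le_ofReal ?_)
  have inv_sqrt : (√(1 - 99 / 100 : ℝ))⁻¹ = 10 := by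
    rw [show (1 - 99 / 100 : ℝ) = (1 / 10) ^ 2 by norm_num, Real.sqrt_sq (by norm_num)]
    norm_num
  have card_eq : Fintype.card K = t.card + (K \ t).card := by
    rw [Fintype.card_coe, add_comm, Finset.card_sdiff_add_card_eq_card htK]
  have tail_le : Real.exp (-(99 / 100 * (21 / 20 * ((K \ t).card + 1 / 20) * Real.log n))) ≤
      (n : ℝ) ^ (-(1 / 20) : ℝ) * ((n : ℝ) ^ (-(103 / 100) : ℝ)) ^ (K \ t).card := by
    rw [← Real.rpow_natCast, ← Real.rpow_mul hn₀.le, ← Real.rpow_add hn₀,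
      Real.rpow_def_of_pos hn₀]
    refine Real.exp_le_exp.2 ?_
    have hlog := Real.log_natCast_nonneg n
    have : 0 ≤ ((K \ t).card : ℝ) * Real.log n := by positivity
    linarith
  rw [inv_sqrt, card_eq]
  calc _ ≤ ((n : ℝ) ^ (-(1 / 20) : ℝ) * ((n : ℝ) ^ (-(103 / 100) : ℝ)) ^ (K \ t).card) *
        10 ^ (t.card + (K \ t).card) := by gcongr
    _ = _ := by ring

lemma measure_exists_lt_projSq_le (hX : DesignEigenBounds X ε) (hn : 1 ≤ n) (hε : 0 < ε)
    (hv : 0 < v) (t : Finset (Fin p)) :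
    (Measure.pi fun _ : Fin n => gaussianReal 0 v) {e | ∃ K : Finset (Fin p), t ⊆ K ∧ K.card ≤ n ∧
        2 * v * (21 / 20 * ((K \ t).card + 1 / 20) * Real.log n) < projSq (subDesign X K) e} ≤
      ENNReal.ofReal (10 ^ t.card * (n : ℝ) ^ (-(1 / 20) : ℝ) *
        Real.exp (p * (10 * (n : ℝ) ^ (-(103 / 100) : ℝ)))) := by
  have subset_biUnion : {e : Fin n → ℝ | ∃ K : Finset (Fin p), t ⊆ K ∧ K.card ≤ n ∧
        2 * v * (21 / 20 * ((K \ t).card + 1 / 20) * Real.log n) < projSq (subDesign X K) e} ⊆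
      ⋃ K ∈ Finset.univ.filter fun K : Finset (Fin p) => t ⊆ K, {e | K.card ≤ n ∧
        2 * v * (21 / 20 * ((K \ t).card + 1 / 20) * Real.log n) < projSq (subDesign X K) e} := by
    rintro e ⟨K, htK, hKn, hlt⟩
    simp only [Set.mem_iUnion]
    exact ⟨K, by simpa using htK, hKn, hlt⟩
  refine (measure_mono subset_biUnion).trans ((measure_biUnion_finset_le _ _).trans ?_)
  refine (Finset.sum_le_sum (g := fun K => ENNReal.ofReal (10 ^ t.card *
    (n : ℝ) ^ (-(1 / 20) : ℝ) * (10 * (n : ℝ) ^ (-(103 / 100) : ℝ)) ^ (K \ t).card))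
    fun K hK => ?_).trans ?_
  · by_cases hKn : K.card ≤ n
    · exact (measure_mono fun e he => he.2).trans
        (measure_lt_projSq_subDesign_le hX hn hε hv (Finset.mem_filter.1 hK).2 hKn)
    · simp [hKn]
  · rw [← ENNReal.ofReal_sum_of_nonneg fun _ _ => by positivity, ← Finset.mul_sum]
    gcongr
    exact sum_pow_card_sdiff_le_exp t (by positivity)

lemma compl_typicalErrors_subset (X : Matrix (Fin n) (Fin p) ℝ) (t : Finset (Fin p)) (v : ℝ) :
    (typicalErrors X t v)ᶜ ⊆ {e | v * n / 20 ≤ |e ⬝ᵥ e - v * n|} ∪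
      {e | ∃ K : Finset (Fin p), t ⊆ K ∧ K.card ≤ n ∧
        2 * v * (21 / 20 * ((K \ t).card + 1 / 20) * Real.log n) < projSq (subDesign X K) e} := by
  intro e he
  by_contra! h
  simp only [Set.mem_union, Set.mem_ofPred_eq, not_or, not_le] at h
  have length_near := abs_lt.1 h.1
  exact he ⟨by linarith, by linarith, fun K htK hKn => not_lt.1 fun hlt => h.2 ⟨K, htK, hKn, hlt⟩⟩

lemma measure_compl_typicalErrors_le (hX : DesignEigenBounds X ε) (hn : 1 ≤ n) (hε : 0 < ε)
    (hv : 0 < v) (hεn : ε⁻¹ ≤ (n : ℝ) ^ (1 / 100 : ℝ)) (t : Finset (Fin p)) :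
    (Measure.pi fun _ : Fin n => gaussianReal 0 v) (typicalErrors X t v)ᶜ ≤
      ENNReal.ofReal (400 * Var[fun x => x ^ 2; gaussianReal 0 v] / v ^ 2 * (n : ℝ)⁻¹ +
        10 ^ t.card * Real.exp 10 * (n : ℝ) ^ (-(1 / 20) : ℝ)) := by
  have hn₀ : (0 : ℝ) < n := by exact_mod_cast hn
  have variance_nonneg : 0 ≤ Var[fun x => x ^ 2; gaussianReal 0 v] := variance_nonneg _ _
  have expected_exceedances_le : (p : ℝ) * (10 * (n : ℝ) ^ (-(103 / 100) : ℝ)) ≤ 10 := by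
    have p_le : (p : ℝ) ≤ (n : ℝ) ^ (102 / 100 : ℝ) := by
      calc (p : ℝ) ≤ n * (ε⁻¹ * ε⁻¹) := hX.card_le hn hε
        _ ≤ n * ((n : ℝ) ^ (1 / 100 : ℝ) * (n : ℝ) ^ (1 / 100 : ℝ)) := by gcongr
        _ = (n : ℝ) ^ (102 / 100 : ℝ) := by
            nth_rewrite 1 [← Real.rpow_one (n : ℝ)]
            rw [← Real.rpow_add hn₀, ← Real.rpow_add hn₀]
            norm_num
    have rpow_le_one : (n : ℝ) ^ (102 / 100 : ℝ) * (n : ℝ) ^ (-(103 / 100) : ℝ) ≤ 1 := by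
      rw [← Real.rpow_add hn₀]
      exact Real.rpow_le_one_of_one_le_of_nonpos (by exact_mod_cast hn) (by norm_num)
    have := mul_le_mul_of_nonneg_right p_le (Real.rpow_nonneg hn₀.le (-(103 / 100)))
    linarith
  refine (measure_mono (compl_typicalErrors_subset X t v)).trans ((measure_union_le _ _).trans ?_)
  rw [ENNReal.ofReal_add (by positivity) (by positivity)]
  refine add_le_add ?_ ?_
  · have := measure_le_abs_dotProduct_self_sub_le (Fin n) v (c := v * n / 20) (by positivity)
    rw [Fintype.card_fin] at this
    refine this.trans_eq (congrArg _ ?_)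
    field_simp
    norm_num
  · refine (measure_exists_lt_projSq_le hX hn hε hv t).trans (ENNReal.ofReal_le_ofReal ?_)
    rw [mul_right_comm]
    gcongr

end UnionBound

lemma tendsto_measure_typicalErrors_compl {p : ℕ → ℕ}
    {X : (n : ℕ) → Matrix (Fin n) (Fin (p n)) ℝ} {β₀ : ℕ →₀ ℝ}
    (hβ₀ : ∀ n, 1 ≤ n → ∀ j ∈ β₀.support, j < p n) {v : ℝ≥0} (hv : 0 < v) {ε : ℕ → ℝ}
    (hε : ∀ n, 1 ≤ n → 0 < ε n ∧ ε n < 1 ∧ DesignEigenBounds (X n) (ε n))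
    (hεO : ∀ η : ℝ, 0 < η → (fun n => (ε n)⁻¹) =O[atTop] fun n : ℕ => (n : ℝ) ^ η) :
    Tendsto (fun n => (Measure.pi fun _ : Fin n => gaussianReal 0 v)
      (typicalErrors (X n) (trueModel (p n) β₀) v)ᶜ) atTop (𝓝 0) := by
  have bound_tendsto : Tendsto (fun n : ℕ => ENNReal.ofReal
      (400 * Var[fun x => x ^ 2; gaussianReal 0 v] / v ^ 2 * (n : ℝ)⁻¹ +
        10 ^ β₀.support.card * Real.exp 10 * (n : ℝ) ^ (-(1 / 20) : ℝ))) atTop (𝓝 0) := by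
    rw [← ENNReal.ofReal_zero]
    refine ENNReal.tendsto_ofReal ?_
    have length := (tendsto_inv_atTop_nhds_zero_nat (𝕜 := ℝ)).const_mul
      (400 * Var[fun x => x ^ 2; gaussianReal 0 v] / v ^ 2)
    have projections := ((tendsto_rpow_neg_atTop (show (0 : ℝ) < 1 / 20 by norm_num)).comp
      tendsto_natCast_atTop_atTop).const_mul (10 ^ β₀.support.card * Real.exp 10)
    simpa using length.add projections
  refine tendsto_of_tendsto_of_tendsto_of_le_of_le' tendsto_const_nhds bound_tendsto
    (Eventually.of_forall fun _ => zero_le) ?_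
  filter_upwards [eventually_ge_atTop 1,
    eventually_inv_le_rpow hεO (show (0 : ℝ) < 1 / 100 by norm_num)] with n hn hεn
  rw [← card_trueModel (hβ₀ n hn)]
  exact measure_compl_typicalErrors_le (hε n hn).2.2 hn (hε n hn).1 hv hεn _

end Probability

section PosteriorRatio

variable {n p : ℕ} {X : Matrix (Fin n) (Fin p) ℝ} {A : Matrix (Fin p) (Fin p) ℝ}
  {r : ℕ} {α₁ α₂ q c₁ c₂ c : ℝ} {k t : Finset (Fin p)} {y : Fin n → ℝ}

lemma modelPrior_nonneg (q : ℝ) (hc₁ : 0 ≤ c₁) (c₂ : ℝ) (k : Finset (Fin p)) :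
    0 ≤ modelPrior q c₁ c₂ k :=
  div_nonneg (priorWeight_nonneg q hc₁ c₂ k)
    (Finset.sum_nonneg fun l _ => priorWeight_nonneg q hc₁ c₂ l)

lemma sum_modelPrior_mul_marginal_nonneg (hc₁ : 0 ≤ c₁) :
    0 ≤ ∑ l : Finset (Fin p), modelPrior q c₁ c₂ l * marginal X A r α₁ α₂ l y :=
  Finset.sum_nonneg fun l _ =>
    mul_nonneg (modelPrior_nonneg q hc₁ c₂ l) (marginal_nonneg X A r α₁ α₂ l y)

lemma posterior_nonneg (hc₁ : 0 ≤ c₁) : 0 ≤ posterior X A r α₁ α₂ q c₁ c₂ k y :=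
  div_nonneg (mul_nonneg (modelPrior_nonneg q hc₁ c₂ k) (marginal_nonneg X A r α₁ α₂ k y))
    (sum_modelPrior_mul_marginal_nonneg hc₁)

lemma posterior_le_mul_posterior (hc₁ : 0 ≤ c₁)
    (h : priorWeight q c₁ c₂ k * marginal X A r α₁ α₂ k y ≤
      c * (priorWeight q c₁ c₂ t * marginal X A r α₁ α₂ t y)) :
    posterior X A r α₁ α₂ q c₁ c₂ k y ≤ c * posterior X A r α₁ α₂ q c₁ c₂ t y := by
  rw [posterior, posterior, ← mul_div_assoc]
  refine div_le_div_of_nonneg_right ?_ (sum_modelPrior_mul_marginal_nonneg hc₁)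
  rw [modelPrior, modelPrior, div_mul_eq_mul_div, div_mul_eq_mul_div, ← mul_div_assoc]
  exact div_le_div_of_nonneg_right h
    (Finset.sum_nonneg fun l _ => priorWeight_nonneg q hc₁ c₂ l)

lemma maxPosteriorRatio_nonneg (hc₁ : 0 ≤ c₁) :
    0 ≤ maxPosteriorRatio X A r α₁ α₂ q c₁ c₂ t y :=
  Real.iSup_nonneg fun _ => div_nonneg (posterior_nonneg hc₁) (posterior_nonneg hc₁)

lemma maxPosteriorRatio_le (hc₁ : 0 ≤ c₁) (hc : 0 ≤ c)
    (h : ∀ k, k ≠ t → priorWeight q c₁ c₂ k * marginal X A r α₁ α₂ k y ≤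
      c * (priorWeight q c₁ c₂ t * marginal X A r α₁ α₂ t y)) :
    maxPosteriorRatio X A r α₁ α₂ q c₁ c₂ t y ≤ c :=
  Real.iSup_le (fun k => div_le_of_le_mul₀ (posterior_nonneg hc₁) hc
    (posterior_le_mul_posterior hc₁ (h k.1 k.2))) hc

lemma EigenvaluesBetween.mono {a₁ a₂ b : ℝ} (h : EigenvaluesBetween A a₁ a₂) (hb : a₂ ≤ b) :
    EigenvaluesBetween A a₁ b :=
  ⟨h.1, fun i => ⟨(h.2 i).1, (h.2 i).2.trans_le hb⟩⟩

end PosteriorRatio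

lemma isBigO_natCast_rpow_of_isBigO_log_rpow {f : ℕ → ℝ} {s : ℝ}
    (hf : f =O[atTop] fun n : ℕ => Real.log n ^ s) {η : ℝ} (hη : 0 < η) :
    f =O[atTop] fun n : ℕ => (n : ℝ) ^ η :=
  hf.trans ((isLittleO_log_rpow_rpow_atTop s hη).comp_tendsto tendsto_natCast_atTop_atTop).isBigO

end HyperPMOM

end

theorem theorem5p1_general
    {Ω : Type*} [MeasurableSpace Ω] (μ : Measure Ω) [IsProbabilityMeasure μ]
    (r : ℕ) (hr : 1 ≤ r)
    (α₁ α₂ : ℝ) (hα₁ : 0 < α₁) (hα₂ : 0 < α₂)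
    (c₁ c₂ : ℝ) (hc₁ : 0 < c₁) (hc₂ : 0 ≤ c₂)
    (p : ℕ → ℕ) (X : (n : ℕ) → Matrix (Fin n) (Fin (p n)) ℝ)
    (A : (n : ℕ) → Matrix (Fin (p n)) (Fin (p n)) ℝ) (q : ℕ → ℝ)
    (β₀ : ℕ →₀ ℝ) (ht : ∀ n, 1 ≤ n → ∀ j ∈ β₀.support, j < p n)
    (σ₀sq : ℝ≥0) (hσ₀ : 0 < σ₀sq)
    (e : (n : ℕ) → Fin n → Ω → ℝ)
    (he_law : ∀ n i, HasLaw (e n i) (gaussianReal 0 σ₀sq) μ)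
    (he_indep : ∀ n, iIndepFun (e n) μ)
    (ε : ℕ → ℝ) (hε : ∀ n, 1 ≤ n → 0 < ε n ∧ ε n < 1 ∧ HyperPMOM.DesignEigenBounds (X n) (ε n))
    (hεO : ∀ η : ℝ, 0 < η → (fun n => (ε n)⁻¹) =O[atTop] fun n : ℕ => (n : ℝ) ^ η)
    (ξ : ℝ) (hξ : ξ < 1) (hq : q =O[atTop] fun n : ℕ => (n : ℝ) ^ ξ)
    (htq : ∀ᶠ n in atTop, (β₀.support.card : ℝ) ≤ q n)
    (a₁ a₂ : ℝ) (ha₁ : 0 < a₁) (hA : ∀ n, 1 ≤ n → HyperPMOM.EigenvaluesBetween (A n) a₁ a₂) :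
    TendstoInMeasure μ
      (fun n ω => HyperPMOM.maxPosteriorRatio (X n) (A n) r α₁ α₂ (q n) c₁ c₂
        (HyperPMOM.trueModel (p n) β₀)
        (HyperPMOM.response (X n) β₀ fun i => e n i ω))
      atTop (fun _ => 0) := by
  obtain ⟨c, hc, ratio_le⟩ := HyperPMOM.exists_tendsto_zero_priorWeight_mul_marginal_le
    hr hα₁ hα₂ ha₁ (lt_max_of_lt_right one_pos : 0 < max a₂ 1) hc₁ hc₂ (NNReal.coe_pos.2 hσ₀)
    (fun n hn => (hA n hn).mono (le_max_left _ _)) (fun n hn => (hε n hn).1) hεO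
    (HyperPMOM.eventually_largeSample ht hε hεO hξ hq htq)
  have atypical_tendsto := HyperPMOM.tendsto_measure_typicalErrors_compl ht hσ₀ hε hεO
  rw [tendstoInMeasure_iff_dist]
  intro η hη
  refine tendsto_of_tendsto_of_tendsto_of_le_of_le' tendsto_const_nhds atypical_tendsto
    (Eventually.of_forall fun _ => zero_le) ?_
  filter_upwards [ratio_le, hc.eventually_lt_const hη] with n hn hcη
  have errors_law := (he_indep n).hasLaw_pi (he_law n)
  rw [← errors_law.map_eq]
  refine (measure_mono fun ω hω htyp => ?_).trans (Measure.le_map_apply errors_law.aemeasurable _)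
  have max_le := HyperPMOM.maxPosteriorRatio_le hc₁.le hn.1 (hn.2 _ htyp)
  rw [Set.mem_ofPred_eq, Real.dist_eq, sub_zero,
    abs_of_nonneg (HyperPMOM.maxPosteriorRatio_nonneg hc₁.le)] at hω
  exact absurd (hω.trans max_le) (not_le.2 hcη)

theorem theorem5p1
    {Ω : Type*} [MeasurableSpace Ω] (μ : Measure Ω) [IsProbabilityMeasure μ]
    -- order of the pMOM prior, hyperparameters, constants of the complexity prior
    (r : ℕ) (hr : 1 ≤ r)
    (α₁ α₂ : ℝ) (hα₁ : 0 < α₁) (hα₂ : 0 < α₂)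
    (c₁ c₂ : ℝ) (hc₁ : 0 < c₁) (hc₂ : 0 < c₂)
    -- dimensions, design matrices, prior scale matrices, bounds on the model size
    (p : ℕ → ℕ) (X : (n : ℕ) → Matrix (Fin n) (Fin (p n)) ℝ)
    (A : (n : ℕ) → Matrix (Fin (p n)) (Fin (p n)) ℝ) (q : ℕ → ℝ)
    -- the true coefficients and the true model, which do not depend on the sample size
    (β₀ : ℕ →₀ ℝ) (ht : ∀ n, 1 ≤ n → ∀ j ∈ β₀.support, j < p n)
    -- independent Gaussian errors with variance `σ₀²`
    (σ₀sq : ℝ≥0) (hσ₀ : 0 < σ₀sq)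
    (e : (n : ℕ) → Fin n → Ω → ℝ)
    (he_law : ∀ n i, HasLaw (e n i) (gaussianReal 0 σ₀sq) μ)
    (he_indep : ∀ n, iIndepFun (e n) μ)
    -- eigenvalues of the Gram matrices of all models
    (ε : ℕ → ℝ) (hε : ∀ n, 1 ≤ n → 0 < ε n ∧ ε n < 1 ∧ HyperPMOM.DesignEigenBounds (X n) (ε n))
    (hεO : (fun n => (ε n)⁻¹) =O[atTop] fun n : ℕ => Real.log n ^ (1 / 8 : ℝ))
    -- size of the models with positive prior probability
    (ξ : ℝ) (hξ : ξ < 1) (hq : q =O[atTop] fun n : ℕ => (n : ℝ) ^ ξ)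
    (htq : ∀ᶠ n in atTop, (β₀.support.card : ℝ) ≤ q n)
    -- eigenvalues of the prior scale matrices
    (a₁ a₂ : ℝ) (ha₁ : 0 < a₁) (hA : ∀ n, 1 ≤ n → HyperPMOM.EigenvaluesBetween (A n) a₁ a₂)
    -- growth of the number of covariates
    (κ : ℝ) (hκ₀ : 0 < κ) (hκ₁ : κ < 1)
    (hp : (fun n => Real.log (p n)) =O[atTop] fun n : ℕ => (n : ℝ) ^ κ) :
    TendstoInMeasure μ
      (fun n ω => HyperPMOM.maxPosteriorRatio (X n) (A n) r α₁ α₂ (q n) c₁ c₂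
        (HyperPMOM.trueModel (p n) β₀)
        (HyperPMOM.response (X n) β₀ fun i => e n i ω))
      atTop (fun _ => 0) :=
  theorem5p1_general μ r hr α₁ α₂ hα₁ hα₂ c₁ c₂ hc₁ hc₂.le p X A q β₀ ht σ₀sq hσ₀ e he_law he_indep
    ε hε (fun _ hη => HyperPMOM.isBigO_natCast_rpow_of_isBigO_log_rpow hεO hη) ξ hξ hq htq a₁ a₂ ha₁
    hA
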